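/- Let $k$ be a field and let $\mathcal C$ be a small category with an $\mathbb N$-grading, i.e. a functor $l:\mathcal C\to\mathbb N$ to the one-object category $\mathbb N$: $l(\mathrm{Id}_x)=0$ and $l(f\circ g)=l(f)+l(g)$. Assume that $\mathcal C$ is \emph{indiscretely based}: let $\mathcal C_0$ be the subcategory of all objects and all morphisms of length $0$; in each connected component of $\mathcal C_0$ there is exactly one morphism between any two objects. The category algebra $k\mathcal C$ is the (possibly non-unital) $k$-algebra with basis the morphisms of $\mathcal C$ and product $\alpha\beta=\alpha\circ\beta$ if $\alpha,\beta$ are composable, $0$ otherwise, graded by $l$. A graded algebra $A=\bigoplus_{j\ge 0}A_j$ is \emph{Koszul} if $A_0$ is semisimple (as a left module over itself it is a possibly infinite direct sum of simple modules) and the graded left $A$-module $A_0$ has a graded projective resolution $\cdots\to P^1\to P^0\to A_0\to 0$ with $P^i=AP^i_i$ for all $i$. For a morphism $p$ of $\mathcal C$ let $\mathcal C(p)$ be the semi-simplicial set whose $n$-simplices are the factorizations $p=f_0\circ\cdots\circ f_{n+1}$ into $n+2$ non-isomorphisms, modulo isomorphisms of the $n+1$ intermediate objects, with face operators $\partial_i$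 ($0\le i\le n$) composing $f_i$ and $f_{i+1}$. Its geometric realization $B\mathcal C(p)$ is the factorization space of $p$. The category $\mathcal C$ is \emph{locally bouquet} (over $k$) if for every morphism $p$ one has $\widetilde H^j(B\mathcal C(p);k)=0$ for all $j<\dim B\mathcal C(p)$. Here $\widetilde H^{*}$ is cellular, computed by the augmented cochain complex of $\mathcal C(p)$; the condition is empty if $B\mathcal C(p)=\emptyset$. \textbf{Theorem.} The category algebra $k\mathcal C$ is Koszul if and only if $\mathcal C$ is locally bouquet and every morphism of positive length in $\mathcal C$ is a composition of morphisms of length $1$. (In particular, if every morphism of positive length is a composition of morphisms of length $1$, then $k\mathcal C$ is Koszul if and only if $\mathcal C$ is locally bouquet; and Koszulity implies locally bouquet without this assumption.) -/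

import Mathlib

open CategoryTheory

universe w v u

/-! ## Koszul algebras

Algebras here are associative algebras over a field `k` which need not have a unit. -/

section Koszul

variable (k : Type*) [Field k] {A : Type w} [NonUnitalRing A] [Module k A]
  [IsScalarTower k A A] [SMulCommClass k A A]

/-- The projection of an `ℕ`-graded algebra onto its degree zero part is multiplicative. -/
theorem GradedAlg.decompose_zero_mul {k : Type*} [Field k] {A : Type w} [NonUnitalRing A]
    [Module k A] (𝒜 : ℕ → Submodule k A) [SetLike.GradedMul 𝒜] [DirectSum.Decomposition 𝒜]
    (a b : A) :
    (DirectSum.decompose 𝒜 (a * b) 0 : A) =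
      (DirectSum.decompose 𝒜 a 0 : A) * (DirectSum.decompose 𝒜 b 0 : A) := by
  classical
  induction a using DirectSum.Decomposition.inductionOn 𝒜 with
  | zero => simp
  | add a a' ha ha' => simp [add_mul, ha, ha']
  | @homogeneous i a =>
    induction b using DirectSum.Decomposition.inductionOn 𝒜 with
    | zero => simp
    | add b b' hb hb' => simp [mul_add, hb, hb']
    | @homogeneous j b =>
      have hab : (a : A) * (b : A) ∈ 𝒜 (i + j) := SetLike.GradedMul.mul_mem a.2 b.2
      rw [DirectSum.decompose_of_mem 𝒜 hab, DirectSum.decompose_coe, DirectSum.decompose_coe]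
      simp only [DirectSum.coe_of_apply]
      rcases Nat.eq_zero_or_pos i with rfl | hi
      · rcases Nat.eq_zero_or_pos j with rfl | hj
        · simp
        · rw [if_neg (by omega), if_neg (by omega : ¬ j = 0)]
          simp
      · rw [if_neg (by omega), if_neg (by omega : ¬ i = 0)]
        simp

/-- The degree zero component, as a linear map `A → A₀`. -/
noncomputable def GradedAlg.projZero (𝒜 : ℕ → Submodule k A) [DirectSum.Decomposition 𝒜] :
    A →ₗ[k] 𝒜 0 :=
  (DirectSum.component k ℕ (fun i => 𝒜 i) 0).comp (DirectSum.decomposeLinearEquiv 𝒜).toLinearMap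

/-- A `ℤ`-graded left module over the `ℕ`-graded algebra `A = ⨁ 𝒜 i`: a vector space with a
linear action of `A`, and a decomposition `⨁ deg j` such that `A_i M_j ⊆ M_{i+j}`. -/
structure GrModule (𝒜 : ℕ → Submodule k A) where
  carrier : Type w
  [addCommGroup : AddCommGroup carrier]
  [module : Module k carrier]
  act : A →ₙₐ[k] Module.End k carrier
  deg : ℤ → Submodule k carrier
  isInternal : DirectSum.IsInternal deg
  act_mem : ∀ {i : ℕ} {j : ℤ} {a : A} {m : carrier}, a ∈ 𝒜 i → m ∈ deg j →
    act a m ∈ deg (i + j)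

attribute [instance] GrModule.addCommGroup GrModule.module

namespace GrModule

variable {k} {𝒜 : ℕ → Submodule k A}

/-- Morphisms of graded modules: `A`-linear maps preserving degrees. -/
structure Hom (M N : GrModule k 𝒜) where
  toLin : M.carrier →ₗ[k] N.carrier
  map_act : ∀ (a : A) (m : M.carrier), toLin (M.act a m) = N.act a (toLin m)
  map_deg : ∀ {j : ℤ} {m : M.carrier}, m ∈ M.deg j → toLin m ∈ N.deg j

/-- Projective objects of the category of graded modules. -/
def IsProjective (P : GrModule k 𝒜) : Prop :=
  ∀ (M N : GrModule k 𝒜) (g : Hom M N) (f : Hom P N), Function.Surjective g.toLin →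
    ∃ h : Hom P M, ∀ x, g.toLin (h.toLin x) = f.toLin x

/-- `M` is generated by its component of degree `i`, that is `M = A M_i`. -/
def GeneratedInDegree (M : GrModule k 𝒜) (i : ℤ) : Prop :=
  Submodule.span k {x | ∃ (a : A) (m : M.carrier), m ∈ M.deg i ∧ M.act a m = x} = ⊤

/-- `A₀` as a graded left `A`-module: it sits in degree zero and an element of `A` acts as left
multiplication by its component of degree zero. -/
noncomputable def degZero (𝒜 : ℕ → Submodule k A) [SetLike.GradedMul 𝒜]
    [DirectSum.Decomposition 𝒜] : GrModule k 𝒜 where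
  carrier := 𝒜 0
  act :=
    { toFun := fun a =>
        { toFun := fun x => ⟨(GradedAlg.projZero k 𝒜 a : A) * x,
            SetLike.GradedMul.mul_mem (A := 𝒜) (i := 0) (j := 0)
              (GradedAlg.projZero k 𝒜 a).2 x.2⟩
          map_add' := fun x y => Subtype.ext (mul_add _ _ _)
          map_smul' := fun c x => Subtype.ext (mul_smul_comm _ _ _) }
      map_smul' := fun c a => by
        ext x
        simp [smul_mul_assoc]
      map_zero' := by
        ext x
        simp
      map_add' := fun a b => by
        ext x
        simp [add_mul]
      map_mul' := fun a b => by
        ext x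
        have h : (GradedAlg.projZero k 𝒜 (a * b) : A) =
            (GradedAlg.projZero k 𝒜 a : A) * (GradedAlg.projZero k 𝒜 b : A) :=
          GradedAlg.decompose_zero_mul 𝒜 a b
        simp [h, mul_assoc] }
  deg := fun j => if j = 0 then ⊤ else ⊥
  isInternal := by
    rw [DirectSum.isInternal_submodule_iff_iSupIndep_and_iSup_eq_top]
    constructor
    · intro i
      by_cases hi : i = 0
      · have : (⨆ (j : ℤ) (_ : j ≠ i), (if j = 0 then (⊤ : Submodule k (𝒜 0)) else ⊥)) = ⊥ := by
          simp only [iSup_eq_bot]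
          intro j hj
          rw [if_neg (by omega)]
        rw [this]
        exact disjoint_bot_right
      · simp only [if_neg hi]
        exact disjoint_bot_left
    · refine eq_top_iff.2 (le_trans ?_ (le_iSup _ (0 : ℤ)))
      simp
  act_mem := by
    intro i j a m ha hm
    by_cases hj : j = 0
    · subst hj
      by_cases hi : i = 0
      · subst hi
        simp
      · have h0 : GradedAlg.projZero k 𝒜 a = 0 :=
          Subtype.ext (DirectSum.decompose_of_mem_ne 𝒜 ha hi)
        have : (⟨(GradedAlg.projZero k 𝒜 a : A) * m,
            SetLike.GradedMul.mul_mem (A := 𝒜) (i := 0) (j := 0)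
              (GradedAlg.projZero k 𝒜 a).2 m.2⟩ : 𝒜 0) = 0 := by
          apply Subtype.ext
          simp [h0]
        change (⟨(GradedAlg.projZero k 𝒜 a : A) * m, _⟩ : 𝒜 0) ∈ _
        rw [this]
        exact Submodule.zero_mem _
    · rw [if_neg hj] at hm
      rw [(Submodule.mem_bot k).1 hm, map_zero]
      exact Submodule.zero_mem _

end GrModule

/-- A simple left ideal of the (possibly non-unital) algebra `A₀`: a left ideal `I` with
`A₀ I ≠ 0` whose only sub-left-ideals are `0` and `I`. -/
structure IsSimpleLeftIdeal (A₀ : Submodule k A) (I : Submodule k A) : Prop where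
  le : I ≤ A₀
  mul_mem : ∀ a ∈ A₀, ∀ x ∈ I, a * x ∈ I
  mul_ne_zero : ∃ a ∈ A₀, ∃ x ∈ I, a * x ≠ 0
  eq_bot_or_eq : ∀ J : Submodule k A, J ≤ I → (∀ a ∈ A₀, ∀ x ∈ J, a * x ∈ J) → J = ⊥ ∨ J = I

/-- The subalgebra `A₀` is semisimple: as a left module over itself it is a (possibly infinite)
direct sum of simple modules. -/
def IsSemisimpleSubalgebra (A₀ : Submodule k A) : Prop :=
  ∃ S : Set (Submodule k A), (∀ I ∈ S, IsSimpleLeftIdeal k A₀ I) ∧ sSupIndep S ∧ sSup S = A₀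

/-- A positively graded algebra `A = ⨁ 𝒜 i` is Koszul if `A₀` is semisimple and the graded left
`A`-module `A₀` has a graded projective resolution `⋯ → P¹ → P⁰ → A₀ → 0` such that `Pⁱ` is
generated by its component of degree `i`. -/
structure IsKoszul (𝒜 : ℕ → Submodule k A) [SetLike.GradedMul 𝒜]
    [DirectSum.Decomposition 𝒜] : Prop where
  semisimple : IsSemisimpleSubalgebra k (𝒜 0)
  exists_resolution : ∃ (P : ℕ → GrModule k 𝒜) (d : ∀ i, (P (i + 1)).Hom (P i))
    (ε : (P 0).Hom (GrModule.degZero 𝒜)),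
    (∀ i, (P i).IsProjective) ∧ (∀ i, (P i).GeneratedInDegree i) ∧
    Function.Surjective ε.toLin ∧ Function.Exact (d 0).toLin ε.toLin ∧
    ∀ i, Function.Exact (d (i + 1)).toLin (d i).toLin

end Koszul

/-! ## Graded categories and category algebras -/

/-- An `ℕ`-grading on a category: a functor to `ℕ`, seen as a category with one object. -/
structure CatGrading (C : Type u) [Category.{v} C] where
  len : ∀ {x y : C}, (x ⟶ y) → ℕ
  len_id : ∀ x : C, len (𝟙 x) = 0
  len_comp : ∀ {x y z : C} (f : x ⟶ y) (g : y ⟶ z), len (f ≫ g) = len f + len g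

/-- The set of morphisms of a category. -/
structure CatMor (C : Type u) [Category.{v} C] where
  src : C
  tgt : C
  hom : src ⟶ tgt

/-- The category algebra: the vector space with basis the morphisms of `C`. -/
def CatAlg (k : Type w) [Field k] (C : Type u) [Category.{v} C] : Type (max u v w) :=
  CatMor C →₀ k

namespace CatAlg

variable (k : Type w) [Field k] (C : Type u) [Category.{v} C]

noncomputable instance : AddCommGroup (CatAlg k C) := inferInstanceAs (AddCommGroup (CatMor C →₀ k))

noncomputable instance : Module k (CatAlg k C) := inferInstanceAs (Module k (CatMor C →₀ k))

/-- The basis of the category algebra given by the morphisms. -/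
noncomputable def basis : Module.Basis (CatMor C) k (CatAlg k C) :=
  .ofRepr (LinearEquiv.refl k (CatMor C →₀ k))

variable {C}

open Classical in
/-- The product of two morphisms: `f ∘ g` if they are composable, `0` otherwise. -/
noncomputable def mulMor (f g : CatMor C) : CatAlg k C :=
  if h : g.tgt = f.src then basis k C ⟨g.src, f.tgt, g.hom ≫ eqToHom h ≫ f.hom⟩ else 0

variable (C)

/-- Multiplication of the category algebra, the bilinear extension of `mulMor`. -/
noncomputable def mulHom : CatAlg k C →ₗ[k] CatAlg k C →ₗ[k] CatAlg k C :=
  (basis k C).constr k fun f => (basis k C).constr k fun g => mulMor k f g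

noncomputable instance : Mul (CatAlg k C) := ⟨fun a b => mulHom k C a b⟩

variable {C}

theorem mul_def (a b : CatAlg k C) : a * b = mulHom k C a b := rfl

theorem basis_mul_basis (f g : CatMor C) : basis k C f * basis k C g = mulMor k f g := by
  rw [mul_def, mulHom, Module.Basis.constr_basis, Module.Basis.constr_basis]

theorem basis_mul_basis_comp {x y z : C} (f : x ⟶ y) (g : y ⟶ z) :
    basis k C ⟨y, z, g⟩ * basis k C ⟨x, y, f⟩ = basis k C ⟨x, z, f ≫ g⟩ := by
  rw [basis_mul_basis, mulMor, dif_pos rfl]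
  simp

theorem basis_mul_basis_ne (f g : CatMor C) (h : g.tgt ≠ f.src) :
    basis k C f * basis k C g = 0 := by
  rw [basis_mul_basis, mulMor, dif_neg h]

theorem basis_mul_assoc (f g h : CatMor C) :
    basis k C f * basis k C g * basis k C h = basis k C f * (basis k C g * basis k C h) := by
  obtain ⟨x, y, f⟩ := f
  obtain ⟨z, t, g⟩ := g
  obtain ⟨r, s, h⟩ := h
  by_cases h1 : t = x
  · subst h1
    by_cases h2 : s = z
    · subst h2
      simp only [basis_mul_basis_comp, Category.assoc]
    · rw [basis_mul_basis_comp, basis_mul_basis_ne k _ _ h2, basis_mul_basis_ne k _ _ h2,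
        mul_def, map_zero]
  · rw [basis_mul_basis_ne k _ _ h1, mul_def, map_zero, LinearMap.zero_apply]
    by_cases h2 : s = z
    · subst h2
      rw [basis_mul_basis_comp, basis_mul_basis_ne k _ _ h1]
    · rw [basis_mul_basis_ne k _ _ h2, mul_def, map_zero]

noncomputable instance : NonUnitalRing (CatAlg k C) where
  left_distrib a b c := by simp only [mul_def, map_add]
  right_distrib a b c := by simp only [mul_def, map_add, LinearMap.add_apply]
  zero_mul a := by simp only [mul_def, map_zero, LinearMap.zero_apply]
  mul_zero a := by simp only [mul_def, map_zero]
  mul_assoc a b c := by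
    let L : CatAlg k C →ₗ[k] CatAlg k C →ₗ[k] CatAlg k C →ₗ[k] CatAlg k C :=
      (mulHom k C).compr₂ (mulHom k C)
    let R : CatAlg k C →ₗ[k] CatAlg k C →ₗ[k] CatAlg k C →ₗ[k] CatAlg k C :=
      ((LinearMap.llcomp k (CatAlg k C) (CatAlg k C) (CatAlg k C)).flip ∘ₗ
        mulHom k C).flip ∘ₗ mulHom k C
    have hLR : L = R :=
      (basis k C).ext fun f => (basis k C).ext fun g => (basis k C).ext fun h =>
        basis_mul_assoc k f g h
    exact LinearMap.congr_fun (LinearMap.congr_fun (LinearMap.congr_fun hLR a) b) c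

instance : IsScalarTower k (CatAlg k C) (CatAlg k C) where
  smul_assoc c a b := by
    simp only [smul_eq_mul, mul_def, map_smul, LinearMap.smul_apply]

instance : SMulCommClass k (CatAlg k C) (CatAlg k C) where
  smul_comm c a b := by
    simp only [smul_eq_mul, mul_def, map_smul]

variable (l : CatGrading C)

/-- The grading of the category algebra induced by a grading of the category: the component of
degree `i` is spanned by the morphisms of length `i`. -/
noncomputable def grading (i : ℕ) : Submodule k (CatAlg k C) :=
  Submodule.span k (basis k C '' {f | l.len f.hom = i})

theorem basis_mem_grading (f : CatMor C) : basis k C f ∈ grading k l (l.len f.hom) :=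
  Submodule.subset_span ⟨f, rfl, rfl⟩

instance : SetLike.GradedMul (grading k l) where
  mul_mem {i j a b} ha hb := by
    induction ha using Submodule.span_induction with
    | zero => simp
    | add a a' _ _ h h' => rw [add_mul]; exact Submodule.add_mem _ h h'
    | smul c a _ h => rw [smul_mul_assoc]; exact Submodule.smul_mem _ _ h
    | mem a ha =>
      obtain ⟨⟨y, z, f⟩, rfl, rfl⟩ := ha
      induction hb using Submodule.span_induction with
      | zero => simp
      | add a a' _ _ h h' => rw [mul_add]; exact Submodule.add_mem _ h h'
      | smul c a _ h => rw [mul_smul_comm]; exact Submodule.smul_mem _ _ h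
      | mem b hb =>
        obtain ⟨⟨x, t, g⟩, rfl, rfl⟩ := hb
        by_cases h : t = y
        · subst h
          rw [basis_mul_basis_comp]
          exact Submodule.subset_span ⟨_, by simp [l.len_comp, add_comm], rfl⟩
        · rw [basis_mul_basis_ne k _ _ h]
          exact Submodule.zero_mem _

noncomputable instance : DirectSum.Decomposition (grading k l) :=
  .ofLinearMap _
    ((basis k C).constr k fun f =>
      DirectSum.lof k ℕ (fun i => grading k l i) (l.len f.hom) ⟨_, basis_mem_grading k l f⟩)
    (by
      refine (basis k C).ext fun f => ?_
      rw [LinearMap.comp_apply, Module.Basis.constr_basis, DirectSum.coeLinearMap_lof]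
      rfl)
    (by
      refine DirectSum.linearMap_ext _ fun i => LinearMap.ext fun x => ?_
      obtain ⟨x, hx⟩ := x
      simp only [LinearMap.comp_apply, DirectSum.coeLinearMap_lof, LinearMap.id_apply]
      induction hx using Submodule.span_induction with
      | zero => exact (map_zero _).trans (map_zero _).symm
      | add a b ha hb h h' =>
        rw [map_add, h, h', ← map_add]
        rfl
      | smul c a ha h =>
        rw [map_smul, h, ← map_smul]
        rfl
      | mem a ha =>
        obtain ⟨f, rfl, rfl⟩ := ha
        rw [Module.Basis.constr_basis])

end CatAlg

namespace CatGrading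

variable {C : Type u} [Category.{v} C] (l : CatGrading C)

/-- The class of morphisms of length zero. -/
def zeroLen : MorphismProperty C := fun _ _ f => l.len f = 0

instance : l.zeroLen.IsMultiplicative where
  id_mem x := l.len_id x
  comp_mem f g hf hg := by
    have hf' : l.len f = 0 := hf
    have hg' : l.len g = 0 := hg
    change l.len (f ≫ g) = 0
    rw [l.len_comp, hf', hg']

/-- The subcategory `C₀` of all objects of `C` and all morphisms of length zero. -/
abbrev ZeroPart : Type u := WideSubcategory l.zeroLen

end CatGrading

/-- A category is indiscrete if there is exactly one morphism between any two objects. -/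
def IsIndiscreteCat (D : Type u) [Category.{v} D] : Prop :=
  ∀ x y : D, Nonempty (Unique (x ⟶ y))

namespace CatGrading

variable {C : Type u} [Category.{v} C] (l : CatGrading C)

/-- A graded category is indiscretely based if each connected component of its degree zero part
is an indiscrete category. -/
def IndiscretelyBased : Prop :=
  ∀ j : CategoryTheory.ConnectedComponents l.ZeroPart, IsIndiscreteCat j.Component

/-- `l.IsCompOfLenOne f`: the morphism `f` is a composition of one or more morphisms of
length one. -/
inductive IsCompOfLenOne : ∀ {x y : C}, (x ⟶ y) → Prop
  | of {x y : C} (f : x ⟶ y) (hf : l.len f = 1) : IsCompOfLenOne f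
  | comp {x y z : C} (f : x ⟶ y) (g : y ⟶ z) (hf : IsCompOfLenOne f) (hg : IsCompOfLenOne g) :
      IsCompOfLenOne (f ≫ g)

/-- Every morphism of positive length is a composition of morphisms of length one. -/
def GeneratedInLenOne : Prop :=
  ∀ {x y : C} (f : x ⟶ y), 0 < l.len f → l.IsCompOfLenOne f

variable {l}

theorem len_eq_zero_of_isIso {x y : C} (f : x ⟶ y) [IsIso f] : l.len f = 0 := by
  have h := l.len_comp f (inv f)
  rw [IsIso.hom_inv_id, l.len_id] at h
  omega

theorem IndiscretelyBased.isIso_iff (h : l.IndiscretelyBased) {x y : C} (f : x ⟶ y) :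
    IsIso f ↔ l.len f = 0 := by
  refine ⟨fun _ => len_eq_zero_of_isIso f, fun hf => ?_⟩
  let X : l.ZeroPart := ⟨x⟩
  let Y : l.ZeroPart := ⟨y⟩
  let F : X ⟶ Y := ⟨f, hf⟩
  let j := CategoryTheory.ConnectedComponents.mk Y
  let X' : j.Component := ⟨X, Quotient.sound' (Zigzag.of_hom F)⟩
  let Y' : j.Component := ⟨Y, rfl⟩
  let F' : X' ⟶ Y' := ObjectProperty.homMk F
  obtain ⟨uYX⟩ := h j Y' X'
  obtain ⟨uX⟩ := h j X' X'
  obtain ⟨uY⟩ := h j Y' Y'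
  let G' : Y' ⟶ X' := uYX.default
  have h1 : F' ≫ G' = 𝟙 X' := (uX.uniq _).trans (uX.uniq _).symm
  have h2 : G' ≫ F' = 𝟙 Y' := (uY.uniq _).trans (uY.uniq _).symm
  refine ⟨G'.hom.hom, ?_, ?_⟩
  · exact congrArg (fun t : X' ⟶ X' => t.hom.hom) h1
  · exact congrArg (fun t : Y' ⟶ Y' => t.hom.hom) h2

theorem IndiscretelyBased.not_isIso_comp (h : l.IndiscretelyBased) {x y z : C} {f : x ⟶ y}
    {g : y ⟶ z} (hfg : ¬ IsIso f ∨ ¬ IsIso g) : ¬ IsIso (f ≫ g) := by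
  simp only [h.isIso_iff, l.len_comp] at hfg ⊢
  omega

end CatGrading

/-! ## Semi-simplicial sets and their reduced cohomology -/

/-- A semi-simplicial set: sets of `n`-simplices and face operators with
`∂ᵢ ∂ⱼ = ∂ⱼ₋₁ ∂ᵢ` for `i < j`. -/
structure SemiSimplicialSet where
  simplex : ℕ → Type w
  face : ∀ {n : ℕ}, Fin (n + 2) → simplex (n + 1) → simplex n
  face_face : ∀ {n : ℕ} (i j : Fin (n + 2)) (σ : simplex (n + 2)), i ≤ j →
    face i (face j.succ σ) = face j (face i.castSucc σ)

namespace SemiSimplicialSet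

variable (X : SemiSimplicialSet.{w})

/-- The dimension of the geometric realization: the supremum of the `n` for which there is an
`n`-simplex (and `⊥` if there is none). -/
noncomputable def dim : WithBot ℕ∞ :=
  ⨆ (n : ℕ) (_ : Nonempty (X.simplex n)), (n : WithBot ℕ∞)

/-- The simplices of the augmentation, with a shift of degrees: one empty simplex of degree `-1` for
`n = 0`, and the `(n-1)`-simplices for `n ≥ 1`. -/
def AugSimplex : ℕ → Type w
  | 0 => PUnit
  | n + 1 => X.simplex n

/-- Faces in the augmentation; the only face of a `0`-simplex is the empty simplex. -/
def augFace : ∀ {n : ℕ}, Fin (n + 1) → X.AugSimplex (n + 1) → X.AugSimplex n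
  | 0, _, _ => PUnit.unit
  | _ + 1, i, σ => X.face i σ

variable (k : Type*) [Field k]

/-- The differential `(δ φ)(σ) = ∑ (-1)ⁱ φ(∂ᵢ σ)` of the augmented cochain complex of `X`
with coefficients in `k`, from degree `n - 1` to degree `n`. -/
def coboundary (n : ℕ) : (X.AugSimplex n → k) →ₗ[k] (X.AugSimplex (n + 1) → k) where
  toFun φ σ := ∑ i : Fin (n + 1), (-1 : k) ^ (i : ℕ) * φ (X.augFace i σ)
  map_add' φ ψ := by
    ext σ
    simp [mul_add, Finset.sum_add_distrib]
  map_smul' c φ := by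
    ext σ
    simp [Finset.mul_sum, mul_left_comm]

/-- The reduced coboundaries of degree `n - 1`. -/
def boundaries : ∀ n : ℕ, Submodule k (X.AugSimplex n → k)
  | 0 => ⊥
  | n + 1 => LinearMap.range (X.coboundary k n)

/-- The reduced cohomology `H̃ⁿ⁻¹(|X|, k)` of the geometric realization of `X`, computed by its
cellular cochain complex. In particular for `n = 0` this is `H̃⁻¹`, which is `k` if `X` is
empty and `0` otherwise. -/
abbrev ReducedCohomology (n : ℕ) : Type _ :=
  LinearMap.ker (X.coboundary k n) ⧸
    (X.boundaries k n).submoduleOf (LinearMap.ker (X.coboundary k n))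

/-- `X` is bouquet (cohomologically, over `k`) if `H̃ʲ(|X|, k) = 0` for all `j < dim |X|`; below
`n = j + 1`, so that the condition `j < dim |X|` becomes `n ≤ dim |X|`. -/
def IsBouquet : Prop :=
  ∀ n : ℕ, (n : WithBot ℕ∞) ≤ X.dim → Subsingleton (X.ReducedCohomology k n)

end SemiSimplicialSet

/-! ## Factorization spaces -/

section Factorization

variable {C : Type u} [Category.{v} C]

/-- A nontrivial factorization of `p : x ⟶ y` into `n + 2` factors: the first factor
`x ⟶ z₀`, a sequence `z₀ ⟶ z₁ ⟶ ⋯ ⟶ zₙ` of `n` composable morphisms, and the last factor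
`zₙ ⟶ y`, all of them non-isomorphisms and with composition `p`. -/
structure NontrivFactorization {x y : C} (p : x ⟶ y) (n : ℕ) where
  mid : ComposableArrows C n
  first : x ⟶ mid.obj 0
  last : mid.obj (Fin.last n) ⟶ y
  first_not_isIso : ¬ IsIso first
  mid_not_isIso : ∀ i : Fin n, ¬ IsIso (mid.map (homOfLE i.castSucc_lt_succ.le))
  last_not_isIso : ¬ IsIso last
  fac : first ≫ mid.map (homOfLE (Fin.zero_le (Fin.last n))) ≫ last = p

namespace NontrivFactorization

variable {x y : C} {p : x ⟶ y}

/-- Two factorizations are equivalent if they differ by isomorphisms of the intermediate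
objects `z₀, …, zₙ`. -/
def setoid (p : x ⟶ y) (n : ℕ) : Setoid (NontrivFactorization p n) where
  r F G := ∃ e : F.mid ≅ G.mid, F.first ≫ e.hom.app 0 = G.first ∧
    e.hom.app (Fin.last n) ≫ G.last = F.last
  iseqv :=
    { refl := fun F => ⟨Iso.refl _, by simp, by simp⟩
      symm := by
        rintro F G ⟨e, h1, h2⟩
        refine ⟨e.symm, ?_, ?_⟩
        · rw [← h1]
          simp
        · rw [← h2]
          simp
      trans := by
        rintro F G H ⟨e, h1, h2⟩ ⟨e', h1', h2'⟩
        refine ⟨e ≪≫ e', ?_, ?_⟩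
        · rw [← h1', ← h1]
          simp
        · rw [← h2, ← h2']
          simp }

/-- The composition `zᵢ ⟶ zⱼ` of the factors between two intermediate objects. -/
def seg {n : ℕ} (F : NontrivFactorization p n) {i j : Fin (n + 1)} (hij : i ≤ j) :
    F.mid.obj i ⟶ F.mid.obj j :=
  F.mid.map (homOfLE hij)

theorem seg_seg {n : ℕ} (F : NontrivFactorization p n) {i j r : Fin (n + 1)} (hij : i ≤ j)
    (hjr : j ≤ r) : F.seg hij ≫ F.seg hjr = F.seg (hij.trans hjr) := by
  unfold seg
  rw [← Functor.map_comp]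
  rfl

theorem seg_not_isIso {l : CatGrading C} (h : l.IndiscretelyBased) {n : ℕ}
    (F : NontrivFactorization p n) {i j : Fin (n + 1)} (hij : i < j) :
    ¬ IsIso (F.seg hij.le) := by
  have hi : (i : ℕ) < n := by omega
  let i' : Fin n := ⟨i, hi⟩
  have h1 : i'.castSucc ≤ i'.succ := i'.castSucc_lt_succ.le
  have h2 : i'.succ ≤ j := by
    rw [Fin.le_def]
    simpa [i'] using hij
  have key : F.seg hij.le = F.seg h1 ≫ F.seg h2 := (F.seg_seg h1 h2).symm
  rw [key]
  exact h.not_isIso_comp (Or.inl (F.mid_not_isIso i'))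

theorem restrict_fac {m n : ℕ} (α : Fin (m + 1) ↪o Fin (n + 1)) (F : NontrivFactorization p n) :
    (F.first ≫ F.seg (Fin.zero_le (α 0))) ≫
      F.seg (α.monotone (Fin.zero_le (Fin.last m))) ≫
        F.seg (Fin.le_last (α (Fin.last m))) ≫ F.last = p := by
  have h1 : F.seg (Fin.zero_le (α 0)) ≫ F.seg (α.monotone (Fin.zero_le (Fin.last m))) ≫
      F.seg (Fin.le_last (α (Fin.last m))) = F.seg (Fin.zero_le (Fin.last n)) := by
    rw [seg_seg, seg_seg]
  calc _ = F.first ≫ (F.seg (Fin.zero_le (α 0)) ≫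
        F.seg (α.monotone (Fin.zero_le (Fin.last m))) ≫
          F.seg (Fin.le_last (α (Fin.last m)))) ≫ F.last := by simp only [Category.assoc]
    _ = p := by
      rw [h1]
      exact F.fac

/-- The factorization obtained by keeping only the intermediate objects in the image of a strictly
increasing map, composing the morphisms in between. -/
def restrict {l : CatGrading C} (h : l.IndiscretelyBased) {m n : ℕ}
    (α : Fin (m + 1) ↪o Fin (n + 1)) (F : NontrivFactorization p n) :
    NontrivFactorization p m where
  mid := α.monotone.functor ⋙ F.mid
  first := F.first ≫ F.seg (Fin.zero_le (α 0))
  last := F.seg (Fin.le_last (α (Fin.last m))) ≫ F.last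
  first_not_isIso := h.not_isIso_comp (Or.inl F.first_not_isIso)
  mid_not_isIso i := F.seg_not_isIso h (α.strictMono i.castSucc_lt_succ)
  last_not_isIso := h.not_isIso_comp (Or.inr F.last_not_isIso)
  fac := F.restrict_fac α

theorem restrict_rel {l : CatGrading C} (h : l.IndiscretelyBased) {m n : ℕ}
    (α : Fin (m + 1) ↪o Fin (n + 1)) {F G : NontrivFactorization p n}
    (hFG : setoid p n F G) : setoid p m (F.restrict h α) (G.restrict h α) := by
  obtain ⟨e, h1, h2⟩ := hFG
  have nat : ∀ {i j : Fin (n + 1)} (hij : i ≤ j),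
      F.seg hij ≫ e.hom.app j = e.hom.app i ≫ G.seg hij := fun hij => e.hom.naturality _
  refine ⟨Functor.isoWhiskerLeft _ e, ?_, ?_⟩
  · change (F.first ≫ F.seg _) ≫ e.hom.app (α 0) = G.first ≫ G.seg _
    rw [← h1, Category.assoc, Category.assoc, nat]
  · change e.hom.app (α (Fin.last m)) ≫ G.seg _ ≫ G.last = F.seg _ ≫ F.last
    rw [← h2, ← Category.assoc, ← Category.assoc, nat]

theorem restrict_restrict {l : CatGrading C} (h : l.IndiscretelyBased) {m n r : ℕ}
    (α : Fin (m + 1) ↪o Fin (n + 1)) (β : Fin (n + 1) ↪o Fin (r + 1))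
    (F : NontrivFactorization p r) :
    (F.restrict h β).restrict h α = F.restrict h (α.trans β) := by
  have h1 : (F.first ≫ F.seg (Fin.zero_le (β 0))) ≫ F.seg (β.monotone (Fin.zero_le (α 0))) =
      F.first ≫ F.seg (Fin.zero_le (β (α 0))) := by
    rw [Category.assoc, seg_seg]
  have h2 : F.seg (β.monotone (Fin.le_last (α (Fin.last m)))) ≫
      F.seg (Fin.le_last (β (Fin.last n))) ≫ F.last =
        F.seg (Fin.le_last (β (α (Fin.last m)))) ≫ F.last := by
    rw [← Category.assoc, seg_seg]
  unfold restrict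
  congr 1

end NontrivFactorization

/-- The semi-simplicial set `C(p)`: its `n`-simplices are the nontrivial factorizations of `p` into
`n + 2` factors up to equivalence, and the operator `∂ᵢ` deletes the intermediate object `zᵢ`,
that is, it composes the two consecutive factors which meet there. -/
def factorizationSet {l : CatGrading C} (h : l.IndiscretelyBased) {x y : C} (p : x ⟶ y) :
    SemiSimplicialSet.{max u v} where
  simplex n := Quotient (NontrivFactorization.setoid p n)
  face i := Quotient.map (NontrivFactorization.restrict h (Fin.succAboveOrderEmb i))
    fun _ _ hFG => NontrivFactorization.restrict_rel h _ hFG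
  face_face {n} i j σ hij := by
    induction σ using Quotient.inductionOn with
    | h F =>
      simp only [Quotient.map_mk, NontrivFactorization.restrict_restrict]
      congr 2
      ext a
      simp only [RelEmbedding.coe_trans, Function.comp_apply, Fin.succAboveOrderEmb_apply,
        Fin.succAbove, Fin.lt_def]
      have hij' : (i : ℕ) ≤ j := hij
      split_ifs <;> simp_all <;> omega

/-- A graded, indiscretely based category is locally bouquet (over `k`) if the semi-simplicial set
`C(p)` is bouquet for every morphism `p`. -/
def CatGrading.LocallyBouquet (k : Type*) [Field k] {l : CatGrading C}
    (h : l.IndiscretelyBased) : Prop :=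
  ∀ {x y : C} (p : x ⟶ y), (factorizationSet h p).IsBouquet k

end Factorization

/-!
The proof computes the obstruction to the existence of a linear resolution of `A₀`, where `A = kC`,
by a cobar complex, and identifies this complex with a product of the augmented cochain complexes of
the factorization sets `C(p)`.

Since `C` is indiscretely based, graded modules over `A` on which the identities act as local units
are functors on a one-way category `GrObj hC`: an object is a component of `C₀` together with a
degree, and an endomorphism is an identity. Instead of projective resolutions of left modules, the
argument uses their duals, which are right modules over the one-way category. For a right module `N`
and an object `b`, the groups `Extⁿ(S, N)`, where `S` is the simple module supported at `b`, are the
cohomology of the cobar complex `N b → cosyz N b → cosyz (cosyz N) b → ⋯`, obtained by iterating the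
cokernel `cosyz N` of the embedding of `N` into a coinduced module; only their vanishing,
`RightMod.ExtVanishes`, is needed. The usual dimension shifting works: there are long exact
sequences (`IsShortExact.extVanishes_succ_left`, `IsShortExact.extVanishes_right`), and coinduced
modules and their retracts are acyclic (`IsRetract.extVanishes_of_coind`), which applies to the
duals of projective modules (`GrModule.IsProjective.dual_isRetract`). A module which vanishes in
degrees below `i` is generated in degree `i` exactly if the socle of its dual is concentrated in
degree `i` (`GeneratedInDegree.extVanishes_zero` and the Nakayama lemma `Unital.generatedInDegree`).
Hence a linear resolution of `A₀` exists if and only if `Extⁿ` for the dual of `A₀` is concentrated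
in degree `n` (`GrModule.exists_resolution_iff`): one direction shifts dimensions along the given
resolution, the other one builds the minimal free resolution. The semisimplicity of `A₀` is
automatic (`CatAlg.isSemisimpleSubalgebra_grading_zero`).

Morphisms of positive length act by zero on the dual of `A₀`, so its cobar complex is the complex of
cochains on chains of non-identities of the one-way category, with alternating sums of faces as
differential (`RightMod.extVanishes_succ_iff`). A chain from degree zero to `b` is the same as a
morphism `p` of length `b.deg` with a simplex of the augmentation of `C(p)`, because choosing a
representative in each component of `C₀` removes the isomorphisms of the intermediate objects
(`CatGrading.Cell.simplex_injective`, `CatGrading.Cell.simplex_surjective`). So `A` is Koszul if and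
only if for each `p` the augmented cochain complex of `C(p)` is exact in degrees `j < len p - 2`
(`isKoszul_iff_subsingleton_reducedCohomology`).

It remains to compare `len p - 2` with `dim C(p)`. Always `dim C(p) ≤ len p - 2`, with equality if
`len p ≥ 2` and all morphisms of positive length are compositions of morphisms of length one
(`NontrivFactorization.add_two_le_len`, `GeneratedInLenOne.nonempty_factorization`). Conversely,
exactness in degree `-1` says that `C(p)` is not empty, that is, that `p` is decomposable, whenever
`len p ≥ 2`; by induction on the length, `C` is generated by morphisms of length one.
-/

/-! ### Right modules over one-way categories and the cobar complex -/

/-- A one-way category: objects have degrees, morphisms do not lower the degree, and the only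
morphisms that preserve it are the identities. -/
class OneWayCat (D : Type u) [Category.{v} D] where
  deg : D → ℤ
  deg_le : ∀ {a b : D}, (a ⟶ b) → deg a ≤ deg b
  eq_of_deg_eq : ∀ {a b : D} (f : a ⟶ b), deg a = deg b → ∃ h : a = b, f = eqToHom h

open OneWayCat

/-- A right module over a category: a contravariant functor to vector spaces. -/
structure RightMod (k : Type w) [Field k] (D : Type u) [Category.{v} D] where
  obj : D → Type (max u v w)
  [addCommGroup : ∀ b, AddCommGroup (obj b)]
  [module : ∀ b, Module k (obj b)]
  map : ∀ {a b : D}, (a ⟶ b) → obj b →ₗ[k] obj a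
  map_id : ∀ (b : D) (v : obj b), map (𝟙 b) v = v
  map_comp : ∀ {a b c : D} (f : a ⟶ b) (g : b ⟶ c) (v : obj c), map (f ≫ g) v = map f (map g v)

namespace RightMod

attribute [instance] RightMod.addCommGroup RightMod.module

variable {k : Type w} [Field k] {D : Type u} [Category.{v} D]

/-- Morphisms of right modules. -/
structure Hom (N N' : RightMod.{w, v, u} k D) where
  app : ∀ b, N.obj b →ₗ[k] N'.obj b
  naturality : ∀ {a b : D} (f : a ⟶ b) (v : N.obj b), app a (N.map f v) = N'.map f (app b v)

/-- Short exact sequences of right modules. -/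
structure IsShortExact {N₁ N₂ N₃ : RightMod.{w, v, u} k D} (i : Hom N₁ N₂) (p : Hom N₂ N₃) :
    Prop where
  injective : ∀ b, Function.Injective (i.app b)
  surjective : ∀ b, Function.Surjective (p.app b)
  exact : ∀ b, Function.Exact (i.app b) (p.app b)

/-- `N` is a retract of `N'`. -/
def IsRetract (N N' : RightMod.{w, v, u} k D) : Prop :=
  ∃ (i : Hom N N') (r : Hom N' N), ∀ b v, r.app b (i.app b v) = v

/-- The coinduced module on the vector spaces `N b`. -/
@[reducible]
def coind (N : RightMod.{w, v, u} k D) : RightMod.{w, v, u} k D where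
  obj b := ∀ a, (a ⟶ b) → N.obj a
  map g :=
    { toFun := fun w a f => w a (f ≫ g)
      map_add' := fun _ _ => rfl
      map_smul' := fun _ _ => rfl }
  map_id b w := by
    funext a f
    simp
  map_comp f g w := by
    funext a h
    simp

theorem IsRetract.trans {N N' N'' : RightMod.{w, v, u} k D} (h : IsRetract N N')
    (h' : IsRetract N' N'') : IsRetract N N'' := by
  obtain ⟨i, r, h⟩ := h
  obtain ⟨i', r', h'⟩ := h'
  refine ⟨⟨fun b => i'.app b ∘ₗ i.app b, fun f v => ?_⟩,
    ⟨fun b => r.app b ∘ₗ r'.app b, fun f v => ?_⟩, fun b v => ?_⟩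
  · simp [i.naturality, i'.naturality]
  · simp [r.naturality, r'.naturality]
  · simp [h, h']

variable [OneWayCat D]

open Classical in
/-- The cosyzygy of `N`, the cokernel of the embedding of `N` into the coinduced module on `N`.
The class of `w` is represented by the values `w f - N.map f (w 𝟙)` at the non-identities `f`,
which accounts for the twisted action. -/
@[reducible]
noncomputable def cosyz (N : RightMod.{w, v, u} k D) : RightMod.{w, v, u} k D where
  obj b := ∀ a : D, {_f : a ⟶ b // deg a < deg b} → N.obj a
  map {b c} g :=
    { toFun := fun ψ a f => ψ a ⟨f.1 ≫ g, f.2.trans_le (deg_le g)⟩ -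
        if h' : deg b < deg c then N.map f.1 (ψ b ⟨g, h'⟩) else 0
      map_add' := fun ψ ψ' => by
        funext a f
        simp only [Pi.add_apply]
        split_ifs
        · rw [map_add]; abel
        · abel
      map_smul' := fun r ψ => by
        funext a f
        simp only [Pi.smul_apply, RingHom.id_apply]
        split_ifs
        · rw [map_smul, smul_sub]
        · simp }
  map_id b ψ := by
    funext a f
    simp
  map_comp {b c e} g g' ψ := by
    funext a ⟨f, h⟩
    simp only [LinearMap.coe_mk, AddHom.coe_mk, Category.assoc]
    rcases (deg_le g).lt_or_eq with hg | hg
    · rcases (deg_le g').lt_or_eq with hg' | hg'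
      · simp only [dif_pos hg, dif_pos hg', dif_pos (hg.trans hg'), N.map_comp, map_sub]
        abel
      · obtain ⟨rfl, rfl⟩ := eq_of_deg_eq g' hg'
        simp [hg]
    · obtain ⟨rfl, rfl⟩ := eq_of_deg_eq g hg
      simp

variable (N : RightMod.{w, v, u} k D)

open Classical in
theorem cosyz_map_apply {b c : D} (g : b ⟶ c) (ψ : N.cosyz.obj c) {a : D}
    (f : {_f : a ⟶ b // deg a < deg b}) :
    N.cosyz.map g ψ a f = ψ a ⟨f.1 ≫ g, f.2.trans_le (deg_le g)⟩ -
      if h' : deg b < deg c then N.map f.1 (ψ b ⟨g, h'⟩) else 0 := rfl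

theorem cosyz_map_of_lt {b c : D} (g : b ⟶ c) (ψ : N.cosyz.obj c) {a : D} (f : a ⟶ b)
    (h : deg a < deg b) (h' : deg b < deg c) :
    N.cosyz.map g ψ a ⟨f, h⟩ = ψ a ⟨f ≫ g, h.trans h'⟩ - N.map f (ψ b ⟨g, h'⟩) := by
  refine (cosyz_map_apply N g ψ ⟨f, h⟩).trans ?_
  rw [dif_pos h']

/-- The first differential of the cobar complex, restricting an element along all
non-identities. -/
def toCosyz (b : D) : N.obj b →ₗ[k] N.cosyz.obj b where
  toFun v := fun _ f => N.map f.1 v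
  map_add' v v' := by
    funext a f
    exact map_add _ _ _
  map_smul' c v := by
    funext a f
    exact map_smul _ _ _

/-- The vanishing at `b` of the `n`-th cohomology of the cobar complex
`N b → cosyz N b → cosyz (cosyz N) b → ⋯` of `N`, which is `Extⁿ(S, N)` for the simple module
`S` supported at `b`. -/
def ExtVanishes : ℕ → RightMod.{w, v, u} k D → D → Prop
  | 0, N, b => ∀ v : N.obj b, N.toCosyz b v = 0 → v = 0
  | 1, N, b => ∀ ψ : N.cosyz.obj b, N.cosyz.toCosyz b ψ = 0 → ∃ v, N.toCosyz b v = ψ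
  | n + 2, N, b => ExtVanishes (n + 1) N.cosyz b

variable {N}

theorem toCosyz_apply {b : D} (v : N.obj b) {a : D} (f : a ⟶ b) (h : deg a < deg b) :
    N.toCosyz b v a ⟨f, h⟩ = N.map f v := rfl

theorem toCosyz_toCosyz {b : D} (v : N.obj b) : N.cosyz.toCosyz b (N.toCosyz b v) = 0 := by
  funext a ⟨f, h⟩
  funext c ⟨g, h'⟩
  rw [toCosyz_apply, cosyz_map_of_lt _ _ _ _ _ h, toCosyz_apply, toCosyz_apply, N.map_comp,
    sub_self]
  rfl

/-- The cosyzygy is functorial. -/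
noncomputable def Hom.cosyz {N N' : RightMod.{w, v, u} k D} (F : Hom N N') :
    Hom N.cosyz N'.cosyz where
  app b :=
    { toFun := fun ψ a f => F.app a (ψ a f)
      map_add' := fun ψ ψ' => by
        funext a f
        exact map_add _ _ _
      map_smul' := fun c ψ => by
        funext a f
        exact map_smul _ _ _ }
  naturality {b c} g ψ := by
    funext a f
    change F.app a (N.cosyz.map g ψ a f) = N'.cosyz.map g (fun a f => F.app a (ψ a f)) a f
    rw [cosyz_map_apply, cosyz_map_apply, map_sub]
    split_ifs
    · rw [F.naturality]
    · rw [map_zero]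

theorem Hom.toCosyz {N N' : RightMod.{w, v, u} k D} (F : Hom N N') {b : D} (v : N.obj b) :
    F.cosyz.app b (N.toCosyz b v) = N'.toCosyz b (F.app b v) := by
  funext a f
  exact F.naturality f.1 v

theorem IsShortExact.cosyz {N₁ N₂ N₃ : RightMod.{w, v, u} k D} {i : Hom N₁ N₂} {p : Hom N₂ N₃}
    (h : IsShortExact i p) : IsShortExact i.cosyz p.cosyz where
  injective b ψ ψ' e := by
    funext a f
    exact h.injective a (congrFun (congrFun e a) f)
  surjective b ψ := by
    choose s hs using fun a => h.surjective a
    refine ⟨fun a f => s a (ψ a f), ?_⟩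
    funext a f
    exact hs a _
  exact b ψ := by
    constructor
    · intro e
      choose s hs using fun (a : D) (f : {_f : a ⟶ b // deg a < deg b}) =>
        (h.exact a (ψ a f)).1 (congrFun (congrFun e a) f)
      refine ⟨s, ?_⟩
      funext a f
      exact hs a f
    · rintro ⟨χ, rfl⟩
      funext a f
      exact (h.exact a _).2 ⟨_, rfl⟩

variable {N₁ N₂ N₃ : RightMod.{w, v, u} k D} {i : Hom N₁ N₂} {p : Hom N₂ N₃}

/-- The part `Extⁿ(S, N₃) → Extⁿ⁺¹(S, N₁) → Extⁿ⁺¹(S, N₂)` of the long exact sequence. -/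
theorem IsShortExact.extVanishes_succ_left (h : IsShortExact i p) {b : D} {n : ℕ}
    (h₃ : ExtVanishes n N₃ b) (h₂ : ExtVanishes (n + 1) N₂ b) :
    ExtVanishes (n + 1) N₁ b := by
  induction n using Nat.twoStepInduction generalizing N₁ N₂ N₃ with
  | zero =>
    intro φ hφ
    obtain ⟨ψ, hψ⟩ := h₂ (i.cosyz.app b φ) (by rw [← Hom.toCosyz, hφ, map_zero])
    have h0 : p.app b ψ = 0 := h₃ _ (by
      rw [← Hom.toCosyz, hψ]
      exact (h.cosyz.exact b _).2 ⟨_, rfl⟩)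
    obtain ⟨v, rfl⟩ := (h.exact b ψ).1 h0
    exact ⟨v, h.cosyz.injective b (by rw [Hom.toCosyz, hψ])⟩
  | one =>
    intro φ hφ
    obtain ⟨ψ, hψ⟩ := h₂ (i.cosyz.cosyz.app b φ) (by rw [← Hom.toCosyz, hφ, map_zero])
    obtain ⟨χ, hχ⟩ := h₃ (p.cosyz.app b ψ) (by
      rw [← Hom.toCosyz, hψ]
      exact (h.cosyz.cosyz.exact b _).2 ⟨_, rfl⟩)
    obtain ⟨χ, rfl⟩ := h.surjective b χ
    obtain ⟨v, hv⟩ := (h.cosyz.exact b (ψ - N₂.toCosyz b χ)).1 (by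
      rw [map_sub, Hom.toCosyz, hχ, sub_self])
    refine ⟨v, h.cosyz.cosyz.injective b ?_⟩
    rw [Hom.toCosyz, hv, map_sub, hψ, toCosyz_toCosyz, sub_zero]
  | more n _ ih => exact ih h.cosyz h₃ h₂

/-- The part `Extⁿ(S, N₂) → Extⁿ(S, N₃) → Extⁿ⁺¹(S, N₁)` of the long exact sequence. -/
theorem IsShortExact.extVanishes_right (h : IsShortExact i p) {b : D} {n : ℕ}
    (h₁ : ExtVanishes (n + 1) N₁ b) (h₂ : ExtVanishes n N₂ b) : ExtVanishes n N₃ b := by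
  induction n using Nat.twoStepInduction generalizing N₁ N₂ N₃ with
  | zero =>
    intro v hv
    obtain ⟨ψ, rfl⟩ := h.surjective b v
    obtain ⟨χ, hχ⟩ := (h.cosyz.exact b (N₂.toCosyz b ψ)).1 (by rw [Hom.toCosyz, hv])
    obtain ⟨χ', hχ'⟩ := h₁ χ (h.cosyz.cosyz.injective b (by
      rw [Hom.toCosyz, hχ, toCosyz_toCosyz, map_zero]))
    have h0 : ψ - i.app b χ' = 0 := h₂ _ (by
      rw [map_sub, ← hχ, ← Hom.toCosyz, hχ', sub_self])
    rw [sub_eq_zero.1 h0]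
    exact (h.exact b _).2 ⟨_, rfl⟩
  | one =>
    intro v hv
    obtain ⟨ψ, rfl⟩ := h.cosyz.surjective b v
    obtain ⟨χ, hχ⟩ := (h.cosyz.cosyz.exact b (N₂.cosyz.toCosyz b ψ)).1 (by
      rw [Hom.toCosyz, hv])
    obtain ⟨χ', hχ'⟩ := h₁ χ (h.cosyz.cosyz.cosyz.injective b (by
      rw [Hom.toCosyz, hχ, toCosyz_toCosyz, map_zero]))
    obtain ⟨θ, hθ⟩ := h₂ (ψ - i.cosyz.app b χ') (by
      rw [map_sub, ← hχ, ← Hom.toCosyz, hχ', sub_self])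
    refine ⟨p.app b θ, ?_⟩
    have h0 : p.cosyz.app b (i.cosyz.app b χ') = 0 := (h.cosyz.exact b _).2 ⟨_, rfl⟩
    rw [← Hom.toCosyz, hθ, map_sub, h0, sub_zero]
  | more n _ ih => exact ih h.cosyz h₁ h₂

theorem IsRetract.cosyz {N N' : RightMod.{w, v, u} k D} (h : IsRetract N N') :
    IsRetract N.cosyz N'.cosyz := by
  obtain ⟨i, r, h⟩ := h
  refine ⟨i.cosyz, r.cosyz, fun b ψ => ?_⟩
  funext a f
  exact h a _

theorem IsRetract.extVanishes {N N' : RightMod.{w, v, u} k D} (h : IsRetract N N') {n : ℕ} {b : D}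
    (h' : ExtVanishes n N' b) : ExtVanishes n N b := by
  induction n using Nat.twoStepInduction generalizing N N' with
  | zero =>
    obtain ⟨i, r, h⟩ := h
    intro v hv
    have : i.app b v = 0 := h' _ (by rw [← Hom.toCosyz, hv, map_zero])
    rw [← h b v, this, map_zero]
  | one =>
    have h2 := h.cosyz
    obtain ⟨i, r, h⟩ := h
    intro ψ hψ
    obtain ⟨v, hv⟩ := h' (i.cosyz.app b ψ) (by rw [← Hom.toCosyz, hψ, map_zero])
    refine ⟨r.app b v, ?_⟩
    rw [← Hom.toCosyz, hv]
    funext a f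
    exact h a _
  | more n _ ih => exact ih h.cosyz h'

theorem coind_extVanishes_one (N : RightMod.{w, v, u} k D) (b : D) :
    ExtVanishes 1 N.coind b := by
  classical
  intro ψ hψ
  -- `ψ` is a morphism from the radical of the representable module at `b`; it extends by
  -- adjunction, with the value at the identity irrelevant.
  refine ⟨fun a f => if h : deg a < deg b then ψ a ⟨f, h⟩ a (𝟙 a) else 0, ?_⟩
  funext a ⟨f, h⟩
  funext c g
  have hc : deg c < deg b := (deg_le g).trans_lt h
  change (if h : deg c < deg b then ψ c ⟨g ≫ f, h⟩ c (𝟙 c) else 0) = ψ a ⟨f, h⟩ c g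
  rw [dif_pos hc]
  rcases (deg_le g).lt_or_eq with hg | hg
  · have e := congrFun (congrFun (congrFun (congrFun hψ a) ⟨f, h⟩) c) ⟨g, hg⟩
    rw [toCosyz_apply, cosyz_map_of_lt _ _ _ _ _ h] at e
    have e' := congrFun (congrFun e c) (𝟙 c)
    have e'' : ψ c ⟨g ≫ f, hc⟩ c (𝟙 c) - ψ a ⟨f, h⟩ c (𝟙 c ≫ g) = 0 := e'
    rw [sub_eq_zero.1 e'', Category.id_comp]
  · obtain ⟨rfl, rfl⟩ := eq_of_deg_eq g hg
    simp

theorem cosyz_coind_isRetract (N : RightMod.{w, v, u} k D) :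
    IsRetract N.coind.cosyz N.coind.coind := by
  classical
  -- The embedding of `coind N` into the coinduced module on it is split by `r w f = w f 𝟙`, hence
  -- so is the projection onto the cokernel.
  refine ⟨⟨fun b => ⟨⟨fun ψ a f c g =>
      (if h : deg a < deg b then ψ a ⟨f, h⟩ c g else 0) -
        if h : deg c < deg b then ψ c ⟨g ≫ f, h⟩ c (𝟙 c) else 0, ?_⟩, ?_⟩, ?_⟩,
    ⟨fun b => ⟨⟨fun w a f c g => w a f.1 c g - w b (𝟙 b) c (g ≫ f.1), ?_⟩, ?_⟩, ?_⟩, ?_⟩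
  · intro ψ ψ'
    funext a f c g
    have e : ∀ (a : D) (f : {_f : a ⟶ b // deg a < deg b}) (c : D) (g : c ⟶ a),
      (ψ + ψ') a f c g = ψ a f c g + ψ' a f c g := fun _ _ _ _ => rfl
    simp only [e]
    refine Eq.trans ?_ (add_sub_add_comm _ _ _ _)
    congr 1 <;> split_ifs <;> simp
  · intro r ψ
    funext a f c g
    have e : ∀ (a : D) (f : {_f : a ⟶ b // deg a < deg b}) (c : D) (g : c ⟶ a),
      (r • ψ) a f c g = r • ψ a f c g := fun _ _ _ _ => rfl
    simp only [e]
    refine Eq.trans ?_ (smul_sub r _ _).symm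
    congr 1 <;> split_ifs <;> simp
  · intro b b' g ψ
    funext a f c h
    change (if h' : deg a < deg b then N.coind.cosyz.map g ψ a ⟨f, h'⟩ c h else 0) -
        (if h' : deg c < deg b then N.coind.cosyz.map g ψ c ⟨h ≫ f, h'⟩ c (𝟙 c) else 0) =
      (if h' : deg a < deg b' then ψ a ⟨f ≫ g, h'⟩ c h else 0) -
        if h' : deg c < deg b' then ψ c ⟨h ≫ f ≫ g, h'⟩ c (𝟙 c) else 0
    have key : ∀ (a : D) (f : a ⟶ b) (hf : deg a < deg b) (hg : deg b < deg b') (c : D) (h : c ⟶ a),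
        N.coind.cosyz.map g ψ a ⟨f, hf⟩ c h =
          ψ a ⟨f ≫ g, hf.trans hg⟩ c h - ψ b ⟨g, hg⟩ c (h ≫ f) := by
      intro a f hf hg c h
      rw [cosyz_map_of_lt _ _ _ _ hf hg]
      rfl
    rcases (deg_le g).lt_or_eq with hg | hg
    · have ha : deg a < deg b' := (deg_le f).trans_lt hg
      have hc : deg c < deg b' := (deg_le h).trans_lt ha
      rw [dif_pos ha, dif_pos hc]
      rcases (deg_le f).lt_or_eq with hf | hf
      · rw [dif_pos hf, dif_pos ((deg_le h).trans_lt hf), key _ _ _ hg, key _ _ _ hg]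
        simp
      · obtain ⟨rfl, rfl⟩ := eq_of_deg_eq f hf
        rcases (deg_le h).lt_or_eq with hh | hh
        · rw [dif_neg (lt_irrefl _), dif_pos hh, key _ _ _ hg]
          simp
        · obtain ⟨rfl, rfl⟩ := eq_of_deg_eq h hh
          simp
    · obtain ⟨rfl, rfl⟩ := eq_of_deg_eq g hg
      have e : N.coind.cosyz.map (eqToHom (rfl : b = b)) ψ = ψ := RightMod.map_id _ _ _
      rw [e]
      simp only [eqToHom_refl, Category.comp_id]
  · intro ψ ψ'
    funext a f c g
    exact add_sub_add_comm _ _ _ _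
  · intro r ψ
    funext a f c g
    exact (smul_sub r _ _).symm
  · intro b b' g w
    funext a f c h
    rw [cosyz_map_apply]
    change w a (f.1 ≫ g) c h - w b (𝟙 b ≫ g) c (h ≫ f.1) = _ - _
    split_ifs with hg
    · change _ = (w a (f.1 ≫ g) c h - w b' (𝟙 b') c (h ≫ f.1 ≫ g)) -
        (w b g c (h ≫ f.1) - w b' (𝟙 b') c ((h ≫ f.1) ≫ g))
      simp
    · obtain ⟨rfl, rfl⟩ := eq_of_deg_eq g (le_antisymm (deg_le g) (not_lt.1 hg))
      simp only [eqToHom_refl, Category.comp_id]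
      exact (sub_zero _).symm
  · intro b ψ
    funext a ⟨f, hf⟩ c h
    change ((if hf : deg a < deg b then ψ a ⟨f, hf⟩ c h else 0) -
        (if hc : deg c < deg b then ψ c ⟨h ≫ f, hc⟩ c (𝟙 c) else 0)) -
      ((if hb : deg b < deg b then ψ b ⟨𝟙 b, hb⟩ c (h ≫ f) else 0) -
        (if hc : deg c < deg b then ψ c ⟨(h ≫ f) ≫ 𝟙 b, hc⟩ c (𝟙 c) else 0)) = ψ a ⟨f, hf⟩ c h
    have hc := (deg_le h).trans_lt hf
    simp only [dif_pos hf, dif_pos hc, dif_neg (lt_irrefl _), Category.comp_id]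
    abel

theorem IsRetract.extVanishes_of_coind {N N' : RightMod.{w, v, u} k D} (h : IsRetract N N'.coind)
    (n : ℕ) (b : D) : ExtVanishes (n + 1) N b := by
  induction n generalizing N N' with
  | zero => exact h.extVanishes (coind_extVanishes_one N' b)
  | succ n ih => exact ih (h.cosyz.trans (cosyz_coind_isRetract N'))

end RightMod

/-! ### The one-way category of a graded category -/

namespace CatGrading

variable {C : Type u} [Category.{v} C] {l : CatGrading C}

/-- The connected component in `C₀` of an object. -/
def cls (l : CatGrading C) (x : C) : CategoryTheory.ConnectedComponents l.ZeroPart :=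
  CategoryTheory.ConnectedComponents.mk (⟨x⟩ : l.ZeroPart)

theorem cls_eq_of_len_eq_zero {x y : C} (f : x ⟶ y) (hf : l.len f = 0) : l.cls x = l.cls y :=
  Quotient.sound' (Zigzag.of_hom (⟨f, hf⟩ : (⟨x⟩ : l.ZeroPart) ⟶ ⟨y⟩))

theorem IndiscretelyBased.exists_len_eq_zero (hC : l.IndiscretelyBased) {x y : C}
    (h : l.cls x = l.cls y) : ∃ f : x ⟶ y, l.len f = 0 := by
  let X' : (l.cls y).Component := ⟨⟨x⟩, h⟩
  let Y' : (l.cls y).Component := ⟨⟨y⟩, rfl⟩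
  obtain ⟨U⟩ := hC (l.cls y) X' Y'
  exact ⟨U.default.hom.hom, U.default.hom.2⟩

theorem IndiscretelyBased.eq_of_len_eq_zero (hC : l.IndiscretelyBased) {x y : C} {f g : x ⟶ y}
    (hf : l.len f = 0) (hg : l.len g = 0) : f = g := by
  let F : (⟨x⟩ : l.ZeroPart) ⟶ ⟨y⟩ := ⟨f, hf⟩
  let G : (⟨x⟩ : l.ZeroPart) ⟶ ⟨y⟩ := ⟨g, hg⟩
  let X' : (l.cls y).Component := ⟨⟨x⟩, cls_eq_of_len_eq_zero f hf⟩
  let Y' : (l.cls y).Component := ⟨⟨y⟩, rfl⟩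
  let F' : X' ⟶ Y' := ObjectProperty.homMk F
  let G' : X' ⟶ Y' := ObjectProperty.homMk G
  obtain ⟨U⟩ := hC (l.cls y) X' Y'
  have e : F' = G' := (U.uniq _).trans (U.uniq _).symm
  exact congrArg (fun t : X' ⟶ Y' => t.hom.hom) e

/-- The canonical morphism of length zero between objects of the same component of `C₀`. -/
noncomputable def IndiscretelyBased.can (hC : l.IndiscretelyBased) {x y : C}
    (h : l.cls x = l.cls y) : x ⟶ y :=
  (hC.exists_len_eq_zero h).choose

theorem IndiscretelyBased.len_can (hC : l.IndiscretelyBased) {x y : C} (h : l.cls x = l.cls y) :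
    l.len (hC.can h) = 0 :=
  (hC.exists_len_eq_zero h).choose_spec

theorem IndiscretelyBased.can_refl (hC : l.IndiscretelyBased) {x : C} (h : l.cls x = l.cls x) :
    hC.can h = 𝟙 x :=
  hC.eq_of_len_eq_zero (hC.len_can h) (l.len_id x)

theorem IndiscretelyBased.can_comp (hC : l.IndiscretelyBased) {x y z : C} (h : l.cls x = l.cls y)
    (h' : l.cls y = l.cls z) : hC.can h ≫ hC.can h' = hC.can (h.trans h') :=
  hC.eq_of_len_eq_zero (by rw [l.len_comp, hC.len_can, hC.len_can]) (hC.len_can _)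

/-- A chosen object of each component of `C₀`. -/
noncomputable def rep (c : CategoryTheory.ConnectedComponents l.ZeroPart) : C :=
  (Quotient.out c : l.ZeroPart).obj

theorem cls_rep (c : CategoryTheory.ConnectedComponents l.ZeroPart) : l.cls (rep c) = c :=
  Quotient.out_eq c

/-- The objects of the one-way category attached to a graded category: a component of `C₀`,
represented by a chosen object, together with a degree. A graded module over the category
algebra which is spanned by the images of the identities amounts to a functor on this category. -/
@[ext]
structure GrObj (hC : l.IndiscretelyBased) where
  cls : CategoryTheory.ConnectedComponents l.ZeroPart
  deg : ℤ

namespace GrObj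

variable {hC : l.IndiscretelyBased}

/-- The underlying object of `C`. -/
noncomputable abbrev obj (a : GrObj hC) : C := rep a.cls

theorem cls_obj (a : GrObj hC) : l.cls a.obj = a.cls := cls_rep _

noncomputable instance : Category.{v} (GrObj hC) where
  Hom a b := {f : a.obj ⟶ b.obj // a.deg + l.len f = b.deg}
  id a := ⟨𝟙 _, by simp [l.len_id]⟩
  comp f g := ⟨f.1 ≫ g.1, by have hf := f.2; have hg := g.2; rw [l.len_comp]; omega⟩
  id_comp f := Subtype.ext (Category.id_comp _)
  comp_id f := Subtype.ext (Category.comp_id _)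
  assoc f g h := Subtype.ext (Category.assoc _ _ _)

theorem comp_val {a b c : GrObj hC} (f : a ⟶ b) (g : b ⟶ c) : (f ≫ g).1 = f.1 ≫ g.1 := rfl

theorem id_val (a : GrObj hC) : Subtype.val (𝟙 a) = 𝟙 a.obj := rfl

theorem exists_eq_eqToHom {a b : GrObj hC} (f : a.obj ⟶ b.obj) (hf : l.len f = 0)
    (hd : a.deg = b.deg) : ∃ h : a = b, f = eqToHom (congrArg obj h) := by
  have h : a = b := by
    refine GrObj.ext ?_ hd
    rw [← a.cls_obj, ← b.cls_obj]
    exact cls_eq_of_len_eq_zero f hf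
  subst h
  exact ⟨rfl, hC.eq_of_len_eq_zero hf (l.len_id _)⟩

noncomputable instance : OneWayCat (GrObj hC) where
  deg := GrObj.deg
  deg_le f := by
    have := f.2
    omega
  eq_of_deg_eq {a b} f hab := by
    have hf := f.2
    obtain ⟨rfl, h⟩ := exists_eq_eqToHom f.1 (by omega) hab
    exact ⟨rfl, Subtype.ext h⟩

end GrObj

end CatGrading

/-! ### Graded modules -/

namespace GrModule

/-- A family of submodules with compatible projections which spans the whole module is a direct
sum decomposition. -/
theorem isInternal_of_proj {k : Type*} [Field k] {M ι : Type*} [AddCommGroup M] [Module k M]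
    [DecidableEq ι] (V : ι → Submodule k M) (π : ι → M →ₗ[k] M) (h₁ : ∀ i, ∀ m ∈ V i, π i m = m)
    (h₂ : ∀ i j, i ≠ j → ∀ m ∈ V j, π i m = 0) (h : ⨆ i, V i = ⊤) : DirectSum.IsInternal V := by
  rw [DirectSum.isInternal_submodule_iff_iSupIndep_and_iSup_eq_top]
  refine ⟨fun i => ?_, h⟩
  rw [Submodule.disjoint_def]
  intro m hm hm'
  have hle : (⨆ (j : ι) (_ : j ≠ i), V j) ≤ LinearMap.ker (π i) :=
    iSup₂_le fun j hj m hm => h₂ i j hj.symm m hm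
  rw [← h₁ i m hm]
  exact hle hm'

section General

variable {k : Type*} [Field k] {A : Type w} [NonUnitalRing A] [Module k A]
  {𝒜 : ℕ → Submodule k A}

/-- The decomposition of a graded module into its homogeneous components. -/
noncomputable def decomp (M : GrModule k 𝒜) : (DirectSum ℤ fun i => M.deg i) ≃ₗ[k] M.carrier :=
  LinearEquiv.ofBijective (DirectSum.coeLinearMap M.deg) M.isInternal

/-- The projection of a graded module onto a homogeneous component. -/
noncomputable def proj (M : GrModule k 𝒜) (j : ℤ) : M.carrier →ₗ[k] M.carrier :=
  (M.deg j).subtype ∘ₗ DirectSum.component k ℤ (fun i => M.deg i) j ∘ₗ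
    M.decomp.symm.toLinearMap

variable (M : GrModule k 𝒜)

theorem proj_mem (j : ℤ) (m : M.carrier) : M.proj j m ∈ M.deg j :=
  Subtype.prop _

theorem decomp_symm_coe {j : ℤ} (m : M.deg j) :
    M.decomp.symm m = DirectSum.lof k ℤ (fun i => M.deg i) j m := by
  rw [LinearEquiv.symm_apply_eq]
  exact (DirectSum.coeLinearMap_lof (R := k) M.deg j m).symm

theorem proj_of_mem {j : ℤ} {m : M.carrier} (hm : m ∈ M.deg j) : M.proj j m = m := by
  have h := M.decomp_symm_coe ⟨m, hm⟩
  simp only at h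
  simp [proj, h, DirectSum.component.lof_self]

theorem proj_of_mem_ne {i j : ℤ} {m : M.carrier} (hm : m ∈ M.deg j) (hij : i ≠ j) :
    M.proj i m = 0 := by
  have h := M.decomp_symm_coe ⟨m, hm⟩
  simp only at h
  simp [proj, h, DirectSum.component.of, hij.symm]

theorem iSup_deg : ⨆ j, M.deg j = ⊤ := M.isInternal.submodule_iSup_eq_top

theorem linearMap_ext {N : Type*} [AddCommGroup N] [Module k N] {f g : M.carrier →ₗ[k] N}
    (h : ∀ j, ∀ m ∈ M.deg j, f m = g m) : f = g := by
  have hle : (⊤ : Submodule k M.carrier) ≤ LinearMap.eqLocus f g := by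
    rw [← M.iSup_deg]
    exact iSup_le fun j m hm => h j m hm
  exact LinearMap.ext fun m => hle (Submodule.mem_top (x := m))

theorem mem_of_proj_mem (S : Submodule k M.carrier) {m : M.carrier} (h : ∀ j, M.proj j m ∈ S) :
    m ∈ S := by
  classical
  have h1 : m = M.decomp (M.decomp.symm m) := (M.decomp.apply_symm_apply m).symm
  rw [h1, ← DirectSum.sum_support_of (M.decomp.symm m), map_sum]
  refine Submodule.sum_mem _ fun j _ => ?_
  have h2 := DirectSum.coeLinearMap_lof (R := k) M.deg j (M.decomp.symm m j)
  rw [show M.decomp (DirectSum.of _ j (M.decomp.symm m j)) = _ from h2]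
  exact h j

variable {M} {N : GrModule k 𝒜}

theorem Hom.map_proj (f : Hom M N) (j : ℤ) (m : M.carrier) :
    f.toLin (M.proj j m) = N.proj j (f.toLin m) := by
  have h : f.toLin ∘ₗ M.proj j = N.proj j ∘ₗ f.toLin := by
    refine M.linearMap_ext fun i m hm => ?_
    simp only [LinearMap.comp_apply]
    by_cases hij : j = i
    · subst hij
      rw [M.proj_of_mem hm, N.proj_of_mem (f.map_deg hm)]
    · rw [M.proj_of_mem_ne hm hij, N.proj_of_mem_ne (f.map_deg hm) hij, map_zero]
  exact LinearMap.congr_fun h m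

/-- An element of degree zero commutes with the projections to the homogeneous components. -/
theorem proj_act {a : A} (ha : a ∈ 𝒜 0) (j : ℤ) (m : M.carrier) :
    M.proj j (M.act a m) = M.act a (M.proj j m) := by
  have h : M.proj j ∘ₗ M.act a = M.act a ∘ₗ M.proj j := by
    refine M.linearMap_ext fun i m hm => ?_
    simp only [LinearMap.comp_apply]
    have h0 : M.act a m ∈ M.deg i := by
      have := M.act_mem ha hm
      simpa using this
    by_cases hij : j = i
    · subst hij
      rw [M.proj_of_mem hm, M.proj_of_mem h0]
    · rw [M.proj_of_mem_ne hm hij, M.proj_of_mem_ne h0 hij, map_zero]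
  exact LinearMap.congr_fun h m

theorem act_mul_apply (a b : A) (m : M.carrier) : M.act (a * b) m = M.act a (M.act b m) := by
  rw [map_mul]
  rfl

/-- The composition of morphisms of graded modules. -/
def Hom.comp {L : GrModule k 𝒜} (g : Hom M N) (f : Hom L M) : Hom L N where
  toLin := g.toLin ∘ₗ f.toLin
  map_act a m := by simp [f.map_act, g.map_act]
  map_deg hm := g.map_deg (f.map_deg hm)

/-- The identity morphism. -/
def Hom.id (M : GrModule k 𝒜) : Hom M M where
  toLin := LinearMap.id
  map_act _ _ := rfl
  map_deg hm := hm

/-- The kernel of a morphism of graded modules. -/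
noncomputable def Hom.ker (f : Hom M N) : GrModule k 𝒜 where
  carrier := LinearMap.ker f.toLin
  act :=
    { toFun := fun a => (M.act a).restrict fun m hm => by
        rw [LinearMap.mem_ker] at hm ⊢
        rw [f.map_act, hm, map_zero]
      map_smul' := fun c a => by
        ext m
        simp
      map_zero' := by
        ext m
        simp
      map_add' := fun a b => by
        ext m
        simp
      map_mul' := fun a b => by
        ext m
        simp }
  deg j := (M.deg j).comap (LinearMap.ker f.toLin).subtype
  isInternal := by
    have hp : ∀ j, ∀ m ∈ LinearMap.ker f.toLin, M.proj j m ∈ LinearMap.ker f.toLin := by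
      intro j m hm
      rw [LinearMap.mem_ker] at hm ⊢
      rw [f.map_proj, hm, map_zero]
    refine isInternal_of_proj _ (fun j => (M.proj j).restrict (hp j)) ?_ ?_ ?_
    · rintro i m hm
      exact Subtype.ext (M.proj_of_mem hm)
    · rintro i j hij m hm
      exact Subtype.ext (M.proj_of_mem_ne hm hij)
    · rw [eq_top_iff]
      intro m _
      have h : (m : M.carrier) ∈ (⨆ j, (M.deg j).comap (LinearMap.ker f.toLin).subtype).map
          (LinearMap.ker f.toLin).subtype := by
        refine M.mem_of_proj_mem _ fun j => ?_
        exact ⟨⟨_, hp j m m.2⟩, Submodule.mem_iSup_of_mem j (M.proj_mem j m), rfl⟩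
      obtain ⟨m', hm', e⟩ := h
      have : m' = m := Subtype.ext e
      rwa [← this]
  act_mem ha hm := M.act_mem ha hm

/-- The inclusion of the kernel. -/
noncomputable def Hom.kerι (f : Hom M N) : Hom f.ker M where
  toLin := (LinearMap.ker f.toLin).subtype
  map_act _ _ := rfl
  map_deg hm := hm

theorem Hom.kerι_injective (f : Hom M N) : Function.Injective f.kerι.toLin :=
  Subtype.val_injective

theorem Hom.exact_kerι (f : Hom M N) : Function.Exact f.kerι.toLin f.toLin := by
  intro m
  constructor
  · exact fun h => ⟨⟨m, h⟩, rfl⟩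
  · rintro ⟨m, rfl⟩
    exact m.2

/-- A morphism which composes to zero with `f` factors through the kernel of `f`. -/
noncomputable def Hom.kerLift {L : GrModule k 𝒜} (f : Hom M N) (g : Hom L M)
    (h : ∀ x, f.toLin (g.toLin x) = 0) : Hom L f.ker where
  toLin := g.toLin.codRestrict _ h
  map_act a m := Subtype.ext (g.map_act a m)
  map_deg hm := g.map_deg hm

end General

end GrModule

/-! ### Components of modules over the category algebra and their duals -/

namespace GrModule

section CatAlg

variable {k : Type w} [Field k] {C : Type u} [Category.{v} C] {l : CatGrading C}

theorem act_mem_of_basis (M : GrModule k (CatAlg.grading k l)) (S : Submodule k M.carrier)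
    {m : M.carrier} (h : ∀ f, M.act (CatAlg.basis k C f) m ∈ S) (a : CatAlg k C) :
    M.act a m ∈ S := by
  have ha : a ∈ Submodule.span k (Set.range (CatAlg.basis k C)) := by
    rw [Module.Basis.span_eq]
    trivial
  induction ha using Submodule.span_induction with
  | mem a ha =>
    obtain ⟨f, rfl⟩ := ha
    exact h f
  | zero => simp
  | add a b _ _ ha hb =>
    rw [map_add]
    exact S.add_mem ha hb
  | smul c a _ ha =>
    rw [map_smul]
    exact S.smul_mem c ha

/-- The action of a morphism on a module over the category algebra. -/
noncomputable def actMor (M : GrModule k (CatAlg.grading k l)) {x y : C} (f : x ⟶ y) :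
    M.carrier →ₗ[k] M.carrier :=
  M.act (CatAlg.basis k C ⟨x, y, f⟩)

variable (M : GrModule k (CatAlg.grading k l)) {N : GrModule k (CatAlg.grading k l)}

theorem actMor_comp {x y z : C} (f : x ⟶ y) (g : y ⟶ z) (m : M.carrier) :
    M.actMor (f ≫ g) m = M.actMor g (M.actMor f m) := by
  rw [actMor, ← CatAlg.basis_mul_basis_comp, act_mul_apply]
  rfl

theorem actMor_of_ne {x y z t : C} (f : x ⟶ y) (g : z ⟶ t) (h : y ≠ z) (m : M.carrier) :
    M.actMor g (M.actMor f m) = 0 := by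
  rw [actMor, actMor, ← act_mul_apply, CatAlg.basis_mul_basis_ne k _ _ h, map_zero,
    LinearMap.zero_apply]

theorem actMor_mem {x y : C} (f : x ⟶ y) {j j' : ℤ} (h : j + l.len f = j') {m : M.carrier}
    (hm : m ∈ M.deg j) : M.actMor f m ∈ M.deg j' := by
  rw [← h, add_comm]
  exact M.act_mem (CatAlg.basis_mem_grading k l ⟨x, y, f⟩) hm

variable {M} in
theorem Hom.map_actMor (F : Hom M N) {x y : C} (f : x ⟶ y) (m : M.carrier) :
    F.toLin (M.actMor f m) = N.actMor f (F.toLin m) :=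
  F.map_act _ _

theorem proj_actMor_id (x : C) (j : ℤ) (m : M.carrier) :
    M.proj j (M.actMor (𝟙 x) m) = M.actMor (𝟙 x) (M.proj j m) :=
  proj_act (by
    have := CatAlg.basis_mem_grading k l ⟨x, x, 𝟙 x⟩
    rwa [l.len_id] at this) j m

/-- The homogeneous part of degree `j` of the image of the identity of `x`, that is, the value at
`x` and `j` of the functor corresponding to a module. -/
noncomputable def part (x : C) (j : ℤ) : Submodule k M.carrier :=
  M.deg j ⊓ LinearMap.eqLocus (M.actMor (𝟙 x)) LinearMap.id

variable {M}

theorem mem_part {x : C} {j : ℤ} {m : M.carrier} :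
    m ∈ M.part x j ↔ m ∈ M.deg j ∧ M.actMor (𝟙 x) m = m := Iff.rfl

theorem actMor_mem_part {x y : C} (f : x ⟶ y) {j j' : ℤ} (h : j + l.len f = j') {m : M.carrier}
    (hm : m ∈ M.deg j) : M.actMor f m ∈ M.part y j' :=
  ⟨M.actMor_mem f h hm, by simp [← M.actMor_comp]⟩

theorem actMor_id_mem_part (x : C) {j : ℤ} {m : M.carrier} (hm : m ∈ M.deg j) :
    M.actMor (𝟙 x) m ∈ M.part x j :=
  actMor_mem_part _ (by simp [l.len_id]) hm

theorem Hom.map_part (F : Hom M N) {x : C} {j : ℤ} {m : M.carrier} (hm : m ∈ M.part x j) :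
    F.toLin m ∈ N.part x j :=
  ⟨F.map_deg hm.1, by
    have h : M.actMor (𝟙 x) m = m := hm.2
    exact (F.map_actMor _ _).symm.trans (congrArg F.toLin h)⟩

theorem Hom.exists_part (F : Hom M N) (hF : Function.Surjective F.toLin) {x : C} {j : ℤ}
    {n : N.carrier} (hn : n ∈ N.part x j) : ∃ m ∈ M.part x j, F.toLin m = n := by
  obtain ⟨m, rfl⟩ := hF n
  refine ⟨M.actMor (𝟙 x) (M.proj j m), actMor_id_mem_part x (M.proj_mem j m), ?_⟩
  rw [F.map_actMor, F.map_proj, N.proj_of_mem hn.1]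
  exact hn.2

/-- A module is unital if each of its elements is fixed by a sum of finitely many identities. -/
def Unital (M : GrModule k (CatAlg.grading k l)) : Prop :=
  ∀ m : M.carrier, ∃ s : Finset C, ∀ t, s ⊆ t → ∑ x ∈ t, M.actMor (𝟙 x) m = m

theorem Unital.mem_of_parts (hM : M.Unital) (S : Submodule k M.carrier) {m : M.carrier}
    (h : ∀ x j, M.actMor (𝟙 x) (M.proj j m) ∈ S) : m ∈ S := by
  obtain ⟨s, hs⟩ := hM m
  rw [← hs s subset_rfl]
  refine S.sum_mem fun x _ => M.mem_of_proj_mem S fun j => ?_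
  rw [proj_actMor_id]
  exact h x j

theorem Unital.ker (hM : M.Unital) (F : Hom M N) : F.ker.Unital := by
  intro m
  obtain ⟨s, hs⟩ := hM m.1
  refine ⟨s, fun t ht => F.kerι_injective ?_⟩
  rw [map_sum]
  simp only [F.kerι.map_actMor]
  exact hs t ht

theorem GeneratedInDegree.unital {i : ℤ} (h : M.GeneratedInDegree i) : M.Unital := by
  classical
  intro m
  have hm : m ∈ Submodule.span k {x | ∃ (a : CatAlg k C) (m : M.carrier),
      m ∈ M.deg i ∧ M.act a m = x} := by
    rw [show Submodule.span k _ = ⊤ from h]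
    trivial
  let S : Submodule k M.carrier :=
    { carrier := {m | ∃ s : Finset C, ∀ t, s ⊆ t → ∑ x ∈ t, M.actMor (𝟙 x) m = m}
      zero_mem' := ⟨∅, by simp⟩
      add_mem' := by
        rintro a b ⟨s, hs⟩ ⟨t, ht⟩
        refine ⟨s ∪ t, fun r hr => ?_⟩
        simp only [map_add, Finset.sum_add_distrib]
        rw [hs r (Finset.union_subset_left hr), ht r (Finset.union_subset_right hr)]
      smul_mem' := by
        rintro c a ⟨s, hs⟩
        refine ⟨s, fun r hr => ?_⟩
        simp only [map_smul, ← Finset.smul_sum]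
        rw [hs r hr] }
  refine (Submodule.span_le (p := S)).2 ?_ hm
  rintro _ ⟨a, m, -, rfl⟩
  refine M.act_mem_of_basis S (fun f => ⟨{f.tgt}, fun t ht => ?_⟩) a
  change ∑ x ∈ t, M.actMor (𝟙 x) (M.actMor f.hom m) = M.actMor f.hom m
  rw [Finset.sum_eq_single_of_mem f.tgt (ht (Finset.mem_singleton_self _)), ← M.actMor_comp,
    Category.comp_id]
  exact fun x _ hx => M.actMor_of_ne _ _ hx.symm _

variable {hC : l.IndiscretelyBased}

/-- The component of a module at an object of the one-way category. -/
noncomputable abbrev comp (M : GrModule k (CatAlg.grading k l)) (b : CatGrading.GrObj hC) :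
    Submodule k M.carrier :=
  M.part b.obj b.deg

/-- An element fixed by the identity of `x` comes from the chosen object of the component
of `x`. -/
theorem exists_comp (hC : l.IndiscretelyBased) {x : C} {j : ℤ} {m : M.carrier}
    (hm : m ∈ M.part x j) : ∃ m' ∈ M.comp (⟨l.cls x, j⟩ : CatGrading.GrObj hC),
      M.actMor (hC.can (CatGrading.cls_rep (l.cls x))) m' = m := by
  refine ⟨M.actMor (hC.can (CatGrading.cls_rep (l.cls x)).symm) m,
    actMor_mem_part _ (by simp [hC.len_can]) hm.1, ?_⟩
  rw [← M.actMor_comp, hC.can_comp, hC.can_refl]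
  exact hm.2

/-- The functoriality of the components of a module. -/
noncomputable def compMap (M : GrModule k (CatAlg.grading k l)) {a b : CatGrading.GrObj hC}
    (f : a ⟶ b) : M.comp a →ₗ[k] M.comp b :=
  (M.actMor f.1).restrict fun _ hm => actMor_mem_part f.1 f.2 hm.1

/-- The dual of a module, as a right module over the one-way category. -/
@[reducible]
noncomputable def dual (hC : l.IndiscretelyBased) (M : GrModule k (CatAlg.grading k l)) :
    RightMod.{w, v, u} k (CatGrading.GrObj hC) where
  obj b := Module.Dual k (M.comp b)
  map f := (M.compMap f).dualMap
  map_id b φ := by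
    refine LinearMap.ext fun m => ?_
    refine congrArg φ (Subtype.ext ?_)
    exact m.2.2
  map_comp f g φ := by
    refine LinearMap.ext fun m => ?_
    refine congrArg φ (Subtype.ext ?_)
    exact M.actMor_comp _ _ _

/-- The map on components induced by a morphism. -/
noncomputable def Hom.comps (F : Hom M N) (b : CatGrading.GrObj hC) : M.comp b →ₗ[k] N.comp b :=
  F.toLin.restrict fun _ hm => F.map_part hm

/-- The dual of a morphism. -/
noncomputable def Hom.dual (hC : l.IndiscretelyBased) (F : Hom M N) :
    RightMod.Hom (N.dual hC) (M.dual hC) where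
  app b := (F.comps b).dualMap
  naturality f φ := by
    refine LinearMap.ext fun m => ?_
    refine congrArg φ (Subtype.ext ?_)
    exact (F.map_actMor _ _).symm

theorem isShortExact_dual (hC : l.IndiscretelyBased) {K P M : GrModule k (CatAlg.grading k l)}
    (ι : Hom K P) (π : Hom P M) (hι : Function.Injective ι.toLin)
    (hπ : Function.Surjective π.toLin) (h : Function.Exact ι.toLin π.toLin) :
    RightMod.IsShortExact (π.dual hC) (ι.dual hC) := by
  have hι' : ∀ b : CatGrading.GrObj hC, Function.Injective (ι.comps b) := fun b m m' e =>
    Subtype.ext (hι (congrArg Subtype.val e))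
  have hπ' : ∀ b : CatGrading.GrObj hC, Function.Surjective (π.comps b) := fun b n => by
    obtain ⟨m, hm, e⟩ := π.exists_part hπ n.2
    exact ⟨⟨m, hm⟩, Subtype.ext e⟩
  have h' : ∀ b : CatGrading.GrObj hC,
      LinearMap.range (ι.comps b) = LinearMap.ker (π.comps b) := by
    intro b
    ext m
    constructor
    · rintro ⟨x, rfl⟩
      exact Subtype.ext ((h _).2 ⟨x.1, rfl⟩)
    · intro hm
      obtain ⟨x, hx⟩ := (h m.1).1 (congrArg Subtype.val (LinearMap.mem_ker.1 hm))
      refine ⟨⟨x, ?_, hι ?_⟩, Subtype.ext hx⟩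
      · have e : K.proj b.deg x = x := hι (by
          rw [ι.map_proj, hx, P.proj_of_mem m.2.1])
        rw [← e]
        exact K.proj_mem _ _
      · rw [ι.map_actMor, hx]
        exact m.2.2.trans hx.symm
  refine ⟨fun b => ?_, fun b => ?_, fun b => ?_⟩
  · exact LinearMap.dualMap_injective_of_surjective (hπ' b)
  · exact LinearMap.dualMap_surjective_of_injective (hι' b)
  · rw [LinearMap.exact_iff]
    change LinearMap.ker (ι.comps b).dualMap = LinearMap.range (π.comps b).dualMap
    rw [LinearMap.range_dualMap_eq_dualAnnihilator_ker,
      LinearMap.ker_dualMap_eq_dualAnnihilator_range, h' b]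

end CatAlg

end GrModule

/-! ### Free modules -/

namespace GrModule

theorem map_act_of_actMor {k : Type w} [Field k] {C : Type u} [Category.{v} C]
    {l : CatGrading C} {M N : GrModule k (CatAlg.grading k l)} (F : M.carrier →ₗ[k] N.carrier)
    (h : ∀ {x y : C} (f : x ⟶ y) (m : M.carrier), F (M.actMor f m) = N.actMor f (F m))
    (a : CatAlg k C) (m : M.carrier) : F (M.act a m) = N.act a (F m) := by
  have ha : a ∈ Submodule.span k (Set.range (CatAlg.basis k C)) := by
    rw [Module.Basis.span_eq]
    trivial
  induction ha using Submodule.span_induction with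
  | mem a ha =>
    obtain ⟨f, rfl⟩ := ha
    exact h f.hom m
  | zero => simp
  | add a b _ _ ha hb => simp [ha, hb]
  | smul c a _ ha => simp [ha]

section Free

variable {k : Type w} [Field k] {C : Type u} [Category.{v} C] {l : CatGrading C}
  {hC : l.IndiscretelyBased}

/-- The basis of the free module on generators placed at the objects `s g` of the one-way
category: pairs of a generator and a morphism starting at its object. -/
structure FreeIdx {G : Type max u v w} (s : G → CatGrading.GrObj hC) where
  gen : G
  tgt : C
  hom : (s gen).obj ⟶ tgt

variable (k) {G : Type max u v w} (s : G → CatGrading.GrObj hC)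

open Classical in
/-- The action of a morphism on a basis element of a free module. -/
noncomputable def freeActBasis (f : CatMor C) (b : FreeIdx.{w} s) : FreeIdx.{w} s →₀ k :=
  if e : b.tgt = f.src then Finsupp.single ⟨b.gen, f.tgt, b.hom ≫ eqToHom e ≫ f.hom⟩ 1 else 0

/-- The linear extension of `freeActBasis`. -/
noncomputable def freeAct : CatAlg k C →ₗ[k] Module.End k (FreeIdx.{w} s →₀ k) :=
  (CatAlg.basis k C).constr k fun f => Finsupp.linearCombination k (freeActBasis k s f)

theorem freeAct_basis_single (g : G) {y z : C} (f : (s g).obj ⟶ y) (h : y ⟶ z) :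
    freeAct k s (CatAlg.basis k C ⟨y, z, h⟩) (Finsupp.single ⟨g, y, f⟩ 1) =
      Finsupp.single ⟨g, z, f ≫ h⟩ 1 := by
  rw [freeAct, Module.Basis.constr_basis, Finsupp.linearCombination_single, one_smul,
    freeActBasis, dif_pos rfl]
  simp

theorem freeAct_basis_single_of_ne (b : FreeIdx.{w} s) (f : CatMor C) (h : b.tgt ≠ f.src) :
    freeAct k s (CatAlg.basis k C f) (Finsupp.single b 1) = 0 := by
  rw [freeAct, Module.Basis.constr_basis, Finsupp.linearCombination_single, one_smul,
    freeActBasis, dif_neg h]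

theorem freeAct_mul (a b : CatAlg k C) :
    freeAct k s (a * b) = freeAct k s a * freeAct k s b := by
  have h : (CatAlg.mulHom k C).compr₂ (freeAct k s) =
      (LinearMap.mul k (Module.End k (FreeIdx.{w} s →₀ k))).compl₁₂ (freeAct k s)
        (freeAct k s) := by
    refine (CatAlg.basis k C).ext fun f => (CatAlg.basis k C).ext fun f' =>
      Finsupp.lhom_ext' fun c => LinearMap.ext_ring ?_
    change freeAct k s (CatAlg.basis k C f * CatAlg.basis k C f') (Finsupp.single c 1) =
      freeAct k s (CatAlg.basis k C f) (freeAct k s (CatAlg.basis k C f') (Finsupp.single c 1))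
    obtain ⟨y, z, f⟩ := f
    obtain ⟨x, t, f'⟩ := f'
    obtain ⟨g, r, c⟩ := c
    by_cases h : r = x
    · subst h
      rw [freeAct_basis_single]
      by_cases h' : t = y
      · subst h'
        rw [CatAlg.basis_mul_basis_comp, freeAct_basis_single, freeAct_basis_single,
          Category.assoc]
      · rw [CatAlg.basis_mul_basis_ne k _ _ h', map_zero, LinearMap.zero_apply,
          freeAct_basis_single_of_ne k s _ _ h']
    · rw [freeAct_basis_single_of_ne k s ⟨g, r, c⟩ ⟨x, t, f'⟩ h, map_zero]
      by_cases h' : t = y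
      · subst h'
        rw [CatAlg.basis_mul_basis_comp, freeAct_basis_single_of_ne]
        exact h
      · rw [CatAlg.basis_mul_basis_ne k _ _ h', map_zero, LinearMap.zero_apply]
  exact LinearMap.congr_fun (LinearMap.congr_fun h a) b

variable {s} in
/-- The degree of a basis element of a free module. -/
noncomputable def FreeIdx.deg (b : FreeIdx.{w} s) : ℤ := (s b.gen).deg + l.len b.hom

open Classical in
/-- The free module on generators placed at the objects `s g` of the one-way category. -/
noncomputable def free : GrModule k (CatAlg.grading k l) where
  carrier := FreeIdx.{w} s →₀ k
  act :=
    { toFun := freeAct k s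
      map_smul' := map_smul _
      map_zero' := map_zero _
      map_add' := map_add _
      map_mul' := freeAct_mul k s }
  deg j := Submodule.span k ((fun b => Finsupp.single b 1) '' {b : FreeIdx.{w} s | b.deg = j})
  isInternal := by
    refine isInternal_of_proj _
      (fun j => Finsupp.linearCombination k fun b : FreeIdx.{w} s =>
        if b.deg = j then Finsupp.single b (1 : k) else 0) ?_ ?_ ?_
    · intro i m hm
      refine LinearMap.eqOn_span (g := LinearMap.id) ?_ hm
      rintro _ ⟨b, hb, rfl⟩
      have hb' : b.deg = i := hb
      simp [hb']
    · intro i j hij m hm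
      refine LinearMap.eqOn_span (g := 0) ?_ hm
      rintro _ ⟨b, hb, rfl⟩
      have hb' : b.deg = j := hb
      simp [hb', hij.symm]
    · rw [eq_top_iff]
      intro m _
      induction m using Finsupp.induction_linear with
      | zero => exact Submodule.zero_mem _
      | add m m' h h' => exact Submodule.add_mem _ (h trivial) (h' trivial)
      | single b c =>
        rw [← mul_one c, ← smul_eq_mul, ← Finsupp.smul_single]
        exact Submodule.smul_mem _ _
          (Submodule.mem_iSup_of_mem b.deg (Submodule.subset_span ⟨b, rfl, rfl⟩))
  act_mem {i j a m} ha hm := by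
    change freeAct k s a m ∈ _
    induction ha using Submodule.span_induction with
    | zero => simp
    | add a b _ _ ha hb =>
      rw [map_add]
      exact Submodule.add_mem _ ha hb
    | smul c a _ ha =>
      rw [map_smul]
      exact Submodule.smul_mem _ c ha
    | mem a ha =>
      obtain ⟨⟨y, z, f⟩, rfl, rfl⟩ := ha
      induction hm using Submodule.span_induction with
      | zero => simp
      | add a b _ _ ha hb =>
        rw [map_add]
        exact Submodule.add_mem _ ha hb
      | smul c a _ ha =>
        rw [map_smul]
        exact Submodule.smul_mem _ c ha
      | mem m hm =>
        obtain ⟨⟨g, x, h⟩, rfl, rfl⟩ := hm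
        by_cases e : x = y
        · subst e
          simp only [freeAct_basis_single]
          refine Submodule.subset_span ⟨_, ?_, rfl⟩
          simp only [Set.mem_ofPred_eq, FreeIdx.deg, l.len_comp]
          push_cast
          ring
        · simp only
          rw [freeAct_basis_single_of_ne k s ⟨g, x, h⟩ ⟨y, z, f⟩ e]
          exact Submodule.zero_mem _

/-- A basis element of a free module. -/
noncomputable def freeBasis (g : G) {y : C} (f : (s g).obj ⟶ y) : (free k s).carrier :=
  Finsupp.single (⟨g, y, f⟩ : FreeIdx.{w} s) (1 : k)

variable {s} in
theorem free_hom_ext {V : Type*} [AddCommGroup V] [Module k V]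
    {F F' : (free k s).carrier →ₗ[k] V}
    (h : ∀ (g : G) (y : C) (f : (s g).obj ⟶ y), F (freeBasis k s g f) = F' (freeBasis k s g f)) :
    F = F' :=
  Finsupp.lhom_ext' fun b => LinearMap.ext_ring (h b.gen b.tgt b.hom)

theorem free_actMor_basis (g : G) {y z : C} (f : (s g).obj ⟶ y) (h : y ⟶ z) :
    (free k s).actMor h (freeBasis k s g f) = freeBasis k s g (f ≫ h) :=
  freeAct_basis_single k s g f h

theorem freeBasis_mem_part (g : G) {y : C} (f : (s g).obj ⟶ y) {j : ℤ}
    (h : (s g).deg + l.len f = j) : freeBasis k s g f ∈ (free k s).part y j := by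
  have h' : Finsupp.single ⟨g, y, f⟩ 1 ∈
      Submodule.span k ((fun b => Finsupp.single b (1 : k)) '' {b : FreeIdx.{w} s | b.deg = j}) :=
    Submodule.subset_span ⟨_, h, rfl⟩
  refine ⟨h', ?_⟩
  refine (free_actMor_basis k s g f _).trans ?_
  rw [Category.comp_id]
  rfl

/-- The linear extension of a function on the basis of the free module. -/
noncomputable def freeLinear {V : Type*} [AddCommGroup V] [Module k V]
    (φ : ∀ (g : G) (y : C), ((s g).obj ⟶ y) → V) : (free k s).carrier →ₗ[k] V :=
  (Finsupp.linearCombination k fun b : FreeIdx.{w} s => φ b.gen b.tgt b.hom :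
    (FreeIdx.{w} s →₀ k) →ₗ[k] V)

theorem freeLinear_basis {V : Type*} [AddCommGroup V] [Module k V]
    (φ : ∀ (g : G) (y : C), ((s g).obj ⟶ y) → V) (g : G) {y : C} (f : (s g).obj ⟶ y) :
    freeLinear k s φ (freeBasis k s g f) = φ g y f := by
  refine (Finsupp.linearCombination_single _ _ _).trans ?_
  simp

variable {k s}

theorem free_act_basis_of_ne (g : G) {y z t : C} (f : (s g).obj ⟶ y) (h : z ⟶ t) (e : y ≠ z) :
    (free k s).actMor h (freeBasis k s g f) = 0 :=
  freeAct_basis_single_of_ne k s ⟨g, y, f⟩ ⟨z, t, h⟩ e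

/-- The universal property of free modules. -/
noncomputable def freeLift {M : GrModule k (CatAlg.grading k l)} (m : G → M.carrier)
    (hm : ∀ g, m g ∈ M.comp (s g)) : Hom (free k s) M where
  toLin := freeLinear k s fun g _ f => M.actMor f (m g)
  map_act := map_act_of_actMor _ fun {y z} h x => by
    refine LinearMap.congr_fun
      (f := (freeLinear k s fun g _ f => M.actMor f (m g)) ∘ₗ (free k s).actMor h)
      (g := M.actMor h ∘ₗ freeLinear k s fun g _ f => M.actMor f (m g))
      (free_hom_ext k fun g t f => ?_) x
    simp only [LinearMap.comp_apply]
    rw [freeLinear_basis]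
    by_cases e : t = y
    · subst e
      rw [free_actMor_basis, freeLinear_basis, M.actMor_comp]
    · rw [free_act_basis_of_ne g f h e, M.actMor_of_ne f h e, map_zero]
  map_deg {j x} hx := by
    induction hx using Submodule.span_induction with
    | zero =>
      rw [map_zero]
      exact Submodule.zero_mem _
    | add a b _ _ ha hb =>
      rw [map_add]
      exact Submodule.add_mem _ ha hb
    | smul c a _ ha =>
      rw [map_smul]
      exact Submodule.smul_mem _ c ha
    | mem x hx =>
      obtain ⟨⟨g, y, f⟩, rfl, rfl⟩ := hx
      refine Set.mem_of_eq_of_mem (freeLinear_basis k s _ g f) ?_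
      exact M.actMor_mem f rfl (hm g).1

theorem freeLift_basis {M : GrModule k (CatAlg.grading k l)} (m : G → M.carrier)
    (hm : ∀ g, m g ∈ M.comp (s g)) (g : G) {y : C} (f : (s g).obj ⟶ y) :
    (freeLift m hm).toLin (freeBasis k s g f) = M.actMor f (m g) :=
  freeLinear_basis k s _ g f

theorem Hom.free_ext {M : GrModule k (CatAlg.grading k l)} {F F' : Hom (free k s) M}
    (h : ∀ g, F.toLin (freeBasis k s g (𝟙 _)) = F'.toLin (freeBasis k s g (𝟙 _)))
    (x : (free k s).carrier) : F.toLin x = F'.toLin x := by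
  refine LinearMap.congr_fun (free_hom_ext k fun g y f => ?_) x
  rw [← Category.id_comp f, ← free_actMor_basis, F.map_actMor, F'.map_actMor, h]

theorem free_isProjective : (free k s).IsProjective := by
  intro M N q F hq
  choose m hm e using fun g => q.exists_part hq
    (F.map_part (freeBasis_mem_part k s g (𝟙 _) (j := (s g).deg) (by simp [l.len_id])))
  refine ⟨freeLift m hm, fun x => ?_⟩
  refine Hom.free_ext (F := q.comp (freeLift m hm)) (F' := F) (fun g => ?_) x
  refine Eq.trans ?_ (e g)
  refine congrArg q.toLin ((freeLift_basis m hm g _).trans ?_)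
  exact (hm g).2

theorem free_generatedInDegree {i : ℤ} (h : ∀ g, (s g).deg = i) :
    (free k s).GeneratedInDegree i := by
  refine eq_top_iff.2 fun x _ => ?_
  induction x using Finsupp.induction_linear with
  | zero => exact Submodule.zero_mem _
  | add m m' h h' => exact Submodule.add_mem _ (h trivial) (h' trivial)
  | single b c =>
    rw [← mul_one c, ← smul_eq_mul, ← Finsupp.smul_single]
    refine Submodule.smul_mem _ _ (Submodule.subset_span ⟨CatAlg.basis k C ⟨_, _, b.hom⟩,
      freeBasis k s b.gen (𝟙 _), (freeBasis_mem_part k s _ _ ?_).1, ?_⟩)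
    · rw [l.len_id, h]
      simp
    · refine (free_actMor_basis k s b.gen _ b.hom).trans ?_
      rw [Category.id_comp]
      rfl

end Free

end GrModule

/-! ### Generators and projectivity in terms of duals -/

namespace GrModule

section Ext

variable {k : Type w} [Field k] {C : Type u} [Category.{v} C] {l : CatGrading C}
  {hC : l.IndiscretelyBased} {M : GrModule k (CatAlg.grading k l)}

/-- The projection of a module onto one of its components. -/
noncomputable def compProj (M : GrModule k (CatAlg.grading k l)) (b : CatGrading.GrObj hC) :
    M.carrier →ₗ[k] M.comp b :=
  (M.actMor (𝟙 b.obj) ∘ₗ M.proj b.deg).codRestrict _ fun m =>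
    actMor_id_mem_part _ (M.proj_mem _ m)

theorem compProj_of_mem {b : CatGrading.GrObj hC} {m : M.carrier} (hm : m ∈ M.comp b) :
    M.compProj b m = ⟨m, hm⟩ := by
  refine Subtype.ext ?_
  change M.actMor (𝟙 b.obj) (M.proj b.deg m) = m
  rw [M.proj_of_mem hm.1]
  exact hm.2

theorem compProj_coe {b : CatGrading.GrObj hC} (m : M.comp b) : M.compProj b m = m :=
  compProj_of_mem m.2

theorem compProj_of_deg_ne {b : CatGrading.GrObj hC} {j : ℤ} {m : M.carrier} (hm : m ∈ M.deg j)
    (h : b.deg ≠ j) : M.compProj b m = 0 := by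
  refine Subtype.ext ?_
  change M.actMor (𝟙 b.obj) (M.proj b.deg m) = 0
  rw [M.proj_of_mem_ne hm h, map_zero]

theorem compProj_actMor_of_ne {b : CatGrading.GrObj hC} {x y : C} (f : x ⟶ y) (m : M.carrier)
    (h : y ≠ b.obj) : M.compProj b (M.actMor f m) = 0 := by
  refine Subtype.ext ?_
  change M.actMor (𝟙 b.obj) (M.proj b.deg (M.actMor f m)) = 0
  rw [← M.proj_actMor_id, M.actMor_of_ne _ _ h, map_zero]

/-- The dual of a module generated in degree `i` has no socle outside degree `i`. -/
theorem GeneratedInDegree.extVanishes_zero {i : ℤ} (h : M.GeneratedInDegree i)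
    {b : CatGrading.GrObj hC} (hb : b.deg ≠ i) : RightMod.ExtVanishes 0 (M.dual hC) b := by
  intro φ hφ
  have hker : (⊤ : Submodule k M.carrier) ≤ LinearMap.ker (φ ∘ₗ M.compProj b) := by
    rw [← show Submodule.span k _ = ⊤ from h, Submodule.span_le]
    rintro _ ⟨a, m, hm, rfl⟩
    refine M.act_mem_of_basis _ (fun f => ?_) a
    obtain ⟨x, y, f⟩ := f
    change φ (M.compProj b (M.actMor f m)) = 0
    by_cases hy : y = b.obj
    · subst hy
      by_cases hd : i + l.len f = b.deg
      · have hm' := actMor_id_mem_part (M := M) x hm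
        obtain ⟨m', hm', e⟩ := exists_comp hC hm'
        have e' : M.actMor f m = M.actMor (hC.can (CatGrading.cls_rep (l.cls x)) ≫ f) m' := by
          rw [M.actMor_comp, e, ← M.actMor_comp, Category.id_comp]
        let a : CatGrading.GrObj hC := ⟨l.cls x, i⟩
        let f' : a ⟶ b := ⟨hC.can (CatGrading.cls_rep (l.cls x)) ≫ f, by
          rw [l.len_comp, hC.len_can, zero_add]
          exact hd⟩
        have hlt : a.deg < b.deg := by
          change i < b.deg
          omega
        have h0 := LinearMap.congr_fun (congrFun (congrFun hφ a) ⟨f', hlt⟩) ⟨m', hm'⟩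
        have h1 : φ (M.compMap f' ⟨m', hm'⟩) = 0 := h0
        rw [← h1, e']
        exact congrArg φ (compProj_of_mem (actMor_mem_part f'.1 f'.2 hm'.1))
      · rw [compProj_of_deg_ne (M.actMor_mem f rfl hm) (Ne.symm hd), map_zero]
    · rw [compProj_actMor_of_ne f m hy, map_zero]
  refine LinearMap.ext fun m => ?_
  have h0 : φ (M.compProj b m) = 0 := hker (Submodule.mem_top (x := (m : M.carrier)))
  rwa [compProj_coe] at h0

/-- A form of the Nakayama lemma: a module which vanishes in degrees below `i` is generated in
degree `i` if the socle of its dual is concentrated in degree `i`. -/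
theorem Unital.generatedInDegree (hM : M.Unital) {i : ℤ}
    (h0 : ∀ b : CatGrading.GrObj hC, b.deg < i → M.comp b = ⊥)
    (h : ∀ b : CatGrading.GrObj hC, b.deg ≠ i → RightMod.ExtVanishes 0 (M.dual hC) b) :
    M.GeneratedInDegree i := by
  set S := Submodule.span k {x | ∃ (a : CatAlg k C) (m : M.carrier), m ∈ M.deg i ∧ M.act a m = x}
    with hS
  have hact : ∀ {x y : C} (f : x ⟶ y) (m : M.carrier), m ∈ S → M.actMor f m ∈ S := by
    intro x y f m hm
    have hle : S ≤ S.comap (M.actMor f) := by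
      rw [hS, Submodule.span_le]
      rintro _ ⟨a, m, hm, rfl⟩
      refine Submodule.subset_span ⟨CatAlg.basis k C ⟨x, y, f⟩ * a, m, hm, ?_⟩
      rw [act_mul_apply]
      rfl
    exact hle hm
  have key : ∀ n : ℕ, ∀ b : CatGrading.GrObj hC, b.deg ≤ i + n → M.comp b ≤ S := by
    intro n
    induction n with
    | zero =>
      intro b hb
      rcases (show b.deg ≤ i by simpa using hb).lt_or_eq with hlt | heq
      · rw [h0 b hlt]
        exact bot_le
      · intro m hm
        refine Submodule.subset_span ⟨CatAlg.basis k C ⟨_, _, 𝟙 b.obj⟩, m, heq ▸ hm.1, hm.2⟩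
    | succ n ih =>
      intro b hb
      by_cases hbn : b.deg ≤ i + n
      · exact ih b hbn
      by_contra hle
      obtain ⟨m, hm, hmS⟩ := SetLike.not_le_iff_exists.1 hle
      -- a form on the component at `b` which kills the submodule generated in degree `i` lies in
      -- the socle of the dual, since all components of lower degree are in this submodule
      obtain ⟨φ, hφ, hφS⟩ := Submodule.exists_dual_map_eq_bot_of_notMem
        (p := S.comap (M.comp b).subtype) (x := ⟨m, hm⟩) hmS inferInstance
      refine hφ ?_
      have hφ0 : φ = 0 := h b (by omega) φ (by
        funext a ⟨f, hlt⟩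
        refine LinearMap.ext fun m' => ?_
        change φ (M.compMap f m') = 0
        have hlt' : a.deg < b.deg := hlt
        have h1 : M.compMap f m' ∈ S.comap (M.comp b).subtype :=
          hact f.1 m'.1 (ih a (by push_cast at hb; omega) m'.2)
        have h2 : φ (M.compMap f m') ∈ (S.comap (M.comp b).subtype).map φ := ⟨_, h1, rfl⟩
        rw [hφS] at h2
        exact h2)
      rw [hφ0]
      rfl
  refine eq_top_iff.2 fun m _ => hM.mem_of_parts S fun x j => ?_
  obtain ⟨m', hm', e⟩ := exists_comp hC (actMor_id_mem_part x (M.proj_mem j m))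
  rw [← e]
  refine hact _ _ (key (j - i).toNat ⟨l.cls x, j⟩ ?_ hm')
  change j ≤ _
  omega

/-- The linear form on the free module on all elements of the components of `P` which is defined by
an element `w` of the coinduced module at `b`: its value at a basis element, given by a generator
`m` and a morphism `f`, is `w f m` if `f` ends at `b` in the one-way category, and `0` otherwise. -/
noncomputable def coindForm {P : GrModule k (CatAlg.grading k l)} {b : CatGrading.GrObj hC}
    (w : (P.dual hC).coind.obj b) :
    (free k (fun g : (Σ a : CatGrading.GrObj hC, P.comp a) => g.1)).carrier →ₗ[k] k := by
  classical
  exact freeLinear k _ fun g y f =>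
    if h : ∃ _ : y = b.obj, g.1.deg + l.len f = b.deg then
      w g.1 ⟨f ≫ eqToHom h.1, by
        obtain ⟨rfl, h⟩ := h
        simpa using h⟩ g.2
    else 0

theorem coindForm_basis {P : GrModule k (CatAlg.grading k l)} {b : CatGrading.GrObj hC}
    (w : (P.dual hC).coind.obj b) (g : Σ a : CatGrading.GrObj hC, P.comp a)
    (f : g.1 ⟶ b) : coindForm w (freeBasis k _ g f.1) = w g.1 f g.2 := by
  rw [coindForm, freeLinear_basis, dif_pos ⟨rfl, f.2⟩]
  simp

theorem coindForm_basis_of_not {P : GrModule k (CatAlg.grading k l)} {b : CatGrading.GrObj hC}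
    (w : (P.dual hC).coind.obj b) (g : Σ a : CatGrading.GrObj hC, P.comp a) {y : C}
    (f : g.1.obj ⟶ y) (h : ¬ ∃ _ : y = b.obj, g.1.deg + l.len f = b.deg) :
    coindForm w (freeBasis k _ g f) = 0 := by
  rw [coindForm, freeLinear_basis, dif_neg h]

theorem coindForm_actMor {P : GrModule k (CatAlg.grading k l)} {a b : CatGrading.GrObj hC}
    (h : a ⟶ b) (w : (P.dual hC).coind.obj b)
    (x : (free k (fun g : (Σ a : CatGrading.GrObj hC, P.comp a) => g.1)).carrier) :
    coindForm w ((free k _).actMor h.1 x) = coindForm ((P.dual hC).coind.map h w) x := by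
  refine LinearMap.congr_fun (f := coindForm w ∘ₗ (free k _).actMor h.1)
    (g := coindForm ((P.dual hC).coind.map h w)) (free_hom_ext k fun g y f => ?_) x
  rw [LinearMap.comp_apply]
  have hh := h.2
  by_cases e : y = a.obj
  · subst e
    rw [free_actMor_basis]
    by_cases hd : g.1.deg + l.len f = a.deg
    · let f' : g.1 ⟶ a := ⟨f, hd⟩
      exact (coindForm_basis w g (f' ≫ h)).trans
        (coindForm_basis ((P.dual hC).coind.map h w) g f').symm
    · rw [coindForm_basis_of_not, coindForm_basis_of_not]
      · rintro ⟨-, hd'⟩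
        exact hd hd'
      · rintro ⟨-, hd'⟩
        rw [l.len_comp] at hd'
        omega
  · rw [free_act_basis_of_ne _ _ _ e, coindForm_basis_of_not, map_zero]
    rintro ⟨e', -⟩
    exact e e'

theorem coindForm_add {P : GrModule k (CatAlg.grading k l)} {b : CatGrading.GrObj hC}
    (w w' : (P.dual hC).coind.obj b) : coindForm (w + w') = coindForm w + coindForm w' := by
  refine free_hom_ext k fun g y f => ?_
  rw [LinearMap.add_apply]
  by_cases h : ∃ _ : y = b.obj, g.1.deg + l.len f = b.deg
  · obtain ⟨rfl, h⟩ := h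
    let f' : g.1 ⟶ b := ⟨f, h⟩
    exact (coindForm_basis (w + w') g f').trans (congrArg₂ (· + ·)
      (coindForm_basis w g f').symm (coindForm_basis w' g f').symm)
  · simp only [coindForm_basis_of_not _ g f h, add_zero]

theorem coindForm_smul {P : GrModule k (CatAlg.grading k l)} {b : CatGrading.GrObj hC} (c : k)
    (w : (P.dual hC).coind.obj b) : coindForm (c • w) = c • coindForm w := by
  refine free_hom_ext k fun g y f => ?_
  rw [LinearMap.smul_apply]
  by_cases h : ∃ _ : y = b.obj, g.1.deg + l.len f = b.deg
  · obtain ⟨rfl, h⟩ := h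
    let f' : g.1 ⟶ b := ⟨f, h⟩
    exact (coindForm_basis (c • w) g f').trans
      (congrArg (c • ·) (coindForm_basis w g f').symm)
  · simp only [coindForm_basis_of_not _ g f h, smul_zero]

/-- The canonical map to a module from the free module on all elements of its components. -/
noncomputable def freeCover (hC : l.IndiscretelyBased) (P : GrModule k (CatAlg.grading k l)) :
    Hom (free k (fun g : (Σ a : CatGrading.GrObj hC, P.comp a) => g.1)) P :=
  freeLift (fun g => g.2.1) fun g => g.2.2

theorem freeCover_basis (P : GrModule k (CatAlg.grading k l))
    (g : Σ a : CatGrading.GrObj hC, P.comp a) {y : C} (f : g.1.obj ⟶ y) :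
    (freeCover hC P).toLin (freeBasis k _ g f) = P.actMor f g.2.1 :=
  freeLift_basis _ _ g f

theorem Unital.freeCover_surjective {P : GrModule k (CatAlg.grading k l)} (hu : P.Unital) :
    Function.Surjective (freeCover hC P).toLin := by
  intro m
  change m ∈ LinearMap.range (freeCover hC P).toLin
  refine hu.mem_of_parts _ fun x j => ?_
  obtain ⟨m', hm', e⟩ := exists_comp hC (actMor_id_mem_part x (P.proj_mem j m))
  rw [← e]
  let g : Σ a : CatGrading.GrObj hC, P.comp a := ⟨⟨l.cls x, j⟩, m', hm'⟩
  exact ⟨_, freeCover_basis P g _⟩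

theorem coindForm_freeCover {P : GrModule k (CatAlg.grading k l)} {b : CatGrading.GrObj hC}
    (φ : (P.dual hC).obj b) :
    coindForm (fun _ f => (P.dual hC).map f φ : (P.dual hC).coind.obj b) =
      φ ∘ₗ P.compProj b ∘ₗ (freeCover hC P).toLin := by
  refine free_hom_ext k fun g y f => ?_
  simp only [LinearMap.comp_apply]
  rw [freeCover_basis]
  by_cases e : y = b.obj
  · subst e
    by_cases hd : g.1.deg + l.len f = b.deg
    · let f' : g.1 ⟶ b := ⟨f, hd⟩
      refine (coindForm_basis _ g f').trans ?_
      rw [compProj_of_mem (actMor_mem_part f hd g.2.2.1)]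
      rfl
    · rw [coindForm_basis_of_not, compProj_of_deg_ne (P.actMor_mem f rfl g.2.2.1), map_zero]
      · exact fun e => hd e.symm
      · rintro ⟨-, e⟩
        exact hd e
  · rw [coindForm_basis_of_not, compProj_actMor_of_ne _ _ e, map_zero]
    rintro ⟨e', -⟩
    exact e e'

/-- The dual of a unital projective module is a retract of a coinduced module, hence injective. -/
theorem IsProjective.dual_isRetract {P : GrModule k (CatAlg.grading k l)} (hP : P.IsProjective)
    (hu : P.Unital) (hC : l.IndiscretelyBased) :
    RightMod.IsRetract (P.dual hC) (P.dual hC).coind := by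
  obtain ⟨σ, hσ⟩ := hP _ _ (freeCover hC P) (Hom.id P) hu.freeCover_surjective
  refine ⟨⟨fun b => ⟨⟨fun φ a f => (P.dual hC).map f φ, ?_⟩, ?_⟩, ?_⟩,
    ⟨fun b => ⟨⟨fun w => coindForm w ∘ₗ σ.toLin ∘ₗ (P.comp b).subtype, ?_⟩, ?_⟩, ?_⟩, ?_⟩
  · intro φ φ'
    rfl
  · intro c φ
    rfl
  · intro a b f φ
    funext c g
    exact ((P.dual hC).map_comp g f φ).symm
  · intro w w'
    rw [coindForm_add, LinearMap.add_comp]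
  · intro c w
    exact congrArg (fun t => t ∘ₗ σ.toLin ∘ₗ (P.comp b).subtype) (coindForm_smul c w)
  · intro a b f w
    refine LinearMap.ext fun m => ?_
    change coindForm ((P.dual hC).coind.map f w) (σ.toLin m) =
      coindForm w (σ.toLin (P.actMor f.1 m))
    rw [σ.map_actMor, coindForm_actMor]
  · intro b φ
    refine LinearMap.ext fun m => ?_
    refine (LinearMap.congr_fun (coindForm_freeCover φ) (σ.toLin m)).trans ?_
    simp only [LinearMap.comp_apply]
    rw [hσ]
    exact congrArg φ (compProj_coe m)

end Ext

end GrModule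

/-! ### Minimal free covers -/

namespace GrModule

section Cover

variable {k : Type w} [Field k] {C : Type u} [Category.{v} C] {l : CatGrading C}
  {hC : l.IndiscretelyBased}

/-- The index type of bases of all components of degree `i` of a module. -/
abbrev CoverGen (hC : l.IndiscretelyBased) (M : GrModule k (CatAlg.grading k l)) (i : ℤ) :
    Type (max u v w) :=
  Σ b : {b : CatGrading.GrObj hC // b.deg = i}, Module.Basis.ofVectorSpaceIndex k (M.comp b.1)

/-- The object at which a generator of the minimal cover is placed. -/
def coverSrc (hC : l.IndiscretelyBased) (M : GrModule k (CatAlg.grading k l)) (i : ℤ) :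
    CoverGen hC M i → CatGrading.GrObj hC := fun g => g.1.1

/-- The element of the module corresponding to a generator of the minimal cover. -/
noncomputable def coverVal (M : GrModule k (CatAlg.grading k l)) (i : ℤ) (g : CoverGen hC M i) :
    M.comp (coverSrc hC M i g) :=
  Module.Basis.ofVectorSpace k (M.comp g.1.1) g.2

/-- The minimal free cover of a module generated in degree `i`. -/
noncomputable def cover (hC : l.IndiscretelyBased) (M : GrModule k (CatAlg.grading k l)) (i : ℤ) :
    Hom (free k (coverSrc hC M i)) M :=
  freeLift (fun g => (coverVal M i g).1) fun g => (coverVal M i g).2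

variable {M : GrModule k (CatAlg.grading k l)} {i : ℤ}

theorem cover_basis (g : CoverGen hC M i) {y : C} (f : (coverSrc hC M i g).obj ⟶ y) :
    (cover hC M i).toLin (freeBasis k _ g f) = M.actMor f (coverVal M i g).1 :=
  freeLift_basis _ _ g f

theorem GeneratedInDegree.cover_surjective (h : M.GeneratedInDegree i) :
    Function.Surjective (cover hC M i).toLin := by
  intro m
  change m ∈ LinearMap.range (cover hC M i).toLin
  have hact : ∀ {x y : C} (f : x ⟶ y) (m : M.carrier),
      m ∈ LinearMap.range (cover hC M i).toLin →
      M.actMor f m ∈ LinearMap.range (cover hC M i).toLin := by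
    rintro x y f _ ⟨m, rfl⟩
    rw [← Hom.map_actMor]
    exact ⟨_, rfl⟩
  have hcomp : ∀ b : CatGrading.GrObj hC, b.deg = i →
      M.comp b ≤ LinearMap.range (cover hC M i).toLin := by
    intro b hb m hm
    have hmem : (⟨m, hm⟩ : M.comp b) ∈
        (LinearMap.range (cover hC M i).toLin).comap (M.comp b).subtype := by
      have hspan := (Module.Basis.ofVectorSpace k (M.comp b)).span_eq
      have hle : Submodule.span k (Set.range (Module.Basis.ofVectorSpace k (M.comp b))) ≤
          (LinearMap.range (cover hC M i).toLin).comap (M.comp b).subtype := by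
        rw [Submodule.span_le]
        rintro _ ⟨e, rfl⟩
        let g : CoverGen hC M i := ⟨⟨b, hb⟩, e⟩
        refine ⟨freeBasis k _ g (𝟙 _), (cover_basis g _).trans ?_⟩
        exact (mem_part.1 (Module.Basis.ofVectorSpace k (M.comp b) e).2).2
      rw [hspan] at hle
      exact hle trivial
    exact hmem
  have hm : m ∈ Submodule.span k {x | ∃ (a : CatAlg k C) (m : M.carrier),
      m ∈ M.deg i ∧ M.act a m = x} := by
    rw [show Submodule.span k _ = ⊤ from h]
    trivial
  refine (Submodule.span_le (p := LinearMap.range (cover hC M i).toLin)).2 ?_ hm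
  rintro _ ⟨a, m, hm, rfl⟩
  refine M.act_mem_of_basis _ (fun f => ?_) a
  change M.actMor f.hom m ∈ _
  rw [← Category.id_comp f.hom, M.actMor_comp]
  obtain ⟨m', hm', e⟩ := exists_comp hC (actMor_id_mem_part f.src hm)
  rw [← e]
  exact hact _ _ (hact _ _ (hcomp ⟨l.cls f.src, i⟩ rfl hm'))

/-- The cover is minimal: its kernel vanishes in degrees up to `i`. -/
theorem cover_ker_comp (b : CatGrading.GrObj hC) (hb : b.deg ≤ i) :
    (cover hC M i).ker.comp b = ⊥ := by
  rw [eq_bot_iff]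
  intro m hm
  have hm' := (cover hC M i).kerι.map_part hm
  refine (Submodule.mem_bot k).2 ((cover hC M i).kerι_injective ?_)
  set x := (cover hC M i).kerι.toLin m with hx
  have hx0 : (cover hC M i).toLin x = 0 := m.2
  rw [map_zero]
  rcases hb.lt_or_eq with hlt | heq
  · have h0 : (free k (coverSrc hC M i)).compProj b = 0 := by
      refine free_hom_ext k fun g y f => ?_
      rw [compProj_of_deg_ne (freeBasis_mem_part k _ g f rfl).1]
      · rfl
      · have hg : (coverSrc hC M i g).deg = i := g.1.2
        omega
    have h1 := LinearMap.congr_fun h0 x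
    rw [compProj_of_mem hm'] at h1
    exact congrArg Subtype.val h1
  · -- the basis of `M b` gives a left inverse of the cover on the component at `b`
    let τ : M.comp b →ₗ[k] (free k (coverSrc hC M i)).carrier :=
      (Module.Basis.ofVectorSpace k (M.comp b)).constr k fun e =>
        freeBasis k (coverSrc hC M i) ⟨⟨b, heq⟩, e⟩ (𝟙 _)
    have h0 : τ ∘ₗ M.compProj b ∘ₗ (cover hC M i).toLin =
        ((free k (coverSrc hC M i)).comp b).subtype ∘ₗ
          (free k (coverSrc hC M i)).compProj b := by
      refine free_hom_ext k fun g y f => ?_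
      simp only [LinearMap.comp_apply]
      have hg := freeBasis_mem_part k (coverSrc hC M i) g f rfl
      rw [cover_basis]
      have hgi : (coverSrc hC M i g).deg = i := g.1.2
      have hM := M.actMor_mem f rfl (coverVal M i g).2.1
      by_cases hy : y = b.obj
      · subst hy
        by_cases hf : l.len f = 0
        · obtain ⟨⟨b', hb'⟩, e⟩ := g
          obtain ⟨rfl, rfl⟩ := CatGrading.GrObj.exists_eq_eqToHom (hC := hC) (a := b') f hf
            (hb'.trans heq.symm)
          have h1 : M.actMor (𝟙 b'.obj) (Module.Basis.ofVectorSpace k (M.comp b') e).1 =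
            (Module.Basis.ofVectorSpace k (M.comp b') e).1 := (mem_part.1 (Subtype.prop _)).2
          have h2 : M.compProj b' (M.actMor (𝟙 b'.obj)
            (Module.Basis.ofVectorSpace k (M.comp b') e).1) =
              Module.Basis.ofVectorSpace k (M.comp b') e := by
            rw [h1, compProj_coe]
          refine (congrArg τ h2).trans ?_
          rw [Module.Basis.constr_basis]
          exact (congrArg Subtype.val (compProj_of_mem
            (freeBasis_mem_part k (coverSrc hC M i) ⟨⟨b', hb'⟩, e⟩ (𝟙 _)
              (by simp [l.len_id, coverSrc])))).symm
        · have hd : b.deg ≠ (coverSrc hC M i g).deg + l.len f := by omega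
          rw [compProj_of_deg_ne hg.1 hd, compProj_of_deg_ne hM hd, map_zero, map_zero]
      · rw [compProj_actMor_of_ne _ _ hy, ← Category.comp_id f, ← free_actMor_basis,
          compProj_actMor_of_ne _ _ hy, map_zero, map_zero]
    have h1 := LinearMap.congr_fun h0 x
    simp only [LinearMap.comp_apply, hx0, map_zero, compProj_of_mem hm'] at h1
    exact h1.symm

end Cover

end GrModule

/-! ### Linear resolutions -/

namespace GrModule

section Resolution

variable {k : Type w} [Field k] {C : Type u} [Category.{v} C] {l : CatGrading C}

theorem GeneratedInDegree.of_surjective {M N : GrModule k (CatAlg.grading k l)} {i : ℤ}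
    (h : M.GeneratedInDegree i) (F : Hom M N) (hF : Function.Surjective F.toLin) :
    N.GeneratedInDegree i := by
  refine eq_top_iff.2 fun n _ => ?_
  obtain ⟨m, rfl⟩ := hF n
  have hm : m ∈ Submodule.span k {x | ∃ (a : CatAlg k C) (m : M.carrier),
      m ∈ M.deg i ∧ M.act a m = x} := by
    rw [show Submodule.span k _ = ⊤ from h]
    trivial
  refine (Submodule.span_le (p := (Submodule.span k {x | ∃ (a : CatAlg k C) (m : N.carrier),
      m ∈ N.deg i ∧ N.act a m = x}).comap F.toLin)).2 ?_ hm
  rintro _ ⟨a, m, hm, rfl⟩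
  exact Submodule.subset_span ⟨a, F.toLin m, F.map_deg hm, (F.map_act a m).symm⟩

/-- If `M` has a linear projective resolution starting in degree `i`, then `Extⁿ` vanishes outside
degree `i + n`, by shifting dimensions along the syzygies. -/
theorem extVanishes_of_resolution (hC : l.IndiscretelyBased) (n : ℕ) :
    ∀ (M : GrModule k (CatAlg.grading k l)) (i : ℤ) (P : ℕ → GrModule k (CatAlg.grading k l))
      (d : ∀ j, (P (j + 1)).Hom (P j)) (ε : (P 0).Hom M), (∀ j, (P j).IsProjective) →
      (∀ j : ℕ, (P j).GeneratedInDegree (i + j)) → Function.Surjective ε.toLin →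
      Function.Exact (d 0).toLin ε.toLin →
      (∀ j, Function.Exact (d (j + 1)).toLin (d j).toLin) →
      ∀ b : CatGrading.GrObj hC, b.deg ≠ i + n → RightMod.ExtVanishes n (M.dual hC) b := by
  induction n with
  | zero =>
    intro M i P d ε hP hg hε _ _ b hb
    exact ((hg 0).of_surjective ε hε).extVanishes_zero hb
  | succ n ih =>
    intro M i P d ε hP hg hε h0 h1 b hb
    have hs := isShortExact_dual hC ε.kerι ε ε.kerι_injective hε ε.exact_kerι
    refine hs.extVanishes_succ_left ?_
      (((hP 0).dual_isRetract (hg 0).unital hC).extVanishes_of_coind n b)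
    refine ih ε.ker (i + 1) (fun j => P (j + 1)) (fun j => d (j + 1))
      (ε.kerLift (d 0) fun x => (h0 _).2 ⟨x, rfl⟩) (fun j => hP (j + 1)) (fun j => ?_) ?_ ?_
      (fun j => h1 (j + 1)) b ?_
    · have := hg (j + 1)
      push_cast at this
      rwa [add_assoc, add_comm (1 : ℤ)]
    · intro m
      obtain ⟨x, hx⟩ := (h0 _).1 m.2
      exact ⟨x, Subtype.ext hx⟩
    · intro x
      refine Iff.trans ?_ (h1 0 x)
      exact ⟨fun e => congrArg Subtype.val e, fun e => Subtype.ext e⟩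
    · push_cast at hb
      omega

/-- The module `M` has no elements in degrees below `i`, and `Extⁿ` vanishes outside degree
`i + n`. -/
structure IsLinear (hC : l.IndiscretelyBased) (M : GrModule k (CatAlg.grading k l)) (i : ℤ) :
    Prop where
  unital : M.Unital
  comp_eq_bot : ∀ b : CatGrading.GrObj hC, b.deg < i → M.comp b = ⊥
  extVanishes : ∀ (n : ℕ) (b : CatGrading.GrObj hC), b.deg ≠ i + n →
    RightMod.ExtVanishes n (M.dual hC) b

variable {hC : l.IndiscretelyBased}

theorem IsLinear.generatedInDegree {M : GrModule k (CatAlg.grading k l)} {i : ℤ}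
    (h : IsLinear hC M i) : M.GeneratedInDegree i :=
  h.unital.generatedInDegree h.comp_eq_bot fun b hb => h.extVanishes 0 b (by simpa using hb)

theorem cover_generatedInDegree (M : GrModule k (CatAlg.grading k l)) (i : ℤ) :
    (free k (coverSrc hC M i)).GeneratedInDegree i :=
  free_generatedInDegree fun g => g.1.2

/-- The first syzygy of a linear module is linear, with degrees shifted by one. -/
theorem IsLinear.ker_cover {M : GrModule k (CatAlg.grading k l)} {i : ℤ} (h : IsLinear hC M i) :
    IsLinear hC (cover hC M i).ker (i + 1) where
  unital := (cover_generatedInDegree M i).unital.ker _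
  comp_eq_bot b hb := cover_ker_comp b (by omega)
  extVanishes n b hb := by
    by_cases hn : n = 0 ∧ b.deg = i
    · obtain ⟨rfl, hbi⟩ := hn
      intro φ _
      refine LinearMap.ext fun m => ?_
      have hm : m = 0 := Subtype.ext ((Submodule.mem_bot k).1
        ((cover_ker_comp (M := M) b hbi.le).le m.2))
      rw [hm, map_zero, map_zero]
    have hs := isShortExact_dual hC (cover hC M i).kerι (cover hC M i)
      (cover hC M i).kerι_injective h.generatedInDegree.cover_surjective
      (cover hC M i).exact_kerι
    refine hs.extVanishes_right (h.extVanishes (n + 1) b (by push_cast; omega)) ?_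
    cases n with
    | zero => exact (cover_generatedInDegree M i).extVanishes_zero (by simpa using hn)
    | succ n =>
      exact (free_isProjective.dual_isRetract (cover_generatedInDegree M i).unital
        hC).extVanishes_of_coind n b

/-- The iterated syzygies of a module in its minimal linear resolution. -/
noncomputable def linSyzygy (hC : l.IndiscretelyBased) (M : GrModule k (CatAlg.grading k l)) :
    ℕ → GrModule k (CatAlg.grading k l)
  | 0 => M
  | n + 1 => (cover hC (linSyzygy hC M n) n).ker

theorem IsLinear.linSyzygy {M : GrModule k (CatAlg.grading k l)} (h : IsLinear hC M 0) (n : ℕ) :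
    IsLinear hC (linSyzygy hC M n) n := by
  induction n with
  | zero => exact h
  | succ n ih =>
    have := ih.ker_cover
    exact_mod_cast this

theorem Hom.exact_kerι_comp {L M N : GrModule k (CatAlg.grading k l)} (f : Hom M N)
    (q : Hom L f.ker) (hq : Function.Surjective q.toLin) :
    Function.Exact (f.kerι.comp q).toLin f.toLin := by
  intro y
  rw [f.exact_kerι y]
  constructor
  · rintro ⟨x, rfl⟩
    obtain ⟨z, rfl⟩ := hq x
    exact ⟨z, rfl⟩
  · rintro ⟨z, rfl⟩
    exact ⟨q.toLin z, rfl⟩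

theorem IsLinear.exists_resolution {M : GrModule k (CatAlg.grading k l)} (h : IsLinear hC M 0) :
    ∃ (P : ℕ → GrModule k (CatAlg.grading k l)) (d : ∀ i, (P (i + 1)).Hom (P i))
      (ε : (P 0).Hom M), (∀ i, (P i).IsProjective) ∧ (∀ i : ℕ, (P i).GeneratedInDegree i) ∧
      Function.Surjective ε.toLin ∧ Function.Exact (d 0).toLin ε.toLin ∧
      ∀ i, Function.Exact (d (i + 1)).toLin (d i).toLin := by
  have hsurj : ∀ n : ℕ, Function.Surjective (cover hC (GrModule.linSyzygy hC M n) n).toLin :=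
    fun n => (h.linSyzygy n).generatedInDegree.cover_surjective
  refine ⟨fun n => free k (coverSrc hC (GrModule.linSyzygy hC M n) n),
    fun n => (cover hC (GrModule.linSyzygy hC M n) n).kerι.comp
      (cover hC (GrModule.linSyzygy hC M (n + 1)) (n + 1 : ℕ)),
    cover hC (GrModule.linSyzygy hC M 0) (0 : ℕ), fun n => free_isProjective,
    fun n => cover_generatedInDegree _ _, hsurj 0, ?_, fun n => ?_⟩
  · exact Hom.exact_kerι_comp _ _ (hsurj 1)
  · intro y
    refine Iff.trans ?_ (Hom.exact_kerι_comp _ _ (hsurj (n + 2)) y)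
    exact map_eq_zero_iff _ (Hom.kerι_injective _)

theorem degZero_generatedInDegree : (degZero (CatAlg.grading k l)).GeneratedInDegree 0 := by
  refine eq_top_iff.2 fun x _ => ?_
  set S := Submodule.span k {x | ∃ (a : CatAlg k C) (m : (degZero (CatAlg.grading k l)).carrier),
    m ∈ (degZero (CatAlg.grading k l)).deg 0 ∧ (degZero (CatAlg.grading k l)).act a m = x}
  have hle : CatAlg.grading k l 0 ≤ Submodule.map ((CatAlg.grading k l 0).subtype :
      (degZero (CatAlg.grading k l)).carrier →ₗ[k] CatAlg k C) S := by
    refine Submodule.span_le.2 ?_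
    rintro _ ⟨⟨y, z, f⟩, hf, rfl⟩
    have hm : CatAlg.basis k C ⟨y, z, f⟩ ∈ CatAlg.grading k l 0 :=
      Submodule.subset_span ⟨_, hf, rfl⟩
    have h1 : CatAlg.basis k C ⟨z, z, 𝟙 z⟩ ∈ CatAlg.grading k l 0 :=
      Submodule.subset_span ⟨_, l.len_id z, rfl⟩
    have h2 : (GradedAlg.projZero k (CatAlg.grading k l) (CatAlg.basis k C ⟨z, z, 𝟙 z⟩) :
        CatAlg k C) = CatAlg.basis k C ⟨z, z, 𝟙 z⟩ :=
      DirectSum.decompose_of_mem_same _ h1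
    let m : (degZero (CatAlg.grading k l)).carrier := ⟨_, hm⟩
    have hmS : m ∈ S := by
      refine Submodule.subset_span ⟨CatAlg.basis k C ⟨z, z, 𝟙 z⟩, m, ?_, ?_⟩
      · have e : (degZero (CatAlg.grading k l)).deg 0 = ⊤ := by
          simp only [degZero, if_true]
          rfl
        rw [e]
        trivial
      · refine Subtype.ext ?_
        change (GradedAlg.projZero k (CatAlg.grading k l) (CatAlg.basis k C ⟨z, z, 𝟙 z⟩) :
          CatAlg k C) * CatAlg.basis k C ⟨y, z, f⟩ = CatAlg.basis k C ⟨y, z, f⟩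
        rw [h2, CatAlg.basis_mul_basis_comp, Category.comp_id]
    exact ⟨m, hmS, rfl⟩
  obtain ⟨x', hx', e⟩ := hle x.2
  have : x' = x := Subtype.ext e
  rwa [← this]

/-- Koszulity in terms of the cobar cohomology: `Extⁿ` of `A₀` is concentrated in degree `n`. -/
theorem exists_resolution_iff (hC : l.IndiscretelyBased) :
    (∃ (P : ℕ → GrModule k (CatAlg.grading k l)) (d : ∀ i, (P (i + 1)).Hom (P i))
      (ε : (P 0).Hom (degZero (CatAlg.grading k l))),
      (∀ i, (P i).IsProjective) ∧ (∀ i : ℕ, (P i).GeneratedInDegree i) ∧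
      Function.Surjective ε.toLin ∧ Function.Exact (d 0).toLin ε.toLin ∧
      ∀ i, Function.Exact (d (i + 1)).toLin (d i).toLin) ↔
    ∀ (n : ℕ) (b : CatGrading.GrObj hC), b.deg ≠ n →
      RightMod.ExtVanishes n ((degZero (CatAlg.grading k l)).dual hC) b := by
  constructor
  · rintro ⟨P, d, ε, hP, hg, hε, h0, h1⟩ n b hb
    exact extVanishes_of_resolution hC n _ 0 P d ε hP (fun j => by simpa using hg j) hε h0 h1 b
      (by simpa using hb)
  · intro h
    refine IsLinear.exists_resolution (hC := hC)
      ⟨degZero_generatedInDegree.unital, fun b hb => ?_, fun n b hb => h n b (by simpa using hb)⟩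
    rw [eq_bot_iff]
    intro m hm
    have hm' : m ∈ (degZero (CatAlg.grading k l)).deg b.deg := hm.1
    have e : (degZero (CatAlg.grading k l)).deg b.deg = ⊥ := if_neg hb.ne
    rwa [e] at hm'

end Resolution

end GrModule

/-! ### Semisimplicity of the degree zero part -/

namespace CatAlg

variable (k : Type w) [Field k] {C : Type u} [Category.{v} C] (l : CatGrading C)

/-- The left ideal of `A₀` spanned by the morphisms of length zero with source `x`. -/
noncomputable def colIdeal (x : C) : Submodule k (CatAlg k C) :=
  Submodule.span k (basis k C '' {f | l.len f.hom = 0 ∧ f.src = x})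

theorem colIdeal_le (x : C) : colIdeal k l x ≤ grading k l 0 :=
  Submodule.span_mono (Set.image_mono fun _ h => h.1)

theorem basis_mem_colIdeal {x y : C} (f : x ⟶ y) (hf : l.len f = 0) :
    basis k C ⟨x, y, f⟩ ∈ colIdeal k l x :=
  Submodule.subset_span ⟨_, ⟨hf, rfl⟩, rfl⟩

variable {k l}

theorem mul_mem_colIdeal {x : C} {a u : CatAlg k C} (ha : a ∈ grading k l 0)
    (hu : u ∈ colIdeal k l x) : a * u ∈ colIdeal k l x := by
  induction ha using Submodule.span_induction with
  | zero => simp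
  | add a b _ _ ha hb =>
    rw [add_mul]
    exact Submodule.add_mem _ ha hb
  | smul c a _ ha =>
    rw [smul_mul_assoc]
    exact Submodule.smul_mem _ c ha
  | mem a ha =>
    obtain ⟨⟨y, z, f⟩, hf, rfl⟩ := ha
    have hf' : l.len f = 0 := hf
    induction hu using Submodule.span_induction with
    | zero => simp
    | add a b _ _ ha hb =>
      rw [mul_add]
      exact Submodule.add_mem _ ha hb
    | smul c a _ ha =>
      rw [mul_smul_comm]
      exact Submodule.smul_mem _ c ha
    | mem u hu =>
      obtain ⟨⟨r, t, g⟩, ⟨hg, rfl⟩, rfl⟩ := hu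
      have hg' : l.len g = 0 := hg
      by_cases e : t = y
      · subst e
        rw [basis_mul_basis_comp]
        exact basis_mem_colIdeal k l _ (by rw [l.len_comp, hf', hg'])
      · rw [basis_mul_basis_ne k _ _ e]
        exact Submodule.zero_mem _

/-- Since there is at most one morphism of length zero from `x` to `y`, multiplication by the
identity of `y` extracts one coefficient. -/
theorem id_mul_of_mem_colIdeal (hC : l.IndiscretelyBased) {x y : C} (f : x ⟶ y)
    (hf : l.len f = 0) {u : CatAlg k C} (hu : u ∈ colIdeal k l x) :
    basis k C ⟨y, y, 𝟙 y⟩ * u = (basis k C).repr u ⟨x, y, f⟩ • basis k C ⟨x, y, f⟩ := by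
  classical
  induction hu using Submodule.span_induction with
  | zero => simp
  | add a b _ _ ha hb => rw [mul_add, ha, hb, map_add, Finsupp.add_apply, add_smul]
  | smul c a _ ha =>
    rw [mul_smul_comm, ha, map_smul, Finsupp.smul_apply, smul_eq_mul, mul_smul]
  | mem u hu =>
    obtain ⟨⟨r, t, g⟩, ⟨hg, rfl⟩, rfl⟩ := hu
    rw [Module.Basis.repr_self, Finsupp.single_apply]
    by_cases e : t = y
    · subst e
      rw [basis_mul_basis_comp, Category.comp_id, hC.eq_of_len_eq_zero hf hg, if_pos rfl,
        one_smul]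
    · rw [basis_mul_basis_ne k _ _ e, if_neg, zero_smul]
      intro h
      exact e (congrArg CatMor.tgt h)

theorem isSimpleLeftIdeal_colIdeal (hC : l.IndiscretelyBased) (x : C) :
    IsSimpleLeftIdeal k (grading k l 0) (colIdeal k l x) where
  le := colIdeal_le k l x
  mul_mem _ ha _ hu := mul_mem_colIdeal ha hu
  mul_ne_zero := by
    have h := basis_mem_colIdeal k l (𝟙 x) (l.len_id x)
    refine ⟨_, colIdeal_le k l x h, _, h, ?_⟩
    rw [basis_mul_basis_comp]
    exact (basis k C).ne_zero _
  eq_bot_or_eq J hJ hmul := by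
    refine or_iff_not_imp_left.2 fun hne => le_antisymm hJ ?_
    obtain ⟨u, hu, hu0⟩ := J.ne_bot_iff.1 hne
    have hr : (basis k C).repr u ≠ 0 := fun h => hu0 ((basis k C).repr.map_eq_zero_iff.1 h)
    obtain ⟨f, hf⟩ := Finsupp.ne_iff.1 hr
    have hfm : f ∈ {f : CatMor C | l.len f.hom = 0 ∧ f.src = x} :=
      (basis k C).mem_span_image.1 (hJ hu) (Finsupp.mem_support_iff.2 hf)
    obtain ⟨r, y, f⟩ := f
    obtain ⟨hf0, rfl⟩ := hfm
    have hf0' : l.len f = 0 := hf0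
    have hfJ : basis k C ⟨r, y, f⟩ ∈ J := by
      have h1 := hmul _ (colIdeal_le k l y (basis_mem_colIdeal k l (𝟙 y) (l.len_id y))) u hu
      rw [id_mul_of_mem_colIdeal hC f hf0' (hJ hu)] at h1
      exact (J.smul_mem_iff hf).1 h1
    refine Submodule.span_le.2 ?_
    rintro _ ⟨⟨r', z, g⟩, ⟨hg, rfl⟩, rfl⟩
    have hg' : l.len g = 0 := hg
    have hi : IsIso f := (hC.isIso_iff f).2 hf0'
    have h2 := hmul _ (colIdeal_le k l y (basis_mem_colIdeal k l (inv f ≫ g) (by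
      rw [l.len_comp, hg', CatGrading.len_eq_zero_of_isIso]))) _ hfJ
    rwa [basis_mul_basis_comp, IsIso.hom_inv_id_assoc] at h2

theorem isSemisimpleSubalgebra_grading_zero (hC : l.IndiscretelyBased) :
    IsSemisimpleSubalgebra k (grading k l 0) := by
  refine ⟨Set.range (colIdeal k l), ?_, ?_, ?_⟩
  · rintro _ ⟨x, rfl⟩
    exact isSimpleLeftIdeal_colIdeal hC x
  · refine iSupIndep.sSupIndep_range fun x => ?_
    have h1 : (⨆ (y : C) (_ : y ≠ x), colIdeal k l y) ≤
        Submodule.span k (basis k C '' {f | f.src ≠ x}) :=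
      iSup₂_le fun y hy => Submodule.span_mono (Set.image_mono fun f hf => by
        obtain ⟨-, rfl⟩ := hf
        exact hy)
    refine Disjoint.mono_right h1 ((basis k C).linearIndependent.disjoint_span_image ?_)
    rw [Set.disjoint_left]
    exact fun f hf hf' => hf' hf.2
  · refine le_antisymm (sSup_le ?_) (Submodule.span_le.2 ?_)
    · rintro _ ⟨x, rfl⟩
      exact colIdeal_le k l x
    · rintro _ ⟨f, hf, rfl⟩
      have hle : colIdeal k l f.src ≤ sSup (Set.range (colIdeal k l)) :=
        le_sSup (Set.mem_range_self f.src)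
      exact hle (basis_mem_colIdeal k l f.hom hf)

end CatAlg

/-! ### The cobar complex in terms of chains -/

namespace RightMod

variable {k : Type w} [Field k] {D : Type u} [Category.{v} D]

/-- Naturally bijective right modules are retracts of each other. -/
theorem Hom.isRetract_of_bijective {N N' : RightMod.{w, v, u} k D} (F : Hom N N')
    (h : ∀ b, Function.Bijective (F.app b)) : IsRetract N N' ∧ IsRetract N' N := by
  let e := fun b => LinearEquiv.ofBijective (F.app b) (h b)
  let G : Hom N' N := ⟨fun b => (e b).symm.toLinearMap, fun {a b} f v => by
    refine (h a).1 ?_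
    rw [F.naturality]
    exact ((e a).apply_symm_apply _).trans (congrArg _ ((e b).apply_symm_apply v).symm)⟩
  exact ⟨⟨F, G, fun b v => (e b).symm_apply_apply v⟩, ⟨G, F, fun b v => (e b).apply_symm_apply v⟩⟩

end RightMod

section Chains

open OneWayCat

variable {D : Type u} [Category.{v} D] [OneWayCat D]

/-- Chains of `n + 1` composable non-identities from `a` to `b` in a one-way category. -/
inductive OneWayChain (b : D) : ℕ → D → Type (max u v)
  | single {a : D} (f : a ⟶ b) (h : deg a < deg b) : OneWayChain b 0 a
  | cons {n : ℕ} {a a' : D} (f : a ⟶ a') (h : deg a < deg a') (c : OneWayChain b n a') :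
      OneWayChain b (n + 1) a

namespace OneWayChain

variable {b : D}

/-- The composition of a chain. -/
def comp : ∀ {n : ℕ} {a : D}, OneWayChain b n a → (a ⟶ b)
  | _, _, single f _ => f
  | _, _, cons f _ c => f ≫ c.comp

/-- The chain obtained by composing two consecutive morphisms, counted from the source. -/
def face : ∀ {n : ℕ} {a : D}, OneWayChain b (n + 1) a → Fin (n + 1) → OneWayChain b n a
  | 0, _, cons f h (single g h'), _ => single (f ≫ g) (h.trans h')
  | _ + 1, _, cons f h (cons g h' c), i =>
    Fin.cases (cons (f ≫ g) (h.trans h') c) (fun j => cons f h (face (cons g h' c) j)) i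

theorem face_single {a a' : D} (f : a ⟶ a') (h : deg a < deg a') (g : a' ⟶ b)
    (h' : deg a' < deg b) (i : Fin 1) :
    (cons f h (single g h')).face i = single (f ≫ g) (h.trans h') := rfl

theorem face_zero {n : ℕ} {a a' a'' : D} (f : a ⟶ a') (h : deg a < deg a') (g : a' ⟶ a'')
    (h' : deg a' < deg a'') (c : OneWayChain b n a'') :
    (cons f h (cons g h' c)).face 0 = cons (f ≫ g) (h.trans h') c := rfl

theorem face_succ {n : ℕ} {a a' : D} (f : a ⟶ a') (h : deg a < deg a')
    (c : OneWayChain b (n + 1) a') (i : Fin (n + 1)) :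
    (cons f h c).face i.succ = cons f h (c.face i) := by
  cases c with
  | cons g h' c => rfl

theorem comp_face {n : ℕ} {a : D} (c : OneWayChain b (n + 1) a) (i : Fin (n + 1)) :
    (c.face i).comp = c.comp := by
  induction n generalizing a with
  | zero =>
    obtain _ | ⟨f, h, c⟩ := c
    obtain ⟨g, h'⟩ | _ := c
    rfl
  | succ n ih =>
    obtain _ | ⟨f, h, c⟩ := c
    induction i using Fin.cases with
    | zero =>
      obtain _ | ⟨g, h', c⟩ := c
      exact Category.assoc _ _ _
    | succ i =>
      rw [face_succ]
      exact congrArg (f ≫ ·) (ih c i)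

end OneWayChain

namespace RightMod

variable {k : Type w} [Field k]

/-- The iterated cosyzygies of a right module; these are the terms of the cobar complex. -/
noncomputable def iterCosyz : ℕ → RightMod.{w, v, u} k D → RightMod.{w, v, u} k D
  | 0, N => N
  | n + 1, N => iterCosyz n N.cosyz

/-- The differential of the cobar complex. -/
noncomputable def cobarD (b : D) : ∀ (n : ℕ) (N : RightMod.{w, v, u} k D),
    (iterCosyz n N).obj b → (iterCosyz n N.cosyz).obj b
  | 0, N => N.toCosyz b
  | n + 1, N => cobarD b n N.cosyz

theorem extVanishes_succ_iff_cobarD (N : RightMod.{w, v, u} k D) (b : D) (n : ℕ) :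
    ExtVanishes (n + 1) N b ↔ ∀ φ : (iterCosyz n N.cosyz).obj b,
      cobarD b n N.cosyz φ = 0 → ∃ v, cobarD b n N v = φ := by
  induction n generalizing N with
  | zero => rfl
  | succ n ih => exact ih N.cosyz

/-- An element of the cobar complex as a function on chains. -/
noncomputable def chainEval {b : D} : ∀ (n : ℕ) (N : RightMod.{w, v, u} k D),
    (iterCosyz n N.cosyz).obj b → ∀ a, OneWayChain b n a → N.obj a
  | 0, _, φ, _, .single f h => φ _ ⟨f, h⟩
  | n + 1, N, φ, _, .cons f h c => chainEval n N.cosyz φ _ c _ ⟨f, h⟩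

/-- The element of the cobar complex given by a function on chains. -/
noncomputable def ofChain {b : D} : ∀ (n : ℕ) (N : RightMod.{w, v, u} k D),
    (∀ a, OneWayChain b n a → N.obj a) → (iterCosyz n N.cosyz).obj b
  | 0, _, W => fun a f => W a (.single f.1 f.2)
  | n + 1, N, W => ofChain n N.cosyz fun _ c a f => W a (.cons f.1 f.2 c)

theorem chainEval_ofChain {b : D} (n : ℕ) (N : RightMod.{w, v, u} k D)
    (W : ∀ a, OneWayChain b n a → N.obj a) : chainEval n N (ofChain n N W) = W := by
  induction n generalizing N with
  | zero =>
    funext a c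
    obtain ⟨f, h⟩ | _ := c
    rfl
  | succ n ih =>
    funext a c
    obtain _ | ⟨f, h, c⟩ := c
    change chainEval n N.cosyz (ofChain n N.cosyz _) _ c a ⟨f, h⟩ = _
    rw [ih]

theorem ofChain_chainEval {b : D} (n : ℕ) (N : RightMod.{w, v, u} k D)
    (φ : (iterCosyz n N.cosyz).obj b) : ofChain n N (chainEval n N φ) = φ := by
  induction n generalizing N with
  | zero => rfl
  | succ n ih => exact ih N.cosyz φ

theorem chainEval_zero {b : D} (n : ℕ) (N : RightMod.{w, v, u} k D) :
    chainEval (b := b) n N 0 = 0 := by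
  induction n generalizing N with
  | zero =>
    funext a c
    obtain ⟨f, h⟩ | _ := c
    rfl
  | succ n ih =>
    funext a c
    obtain _ | ⟨f, h, c⟩ := c
    change chainEval n N.cosyz 0 _ c a ⟨f, h⟩ = 0
    rw [ih]
    rfl

/-- The differential of the cobar complex in terms of chains. -/
theorem chainEval_cobarD {b : D} (n : ℕ) (N : RightMod.{w, v, u} k D)
    (φ : (iterCosyz n N.cosyz).obj b) {a a' : D} (f : a ⟶ a') (h : deg a < deg a')
    (c : OneWayChain b n a') :
    chainEval (n + 1) N (cobarD b n N.cosyz φ) a (.cons f h c) = (-1 : k) ^ n •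
      (∑ i : Fin (n + 1), (-1 : k) ^ (i : ℕ) •
        chainEval n N φ a ((OneWayChain.cons f h c).face i) -
          N.map f (chainEval n N φ a' c)) := by
  induction n generalizing N a a' with
  | zero =>
    obtain ⟨g, h'⟩ | _ := c
    have e : chainEval 1 N (cobarD b 0 N.cosyz φ) a (.cons f h (.single g h')) =
      φ a ⟨f ≫ g, h.trans h'⟩ - N.map f (φ a' ⟨g, h'⟩) := cosyz_map_of_lt N g φ f h h'
    rw [e]
    simp [OneWayChain.face_single, chainEval]
  | succ n ih =>
    obtain _ | ⟨g, h', c⟩ := c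
    change chainEval (n + 1) N.cosyz (cobarD b n N.cosyz.cosyz φ) _ (.cons g h' c) a ⟨f, h⟩ = _
    rw [ih N.cosyz φ g h' c, Fin.sum_univ_succ (n := n + 1)]
    have e1 : ∀ x : N.cosyz.obj a', ∀ r : k, (r • x) a ⟨f, h⟩ = r • x a ⟨f, h⟩ := fun _ _ => rfl
    have e2 : ∀ x y : N.cosyz.obj a', (x - y) a ⟨f, h⟩ = x a ⟨f, h⟩ - y a ⟨f, h⟩ :=
      fun _ _ => rfl
    have e3 : ∀ x : Fin (n + 1) → N.cosyz.obj a',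
        (∑ i, x i) a ⟨f, h⟩ = ∑ i, x i a ⟨f, h⟩ := by
      intro x
      rw [Finset.sum_apply, Finset.sum_apply]
    rw [e1, e2, e3, cosyz_map_of_lt N g _ f h h']
    simp only [OneWayChain.face_zero, OneWayChain.face_succ, Fin.val_zero, Fin.val_succ, pow_zero,
      one_smul, e1]
    have e4 : ∀ i : Fin (n + 1), chainEval (n + 1) N φ a
        (.cons f h ((OneWayChain.cons g h' c).face i)) =
        chainEval n N.cosyz φ a' ((OneWayChain.cons g h' c).face i) a ⟨f, h⟩ := fun _ => rfl
    have e5 : ∀ {d : D} (f : d ⟶ _) (h : deg d < _), chainEval (n + 1) N φ d (.cons f h c) =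
      chainEval n N.cosyz φ _ c d ⟨f, h⟩ := fun _ _ => rfl
    simp only [e4, e5, pow_succ, mul_neg, mul_one, neg_smul, Finset.sum_neg_distrib]
    rw [← smul_neg]
    congr 1
    abel

/-- The cochains on chains of a right module whose cobar class vanishes for trivial reasons: zero
in the lowest degree and coboundaries in the other ones. -/
def IsChainCoboundary (N : RightMod.{w, v, u} k D) (b : D) :
    ∀ n : ℕ, (∀ a, OneWayChain b n a → N.obj a) → Prop
  | 0, W => W = 0
  | n + 1, W => ∃ V : ∀ a, OneWayChain b n a → N.obj a, ∀ (a : D) (c : OneWayChain b (n + 1) a),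
      W a c = ∑ i : Fin (n + 1), (-1 : k) ^ (i : ℕ) • V a (c.face i)

/-- For a right module on which non-identities act by zero, the cobar complex is the complex of
cochains on chains, with the alternating sums of faces as differential. -/
theorem extVanishes_succ_iff (N : RightMod.{w, v, u} k D) (b : D) (n : ℕ)
    (hN : ∀ {a b : D} (f : a ⟶ b), deg a < deg b → ∀ v, N.map f v = 0) :
    ExtVanishes (n + 1) N b ↔ ∀ W : ∀ a, OneWayChain b n a → N.obj a,
      (∀ (a : D) (c : OneWayChain b (n + 1) a),
        ∑ i : Fin (n + 1), (-1 : k) ^ (i : ℕ) • W a (c.face i) = 0) →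
      IsChainCoboundary N b n W := by
  have key : ∀ (n : ℕ) (φ : (iterCosyz n N.cosyz).obj b) {a : D} (c : OneWayChain b (n + 1) a),
      chainEval (n + 1) N (cobarD b n N.cosyz φ) a c = (-1 : k) ^ n •
        ∑ i : Fin (n + 1), (-1 : k) ^ (i : ℕ) • chainEval n N φ a (c.face i) := by
    intro n φ a c
    obtain _ | ⟨f, h, c⟩ := c
    rw [chainEval_cobarD, hN f h, sub_zero]
  have hinj : ∀ (n : ℕ) {φ φ' : (iterCosyz n N.cosyz).obj b},
      chainEval n N φ = chainEval n N φ' → φ = φ' := by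
    intro n φ φ' e
    rw [← ofChain_chainEval n N φ, e, ofChain_chainEval]
  have hsign : ∀ n : ℕ, (-1 : k) ^ n * (-1) ^ n = 1 := by
    intro n
    rw [← mul_pow]
    simp
  rw [extVanishes_succ_iff_cobarD]
  have hcocycle : ∀ φ : (iterCosyz n N.cosyz).obj b, cobarD b n N.cosyz φ = 0 ↔
      ∀ (a : D) (c : OneWayChain b (n + 1) a),
        ∑ i : Fin (n + 1), (-1 : k) ^ (i : ℕ) • chainEval n N φ a (c.face i) = 0 := by
    intro φ
    constructor
    · intro e a c
      have h1 := key n φ c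
      rw [e] at h1
      have h2 : chainEval (n + 1) N (0 : (iterCosyz (n + 1) N.cosyz).obj b) a c = 0 := by
        rw [chainEval_zero]
        rfl
      rw [show chainEval (n + 1) N (0 : (iterCosyz n N.cosyz.cosyz).obj b) a c = 0 from h2] at h1
      have h3 := congrArg ((-1 : k) ^ n • ·) h1
      simpa only [smul_smul, hsign, one_smul, smul_zero] using h3.symm
    · intro e
      refine hinj (n + 1) ?_
      funext a c
      refine (key n φ c).trans ?_
      rw [e, smul_zero]
      exact (congrFun (congrFun (chainEval_zero (n + 1) N) a) c).symm
  have hcob : ∀ φ : (iterCosyz n N.cosyz).obj b, (∃ v, cobarD b n N v = φ) ↔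
      IsChainCoboundary N b n (chainEval n N φ) := by
    intro φ
    cases n with
    | zero =>
      constructor
      · rintro ⟨v, rfl⟩
        funext a c
        obtain ⟨f, h⟩ | _ := c
        exact hN f h v
      · intro e
        refine ⟨0, hinj 0 ?_⟩
        rw [show chainEval 0 N φ = 0 from e, ← chainEval_zero 0 N]
        congr 1
        exact map_zero (N.toCosyz b)
    | succ n =>
      constructor
      · rintro ⟨v, rfl⟩
        refine ⟨fun a c => (-1 : k) ^ n • chainEval n N v a c, fun a c => ?_⟩
        refine (key n v c).trans ?_
        rw [Finset.smul_sum]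
        exact Finset.sum_congr rfl fun i _ => smul_comm _ _ _
      · rintro ⟨V, hV⟩
        refine ⟨ofChain n N fun a c => (-1 : k) ^ n • V a c, hinj (n + 1) ?_⟩
        funext a c
        refine (key n _ c).trans ?_
        rw [hV, chainEval_ofChain, Finset.smul_sum]
        refine Finset.sum_congr rfl fun i _ => ?_
        rw [smul_comm ((-1 : k) ^ (i : ℕ)), smul_smul, hsign, one_smul]
  constructor
  · intro H W hW
    rw [← chainEval_ofChain n N W, ← hcob]
    refine H _ ((hcocycle _).2 ?_)
    rwa [chainEval_ofChain]
  · intro H φ hφ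
    exact (hcob φ).2 (H _ ((hcocycle φ).1 hφ))

/-- A right module which vanishes in degrees below `m` has no `Extⁿ` in degrees below `m + n`. -/
theorem extVanishes_of_deg_lt {n : ℕ} : ∀ (N : RightMod.{w, v, u} k D) (m : ℤ) {b : D},
    deg b < m + n → (∀ a : D, deg a < m → Subsingleton (N.obj a)) → ExtVanishes n N b := by
  have hc : ∀ (N : RightMod.{w, v, u} k D) (m : ℤ),
      (∀ a : D, deg a < m → Subsingleton (N.obj a)) →
      ∀ a : D, deg a < m + 1 → Subsingleton (N.cosyz.obj a) := by
    intro N m hN a ha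
    refine ⟨fun ψ ψ' => ?_⟩
    funext c f
    have := hN c (by have := f.2; omega)
    exact Subsingleton.elim _ _
  induction n using Nat.twoStepInduction with
  | zero =>
    intro N m b hb hN v _
    have := hN b (by simpa using hb)
    exact Subsingleton.elim _ _
  | one =>
    intro N m b hb hN ψ _
    have := hc N m hN b (by simpa using hb)
    exact ⟨0, Subsingleton.elim _ _⟩
  | more n _ ih =>
    intro N m b hb hN
    exact ih N.cosyz (m + 1) (by push_cast at hb ⊢; omega) (hc N m hN)

end RightMod

end Chains

/-! ### The dual of the degree zero part -/

namespace CatGrading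

variable {C : Type u} [Category.{v} C] {l : CatGrading C} {hC : l.IndiscretelyBased}

/-- The morphisms of length zero to an object of the one-way category, if the degree of the latter
is zero. They form a basis of the component of `A₀` at this object. -/
structure ZeroMor (b : GrObj hC) where
  src : C
  hom : src ⟶ b.obj
  len_hom : l.len hom = 0
  deg_eq : b.deg = 0

/-- The composition with a morphism of the one-way category which preserves the degree. -/
noncomputable def ZeroMor.postcomp {a b : GrObj hC} (z : ZeroMor a) (f : a ⟶ b)
    (h : a.deg = b.deg) : ZeroMor b where
  src := z.src
  hom := z.hom ≫ f.1
  len_hom := by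
    have := f.2
    have := z.len_hom
    rw [l.len_comp]
    omega
  deg_eq := h ▸ z.deg_eq

variable (k : Type w) [Field k]

open Classical in
/-- The dual of `A₀` in coordinates: the functions on the morphisms of length zero, on which the
morphisms of positive length act by zero. -/
@[reducible]
noncomputable def zeroMorMod (hC : l.IndiscretelyBased) : RightMod.{w, v, u} k (GrObj hC) where
  obj b := ZeroMor b → k
  map {a b} f :=
    { toFun := fun φ z => if h : a.deg = b.deg then φ (z.postcomp f h) else 0
      map_add' := fun φ ψ => by
        funext z
        simp only [Pi.add_apply]
        split_ifs <;> simp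
      map_smul' := fun c φ => by
        funext z
        simp only [Pi.smul_apply, RingHom.id_apply]
        split_ifs <;> simp }
  map_id b φ := by
    funext z
    refine (dif_pos rfl).trans ?_
    congr 1
    obtain ⟨x, f, _, _⟩ := z
    simp [ZeroMor.postcomp, GrObj.id_val]
  map_comp {a b c} f g φ := by
    have hf := OneWayCat.deg_le f
    have hg := OneWayCat.deg_le g
    simp only [OneWayCat.deg] at hf hg
    funext z
    simp only [LinearMap.coe_mk, AddHom.coe_mk]
    by_cases h : a.deg = b.deg
    · by_cases h' : b.deg = c.deg
      · rw [dif_pos (h.trans h'), dif_pos h, dif_pos h']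
        congr 1
        simp [ZeroMor.postcomp, GrObj.comp_val]
      · rw [dif_neg (by omega), dif_pos h, dif_neg h']
    · rw [dif_neg (by omega), dif_neg h]

variable {k}

theorem zeroMorMod_map_of_lt {a b : GrObj hC} (f : a ⟶ b) (h : a.deg < b.deg)
    (φ : (zeroMorMod k hC).obj b) : (zeroMorMod k hC).map f φ = 0 := by
  funext z
  exact dif_neg h.ne

theorem zeroMorMod_map_of_eq {a b : GrObj hC} (f : a ⟶ b) (h : a.deg = b.deg)
    (φ : (zeroMorMod k hC).obj b) (z : ZeroMor a) :
    (zeroMorMod k hC).map f φ z = φ (z.postcomp f h) := dif_pos h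

theorem subsingleton_zeroMorMod {b : GrObj hC} (h : b.deg ≠ 0) :
    Subsingleton ((zeroMorMod k hC).obj b) :=
  ⟨fun _ _ => funext fun z => absurd z.deg_eq h⟩

end CatGrading

namespace GrModule

open CatGrading

variable {k : Type w} [Field k] {C : Type u} [Category.{v} C] {l : CatGrading C}
  {hC : l.IndiscretelyBased}

theorem degZero_actMor_of_len_ne_zero {x y : C} (f : x ⟶ y) (hf : l.len f ≠ 0)
    (m : (degZero (CatAlg.grading k l)).carrier) :
    (degZero (CatAlg.grading k l)).actMor f m = 0 := by
  have h0 : GradedAlg.projZero k (CatAlg.grading k l) (CatAlg.basis k C ⟨x, y, f⟩) = 0 :=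
    Subtype.ext (DirectSum.decompose_of_mem_ne _ (CatAlg.basis_mem_grading k l ⟨x, y, f⟩) hf)
  refine Subtype.ext ?_
  change (GradedAlg.projZero k (CatAlg.grading k l) (CatAlg.basis k C ⟨x, y, f⟩) : CatAlg k C) *
    m.1 = 0
  rw [h0]
  exact zero_mul _

theorem degZero_actMor_of_len_eq_zero {x y : C} (f : x ⟶ y) (hf : l.len f = 0)
    (m : (degZero (CatAlg.grading k l)).carrier) :
    ((degZero (CatAlg.grading k l)).actMor f m).1 = CatAlg.basis k C ⟨x, y, f⟩ * m.1 := by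
  have hm : CatAlg.basis k C ⟨x, y, f⟩ ∈ CatAlg.grading k l 0 := by
    have := CatAlg.basis_mem_grading k l ⟨x, y, f⟩
    rwa [show l.len (CatMor.hom ⟨x, y, f⟩) = 0 from hf] at this
  have h0 : (GradedAlg.projZero k (CatAlg.grading k l) (CatAlg.basis k C ⟨x, y, f⟩) : CatAlg k C) =
      CatAlg.basis k C ⟨x, y, f⟩ := DirectSum.decompose_of_mem_same _ hm
  change (GradedAlg.projZero k (CatAlg.grading k l) (CatAlg.basis k C ⟨x, y, f⟩) : CatAlg k C) *
    m.1 = _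
  rw [h0]

/-- The basis element of a component of `A₀` given by a morphism of length zero. -/
noncomputable def ofZeroMor (k : Type w) [Field k] {b : GrObj hC} (z : ZeroMor b) :
    (degZero (CatAlg.grading k l)).comp b :=
  ⟨⟨CatAlg.basis k C ⟨z.src, b.obj, z.hom⟩,
    by
      have := CatAlg.basis_mem_grading k l ⟨z.src, b.obj, z.hom⟩
      rwa [show l.len (CatMor.hom ⟨z.src, b.obj, z.hom⟩) = 0 from z.len_hom] at this⟩,
    by
      refine ⟨?_, Subtype.ext ?_⟩
      · change _ ∈ (if b.deg = 0 then (⊤ : Submodule k (CatAlg.grading k l 0)) else ⊥)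
        rw [if_pos z.deg_eq]
        trivial
      · refine (degZero_actMor_of_len_eq_zero (𝟙 b.obj) (l.len_id _) _).trans ?_
        refine (CatAlg.basis_mul_basis_comp k z.hom (𝟙 b.obj)).trans ?_
        rw [Category.comp_id]
        rfl⟩

theorem compMap_ofZeroMor {a b : GrObj hC} (f : a ⟶ b) (z : ZeroMor a) (h : a.deg = b.deg) :
    (degZero (CatAlg.grading k l)).compMap f (ofZeroMor k z) = ofZeroMor k (z.postcomp f h) := by
  have hf : l.len f.1 = 0 := by
    have := f.2
    omega
  refine Subtype.ext (Subtype.ext ?_)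
  refine (degZero_actMor_of_len_eq_zero f.1 hf _).trans ?_
  exact CatAlg.basis_mul_basis_comp k z.hom f.1

theorem span_ofZeroMor (b : GrObj hC) :
    Submodule.span k (Set.range (ofZeroMor k : ZeroMor b → _)) = ⊤ := by
  refine eq_top_iff.2 fun m _ => ?_
  by_cases hb : b.deg = 0
  · obtain ⟨⟨m, hm⟩, hmb⟩ := m
    -- the span in the category algebra of the morphisms of length zero with target `b`
    let T : Submodule k (CatAlg k C) :=
      (Submodule.span k (Set.range (ofZeroMor k : ZeroMor b → _))).map
        ((CatAlg.grading k l 0).subtype ∘ₗ ((degZero (CatAlg.grading k l)).comp b).subtype)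
    have key : ∀ u ∈ CatAlg.grading k l 0,
        CatAlg.basis k C ⟨b.obj, b.obj, 𝟙 b.obj⟩ * u ∈ T := by
      intro u hu
      induction hu using Submodule.span_induction with
      | zero => simp
      | add u u' _ _ h h' =>
        rw [mul_add]
        exact T.add_mem h h'
      | smul c u _ h =>
        rw [mul_smul_comm]
        exact T.smul_mem c h
      | mem u hu =>
        obtain ⟨⟨x, y, f⟩, hf, rfl⟩ := hu
        have hf' : l.len f = 0 := hf
        by_cases e : y = b.obj
        · subst e
          rw [CatAlg.basis_mul_basis_comp, Category.comp_id]
          exact ⟨ofZeroMor k ⟨x, f, hf', hb⟩, Submodule.subset_span ⟨_, rfl⟩, rfl⟩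
        · rw [CatAlg.basis_mul_basis_ne k _ _ e]
          exact T.zero_mem
    have h1 : CatAlg.basis k C ⟨b.obj, b.obj, 𝟙 b.obj⟩ * m = m := by
      have := degZero_actMor_of_len_eq_zero (k := k) (𝟙 b.obj) (l.len_id _) ⟨m, hm⟩
      rw [hmb.2] at this
      exact this.symm
    obtain ⟨t, ht, e⟩ := key m hm
    have : t = ⟨⟨m, hm⟩, hmb⟩ := Subtype.ext (Subtype.ext (e.trans h1))
    rwa [← this]
  · have h0 : m.1 = 0 := by
      have h2 := m.2.1
      change m.1 ∈ (if b.deg = 0 then (⊤ : Submodule k (CatAlg.grading k l 0)) else ⊥) at h2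
      rwa [if_neg hb] at h2
    rw [show m = 0 from Subtype.ext h0]
    exact Submodule.zero_mem _

/-- A functional on a component of `A₀` as a function on the morphisms of length zero. -/
noncomputable def degZeroDualHom (k : Type w) [Field k] (hC : l.IndiscretelyBased) :
    RightMod.Hom ((degZero (CatAlg.grading k l)).dual hC) (zeroMorMod k hC) where
  app b :=
    { toFun := fun φ z => φ (ofZeroMor k z)
      map_add' := fun _ _ => rfl
      map_smul' := fun _ _ => rfl }
  naturality {a b} f φ := by
    funext z
    change φ ((degZero (CatAlg.grading k l)).compMap f (ofZeroMor k z)) = _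
    by_cases h : a.deg = b.deg
    · rw [zeroMorMod_map_of_eq f h, compMap_ofZeroMor f z h]
      rfl
    · have hf : l.len f.1 ≠ 0 := by
        have := f.2
        omega
      have h0 : (degZero (CatAlg.grading k l)).compMap f (ofZeroMor k z) = 0 :=
        Subtype.ext (degZero_actMor_of_len_ne_zero f.1 hf _)
      have hd : a.deg < b.deg := lt_of_le_of_ne (OneWayCat.deg_le f) h
      rw [h0, map_zero, zeroMorMod_map_of_lt f hd]
      rfl

theorem bijective_degZeroDualHom (b : GrObj hC) :
    Function.Bijective ((degZeroDualHom k hC).app b) := by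
  constructor
  · intro φ ψ h
    refine LinearMap.ext_on (span_ofZeroMor b) ?_
    rintro _ ⟨z, rfl⟩
    exact congrFun h z
  · intro F
    classical
    refine ⟨((CatAlg.basis k C).constr k fun f : CatMor C =>
        if h : ∃ z : ZeroMor b, f = ⟨z.src, b.obj, z.hom⟩ then F h.choose else 0) ∘ₗ
      (CatAlg.grading k l 0).subtype ∘ₗ ((degZero (CatAlg.grading k l)).comp b).subtype, ?_⟩
    funext z
    have h : ∃ z' : ZeroMor b, (⟨z.src, b.obj, z.hom⟩ : CatMor C) = ⟨z'.src, b.obj, z'.hom⟩ :=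
      ⟨z, rfl⟩
    refine ((CatAlg.basis k C).constr_basis k _ _).trans ((dif_pos h).trans (congrArg F ?_))
    have e := h.choose_spec
    generalize h.choose = z' at e
    obtain ⟨x, f, _, _⟩ := z
    obtain ⟨x', f', _, _⟩ := z'
    simp only [CatMor.mk.injEq] at e
    obtain ⟨rfl, -, e⟩ := e
    cases e
    rfl

theorem extVanishes_degZero_dual_iff (n : ℕ) (b : GrObj hC) :
    RightMod.ExtVanishes n ((degZero (CatAlg.grading k l)).dual hC) b ↔
      RightMod.ExtVanishes n (zeroMorMod k hC) b := by
  obtain ⟨h1, h2⟩ := (degZeroDualHom k hC).isRetract_of_bijective bijective_degZeroDualHom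
  exact ⟨fun h => h2.extVanishes h, fun h => h1.extVanishes h⟩

end GrModule

/-! ### Isomorphisms of factorizations -/

section Ladders

variable {C : Type u} [Category.{v} C]

theorem CategoryTheory.ComposableArrows.precomp_map_zero_succ {n : ℕ} (F : ComposableArrows C n)
    {x : C} (f : x ⟶ F.obj 0) (j : Fin (n + 1)) :
    (F.precomp f).map (homOfLE (Fin.zero_le j.succ)) = f ≫ F.map (homOfLE (Fin.zero_le j)) := by
  obtain ⟨_ | j, hj⟩ := j
  · refine (Category.comp_id f).symm.trans (congrArg (f ≫ ·) ?_)
    exact (F.map_id 0).symm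
  · rfl

namespace NontrivFactorization

/-- The factorization into two factors. -/
def pair {x y z : C} (f : x ⟶ y) (g : y ⟶ z) (hf : ¬ IsIso f) (hg : ¬ IsIso g) :
    NontrivFactorization (f ≫ g) 0 where
  mid := ComposableArrows.mk₀ y
  first := f
  last := g
  first_not_isIso := hf
  mid_not_isIso i := i.elim0
  last_not_isIso := hg
  fac := congrArg (f ≫ ·) (Category.id_comp g)

/-- A factorization of `p` and a morphism `f` give a factorization of `f ≫ p` whose first factor
is `f`. -/
def cons {w x y : C} {p : x ⟶ y} {n : ℕ} (f : w ⟶ x) (hf : ¬ IsIso f)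
    (F : NontrivFactorization p n) : NontrivFactorization (f ≫ p) (n + 1) where
  mid := F.mid.precomp F.first
  first := f
  last := F.last
  first_not_isIso := hf
  mid_not_isIso i := by
    induction i using Fin.cases with
    | zero => exact F.first_not_isIso
    | succ i => exact F.mid_not_isIso i
  last_not_isIso := F.last_not_isIso
  fac := by
    refine congrArg (f ≫ ·) ?_
    refine (congrArg (· ≫ F.last)
      (ComposableArrows.precomp_map_zero_succ F.mid F.first (Fin.last n))).trans ?_
    exact (Category.assoc _ _ _).trans F.fac

/-- Isomorphic factorizations of possibly different morphisms: the isomorphisms `α` and `β` of the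
sources and the targets extend to isomorphisms of the intermediate objects. -/
def Ladder {x y x' y' : C} {p : x ⟶ y} {p' : x' ⟶ y'} {n : ℕ} (α : x ≅ x') (β : y ≅ y')
    (F : NontrivFactorization p n) (G : NontrivFactorization p' n) : Prop :=
  ∃ e : F.mid ≅ G.mid, F.first ≫ e.hom.app 0 = α.hom ≫ G.first ∧
    e.hom.app (Fin.last n) ≫ G.last = F.last ≫ β.hom

namespace Ladder

variable {x y x' y' x'' y'' : C} {p : x ⟶ y} {p' : x' ⟶ y'} {p'' : x'' ⟶ y''} {n : ℕ}
  {α : x ≅ x'} {β : y ≅ y'} {α' : x' ≅ x''} {β' : y' ≅ y''}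
  {F : NontrivFactorization p n} {G : NontrivFactorization p' n} {H : NontrivFactorization p'' n}

theorem symm (h : Ladder α β F G) : Ladder α.symm β.symm G F := by
  obtain ⟨e, h1, h2⟩ := h
  refine ⟨e.symm, ?_, ?_⟩
  · rw [← cancel_epi α.hom, ← Category.assoc, ← h1]
    simp
  · rw [← cancel_mono β.hom, Category.assoc, ← h2]
    simp

theorem trans (h : Ladder α β F G) (h' : Ladder α' β' G H) :
    Ladder (α ≪≫ α') (β ≪≫ β') F H := by
  obtain ⟨e, h1, h2⟩ := h
  obtain ⟨e', h1', h2'⟩ := h'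
  refine ⟨e ≪≫ e', ?_, ?_⟩
  · rw [Iso.trans_hom, NatTrans.comp_app, ← Category.assoc, h1, Category.assoc, h1', Iso.trans_hom,
      Category.assoc]
  · rw [Iso.trans_hom, NatTrans.comp_app, Category.assoc, h2', ← Category.assoc, h2, Iso.trans_hom,
      Category.assoc]

/-- Ladders are compatible with the deletion of intermediate objects. -/
theorem restrict {l : CatGrading C} (hC : l.IndiscretelyBased) (h : Ladder α β F G) {m : ℕ}
    (φ : Fin (m + 1) ↪o Fin (n + 1)) : Ladder α β (F.restrict hC φ) (G.restrict hC φ) := by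
  obtain ⟨e, h1, h2⟩ := h
  have nat : ∀ {i j : Fin (n + 1)} (hij : i ≤ j),
      F.seg hij ≫ e.hom.app j = e.hom.app i ≫ G.seg hij := fun hij => e.hom.naturality _
  refine ⟨Functor.isoWhiskerLeft _ e, ?_, ?_⟩
  · change (F.first ≫ F.seg _) ≫ e.hom.app (φ 0) = α.hom ≫ G.first ≫ G.seg _
    rw [← Category.assoc α.hom, ← h1, Category.assoc, Category.assoc, nat]
  · change e.hom.app (φ (Fin.last m)) ≫ G.seg _ ≫ G.last = (F.seg _ ≫ F.last) ≫ β.hom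
    rw [Category.assoc, ← h2, ← Category.assoc, ← Category.assoc, nat]

theorem cons (h : Ladder α β F G) {z z' : C} {γ : z ≅ z'} {f : z ⟶ x} {f' : z' ⟶ x'}
    (hf : ¬ IsIso f) (hf' : ¬ IsIso f') (w : f ≫ α.hom = γ.hom ≫ f') :
    Ladder γ β (F.cons f hf) (G.cons f' hf') := by
  obtain ⟨e, h1, h2⟩ := h
  exact ⟨ComposableArrows.isoMkSucc (F := F.mid.precomp F.first) (G := G.mid.precomp G.first)
    α e h1, w, h2⟩

theorem of_cons {z z' : C} {γ : z ≅ z'} {f : z ⟶ x} {f' : z' ⟶ x'}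
    {hf : ¬ IsIso f} {hf' : ¬ IsIso f'} (h : Ladder γ β (F.cons f hf) (G.cons f' hf')) :
    ∃ α : x ≅ x', f ≫ α.hom = γ.hom ≫ f' ∧ Ladder α β F G := by
  obtain ⟨e, h1, h2⟩ := h
  let e' : F.mid ≅ G.mid := ComposableArrows.δ₀Functor.mapIso e
  exact ⟨e.app 0, h1, e',
    e.hom.naturality (homOfLE (by simp) : (⟨0, by omega⟩ : Fin (n + 2)) ⟶ ⟨1, by omega⟩), h2⟩

end Ladder

section

variable {x y x' y' : C} {p : x ⟶ y} {n : ℕ}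

/-- The isomorphic factorization with other end points. -/
def transport (F : NontrivFactorization p n) (α : x ≅ x') (β : y ≅ y')
    {q : x' ⟶ y'} (hq : p ≫ β.hom = α.hom ≫ q) : NontrivFactorization q n where
  mid := F.mid
  first := α.inv ≫ F.first
  last := F.last ≫ β.hom
  first_not_isIso h := F.first_not_isIso (by
    rw [← Iso.hom_inv_id_assoc α F.first]
    infer_instance)
  mid_not_isIso := F.mid_not_isIso
  last_not_isIso h := F.last_not_isIso (by
    have : F.last = (F.last ≫ β.hom) ≫ β.inv := by simp
    rw [this]
    infer_instance)
  fac := by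
    have h := congrArg (· ≫ β.hom) F.fac
    rw [← cancel_epi α.hom, ← hq]
    simpa using h

theorem ladder_transport (F : NontrivFactorization p n)
    (α : x ≅ x') (β : y ≅ y') {q : x' ⟶ y'} (hq : p ≫ β.hom = α.hom ≫ q) :
    Ladder α β F (F.transport α β hq) :=
  ⟨Iso.refl _, by simp [transport], by simp [transport]⟩

end

theorem ladder_pair_iff {x y z x' y' z' : C} {γ : x ≅ x'} {β : z ≅ z'} {f : x ⟶ y} {g : y ⟶ z}
    {f' : x' ⟶ y'} {g' : y' ⟶ z'} {hf : ¬ IsIso f} {hg : ¬ IsIso g} {hf' : ¬ IsIso f'}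
    {hg' : ¬ IsIso g'} : Ladder γ β (pair f g hf hg) (pair f' g' hf' hg') ↔
      ∃ α : y ≅ y', f ≫ α.hom = γ.hom ≫ f' ∧ α.hom ≫ g' = g ≫ β.hom := by
  constructor
  · rintro ⟨e, h1, h2⟩
    exact ⟨e.app 0, h1, h2⟩
  · rintro ⟨α, h1, h2⟩
    exact ⟨ComposableArrows.isoMk₀ α, h1, h2⟩

variable {x y : C} {p : x ⟶ y}

theorem exists_ladder_pair (F : NontrivFactorization p 0) :
    ∃ (z : C) (f : x ⟶ z) (g : z ⟶ y) (hf : ¬ IsIso f) (hg : ¬ IsIso g),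
      Ladder (Iso.refl x) (Iso.refl y) F (pair f g hf hg) := by
  obtain ⟨mid, f, g, hf, hm, hg, fac⟩ := F
  obtain ⟨z, rfl⟩ := ComposableArrows.mk₀_surjective mid
  refine ⟨z, f, g, hf, hg, Iso.refl _, ?_, ?_⟩
  · exact (Category.comp_id f).trans (Category.id_comp f).symm
  · exact (Category.id_comp g).trans (Category.comp_id g).symm

theorem exists_ladder_cons {n : ℕ} (F : NontrivFactorization p (n + 1)) :
    ∃ (z : C) (f : x ⟶ z) (hf : ¬ IsIso f) (q : z ⟶ y) (G : NontrivFactorization q n),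
      Ladder (Iso.refl x) (Iso.refl y) F (G.cons f hf) := by
  obtain ⟨mid, f, g, hf, hm, hg, fac⟩ := F
  obtain ⟨mid', z, f', rfl⟩ := ComposableArrows.precomp_surjective mid
  refine ⟨z, f, hf, _, ⟨mid', f', g, hm 0, fun i => hm i.succ, hg, rfl⟩, Iso.refl _, ?_, ?_⟩
  · exact (Category.comp_id f).trans (Category.id_comp f).symm
  · exact (Category.id_comp g).trans (Category.comp_id g).symm

theorem Ladder.comm {x' y' : C} {p' : x' ⟶ y'} {n : ℕ} {α : x ≅ x'} {β : y ≅ y'}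
    {F : NontrivFactorization p n} {G : NontrivFactorization p' n} (h : Ladder α β F G) :
    p ≫ β.hom = α.hom ≫ p' := by
  obtain ⟨e, h1, h2⟩ := h
  have h3 := congrArg (· ≫ β.hom) F.fac
  have h4 := congrArg (α.hom ≫ ·) G.fac
  beta_reduce at h3 h4
  rw [← h3, ← h4, Category.assoc, Category.assoc, ← h2, ← Category.assoc α.hom, ← h1,
    Category.assoc, NatTrans.naturality_assoc]

section Faces

variable {l : CatGrading C} (hC : l.IndiscretelyBased) {w z : C}

theorem ladder_restrict_pair_zero (f : w ⟶ x) (hf : ¬ IsIso f) (g : x ⟶ z) (hg : ¬ IsIso g)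
    (h : z ⟶ y) (hh : ¬ IsIso h) (hfg : ¬ IsIso (f ≫ g)) :
    Ladder (Iso.refl w) (Iso.refl y)
      (((pair g h hg hh).cons f hf).restrict hC (Fin.succAboveOrderEmb 0))
      (pair (f ≫ g) h hfg hh) :=
  ⟨ComposableArrows.isoMk₀ (Iso.refl z), (Category.comp_id (f ≫ g)).trans
    (Category.id_comp (f ≫ g)).symm, (Category.id_comp h).trans
    ((Category.id_comp h).symm.trans (Category.comp_id _).symm)⟩

theorem ladder_restrict_pair_one (f : w ⟶ x) (hf : ¬ IsIso f) (g : x ⟶ z) (hg : ¬ IsIso g)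
    (h : z ⟶ y) (hh : ¬ IsIso h) (hgh : ¬ IsIso (g ≫ h)) :
    Ladder (Iso.refl w) (Iso.refl y)
      (((pair g h hg hh).cons f hf).restrict hC (Fin.succAboveOrderEmb 1))
      (pair f (g ≫ h) hf hgh) :=
  ⟨ComposableArrows.isoMk₀ (Iso.refl x), (Category.comp_id (f ≫ 𝟙 x)).trans
    ((Category.comp_id f).trans (Category.id_comp f).symm), (Category.id_comp (g ≫ h)).trans
    (Category.comp_id _).symm⟩

theorem ladder_restrict_cons_zero {n : ℕ} (f : w ⟶ x) (hf : ¬ IsIso f) (g : x ⟶ z)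
    (hg : ¬ IsIso g) {q : z ⟶ y} (F : NontrivFactorization q n) (hfg : ¬ IsIso (f ≫ g)) :
    Ladder (Iso.refl w) (Iso.refl y)
      (((F.cons g hg).cons f hf).restrict hC (Fin.succAboveOrderEmb 0))
      (F.cons (f ≫ g) hfg) := by
  refine ⟨Iso.refl _, ?_, ?_⟩
  · exact (Category.comp_id (f ≫ g)).trans (Category.id_comp (f ≫ g)).symm
  · refine (Category.id_comp F.last).trans ?_
    refine Eq.trans ?_ (Category.comp_id _).symm
    refine (Category.id_comp F.last).symm.trans (congrArg (· ≫ F.last) ?_)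
    exact (F.mid.map_id _).symm

/-- The extension of an order embedding by a new least element. -/
def _root_.Fin.consOrderEmb {m n : ℕ} (φ : Fin (m + 1) ↪o Fin (n + 1)) :
    Fin (m + 1 + 1) ↪o Fin (n + 1 + 1) :=
  OrderEmbedding.ofStrictMono (Fin.cases 0 fun j => (φ j).succ) fun i j hij => by
    induction j using Fin.cases with
    | zero => simp at hij
    | succ j =>
      induction i using Fin.cases with
      | zero => exact Fin.succ_pos _
      | succ i => simpa using hij

theorem _root_.Fin.succAboveOrderEmb_succ {n : ℕ} (i : Fin (n + 1 + 1)) :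
    Fin.succAboveOrderEmb i.succ = Fin.consOrderEmb (Fin.succAboveOrderEmb i) := by
  ext j : 1
  induction j using Fin.cases with
  | zero => exact Fin.succ_succAbove_zero i
  | succ j => exact Fin.succ_succAbove_succ i j

/-- Deleting an intermediate object other than the first one does not affect the first factor. -/
theorem ladder_restrict_cons_succ {n : ℕ} (f : w ⟶ x) (hf : ¬ IsIso f)
    (F : NontrivFactorization p (n + 1)) (i : Fin (n + 2)) :
    Ladder (Iso.refl w) (Iso.refl y)
      ((F.cons f hf).restrict hC (Fin.succAboveOrderEmb i.succ))
      ((F.restrict hC (Fin.succAboveOrderEmb i)).cons f hf) := by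
  rw [Fin.succAboveOrderEmb_succ]
  generalize Fin.succAboveOrderEmb i = φ
  refine ⟨ComposableArrows.isoMkSucc (Iso.refl _) (Iso.refl _) ?_, ?_, ?_⟩
  · refine (Category.comp_id _).trans (Eq.trans ?_ (Category.id_comp _).symm)
    exact ComposableArrows.precomp_map_zero_succ F.mid F.first (φ 0)
  · refine (Category.comp_id _).trans (Eq.trans ?_ (Category.id_comp _).symm)
    exact Category.comp_id f
  · exact (Category.id_comp _).trans (Category.comp_id _).symm

end Faces

end NontrivFactorization

end Ladders

/-! ### Factorizations and chains -/

section ChainSimplices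

variable {C : Type u} [Category.{v} C] {l : CatGrading C}

/-- The canonical isomorphism between objects of the same component of `C₀`. -/
noncomputable def CatGrading.IndiscretelyBased.canIso (hC : l.IndiscretelyBased) {x y : C}
    (h : l.cls x = l.cls y) : x ≅ y where
  hom := hC.can h
  inv := hC.can h.symm
  hom_inv_id := by rw [hC.can_comp, hC.can_refl]
  inv_hom_id := by rw [hC.can_comp, hC.can_refl]

theorem CatGrading.IndiscretelyBased.iso_eq (hC : l.IndiscretelyBased) {x y : C} (α β : x ≅ y) :
    α = β :=
  Iso.ext (hC.eq_of_len_eq_zero (CatGrading.len_eq_zero_of_isIso _)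
    (CatGrading.len_eq_zero_of_isIso _))

namespace NontrivFactorization

/-- Since isomorphisms with given source and target are unique, a ladder between factorizations of
the same morphism is an equivalence. -/
theorem Ladder.rel (hC : l.IndiscretelyBased) {x y : C} {p : x ⟶ y} {n : ℕ}
    {F G : NontrivFactorization p n} {α : x ≅ x} {β : y ≅ y} (h : Ladder α β F G) :
    setoid p n F G := by
  obtain ⟨e, h1, h2⟩ := h
  rw [hC.iso_eq α (Iso.refl x)] at h1
  rw [hC.iso_eq β (Iso.refl y)] at h2
  exact ⟨e, h1.trans (Category.id_comp _), h2.trans (Category.comp_id _)⟩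

theorem Ladder.of_rel {x y : C} {p : x ⟶ y} {n : ℕ} {F G : NontrivFactorization p n}
    (h : setoid p n F G) : Ladder (Iso.refl x) (Iso.refl y) F G := by
  obtain ⟨e, h1, h2⟩ := h
  exact ⟨e, h1.trans (Category.id_comp _).symm, h2.trans (Category.comp_id _).symm⟩

end NontrivFactorization

open NontrivFactorization CatGrading

variable {hC : l.IndiscretelyBased}

theorem CatGrading.GrObj.not_isIso {a b : GrObj hC} (f : a ⟶ b) (h : a.deg < b.deg) :
    ¬ IsIso f.1 := by
  rw [hC.isIso_iff]
  have := f.2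
  omega

/-- Morphisms of the one-way category which differ by an isomorphism of their targets in `C` are
equal. -/
theorem CatGrading.GrObj.eq_of_comp_iso {a a' a'' : GrObj hC} (f : a ⟶ a') (f' : a ⟶ a'')
    (α : a'.obj ≅ a''.obj) (h : f.1 ≫ α.hom = f'.1) :
    ∃ e : a' = a'', f' = f ≫ eqToHom e ∧ α.hom = eqToHom (congrArg GrObj.obj e) := by
  have h1 := congrArg (fun t => l.len t) h
  simp only [l.len_comp, CatGrading.len_eq_zero_of_isIso α.hom] at h1
  have hf := f.2
  have hf' := f'.2
  obtain ⟨rfl, e⟩ := GrObj.exists_eq_eqToHom α.hom (CatGrading.len_eq_zero_of_isIso _)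
    (by omega)
  refine ⟨rfl, Subtype.ext ?_, e⟩
  rw [← h, e]
  simp

namespace OneWayChain

variable {b : GrObj hC}

/-- The factorization of the composition of a chain given by the chain. -/
noncomputable def factorization : ∀ {n : ℕ} {a : GrObj hC} (c : OneWayChain b (n + 1) a),
    NontrivFactorization c.comp.1 n
  | 0, _, cons f h (single g h') => pair f.1 g.1 (GrObj.not_isIso f h) (GrObj.not_isIso g h')
  | _ + 1, _, cons f h (cons g h' c) =>
    (factorization (cons g h' c)).cons f.1 (GrObj.not_isIso f h)

theorem factorization_cons {n : ℕ} {a a' : GrObj hC} (f : a ⟶ a') (h : a.deg < a'.deg)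
    (c : OneWayChain b (n + 1) a') : (cons f h c).factorization =
      c.factorization.cons f.1 (GrObj.not_isIso f h) := by
  cases c
  rfl

theorem factorization_face {n : ℕ} {a : GrObj hC} (c : OneWayChain b (n + 2) a)
    (i : Fin (n + 2)) : Ladder (Iso.refl a.obj) (Iso.refl b.obj)
      (c.factorization.restrict hC (Fin.succAboveOrderEmb i)) (c.face i).factorization := by
  induction n generalizing a with
  | zero =>
    obtain _ | ⟨f, h, c⟩ := c
    obtain _ | ⟨g, h', c⟩ := c
    obtain ⟨g', h''⟩ | _ := c
    induction i using Fin.cases with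
    | zero => exact ladder_restrict_pair_zero hC _ _ _ _ _ _ (GrObj.not_isIso (f ≫ g) (h.trans h'))
    | succ i =>
      obtain rfl : i = 0 := Subsingleton.elim _ _
      exact ladder_restrict_pair_one hC _ _ _ _ _ _ (GrObj.not_isIso (g ≫ g') (h'.trans h''))
  | succ n ih =>
    obtain _ | ⟨f, h, c⟩ := c
    induction i using Fin.cases with
    | zero =>
      obtain _ | ⟨g, h', c⟩ := c
      have e := factorization_cons (f ≫ g) (h.trans h') c
      rw [face_zero, e, factorization_cons f h, factorization_cons g h']
      exact ladder_restrict_cons_zero hC _ _ _ _ _ (GrObj.not_isIso (f ≫ g) (h.trans h'))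
    | succ i =>
      rw [face_succ, factorization_cons f h c, factorization_cons f h (c.face i)]
      have h1 := ladder_restrict_cons_succ hC f.1 (GrObj.not_isIso f h) c.factorization i
      have h2 := h1.trans ((ih c i).cons (γ := Iso.refl _) _ (GrObj.not_isIso f h)
        ((Category.comp_id _).trans (Category.id_comp _).symm))
      rwa [Iso.refl_trans, Iso.refl_trans] at h2

/-- Every factorization is isomorphic to the one given by a chain. -/
theorem exists_ladder_factorization {n : ℕ} {x y : C} {p : x ⟶ y} (F : NontrivFactorization p n)
    {a : GrObj hC} (γ : x ≅ a.obj) (β : y ≅ b.obj) (hp : a.deg + l.len p = b.deg) :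
    ∃ c : OneWayChain b (n + 1) a, Ladder γ β F c.factorization := by
  have hpos : ∀ {s t : C} (f : s ⟶ t), ¬ IsIso f → 0 < l.len f := fun f hf =>
    Nat.pos_of_ne_zero fun h => hf ((hC.isIso_iff f).2 h)
  have hcls : ∀ z : C, l.cls z = l.cls (rep (l.cls z)) := fun z => (cls_rep (l.cls z)).symm
  induction n generalizing x p a with
  | zero =>
    obtain ⟨z, f, g, hf, hg, h⟩ := F.exists_ladder_pair
    have hfg : p = f ≫ g := by simpa using h.comm
    have h1 := hpos f hf
    have h2 := hpos g hg
    subst hfg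
    rw [l.len_comp] at hp
    push_cast at hp
    let a' : GrObj hC := ⟨l.cls z, a.deg + l.len f⟩
    let α : z ≅ a'.obj := hC.canIso (hcls z)
    let f' : a ⟶ a' := ⟨γ.inv ≫ f ≫ α.hom, by
      simp only [l.len_comp, CatGrading.len_eq_zero_of_isIso]
      simp [a']⟩
    let g' : a' ⟶ b := ⟨α.inv ≫ g ≫ β.hom, by
      simp only [l.len_comp, CatGrading.len_eq_zero_of_isIso, a']
      push_cast
      omega⟩
    have hf' : a.deg < a'.deg := by
      simp only [a']
      omega
    have hg' : a'.deg < b.deg := by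
      simp only [a']
      omega
    refine ⟨cons f' hf' (single g' hg'), ?_⟩
    have h3 : Ladder γ β (pair f g hf hg)
        (pair f'.1 g'.1 (GrObj.not_isIso f' hf') (GrObj.not_isIso g' hg')) :=
      ladder_pair_iff.2 ⟨α, by simp [f'], by simp [g']⟩
    have h4 := h.trans h3
    rwa [hC.iso_eq (_ ≪≫ γ) γ, hC.iso_eq (_ ≪≫ β) β] at h4
  | succ n ih =>
    obtain ⟨z, f, hf, q, G, h⟩ := F.exists_ladder_cons
    have hfq : p = f ≫ q := by simpa using h.comm
    have h1 := hpos f hf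
    subst hfq
    rw [l.len_comp] at hp
    push_cast at hp
    let a' : GrObj hC := ⟨l.cls z, a.deg + l.len f⟩
    let α : z ≅ a'.obj := hC.canIso (hcls z)
    let f' : a ⟶ a' := ⟨γ.inv ≫ f ≫ α.hom, by
      simp only [l.len_comp, CatGrading.len_eq_zero_of_isIso]
      simp [a']⟩
    have hf' : a.deg < a'.deg := by
      simp only [a']
      omega
    obtain ⟨c, hc⟩ := ih G α (by simp only [a']; omega)
    refine ⟨cons f' hf' c, ?_⟩
    rw [factorization_cons]
    have h3 : Ladder γ β (G.cons f hf) (c.factorization.cons f'.1 (GrObj.not_isIso f' hf')) :=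
      hc.cons _ _ (by simp [f'])
    have h4 := h.trans h3
    rwa [hC.iso_eq (_ ≪≫ γ) γ, hC.iso_eq (_ ≪≫ β) β] at h4

/-- Chains with isomorphic factorizations are equal. -/
theorem eq_of_ladder {n : ℕ} {a : GrObj hC} {c c' : OneWayChain b (n + 1) a}
    {γ : a.obj ≅ a.obj} {β : b.obj ≅ b.obj} (h : Ladder γ β c.factorization c'.factorization) :
    c = c' := by
  obtain rfl := hC.iso_eq β (Iso.refl _)
  obtain rfl := hC.iso_eq γ (Iso.refl _)
  induction n generalizing a with
  | zero =>
    obtain _ | ⟨f, hf, c⟩ := c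
    obtain ⟨g, hg⟩ | _ := c
    obtain _ | ⟨f', hf', c⟩ := c'
    obtain ⟨g', hg'⟩ | _ := c
    obtain ⟨α, h1, h2⟩ := ladder_pair_iff.1 h
    obtain ⟨rfl, rfl, e⟩ := GrObj.eq_of_comp_iso f f' α (h1.trans (Category.id_comp _))
    rw [eqToHom_refl, Category.comp_id]
    have h3 : g' = g := by
      refine Subtype.ext ?_
      rw [e] at h2
      exact (Category.id_comp _).symm.trans (h2.trans (Category.comp_id _))
    rw [h3]
  | succ n ih =>
    obtain _ | ⟨f, hf, c⟩ := c
    obtain _ | ⟨f', hf', c'⟩ := c'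
    rw [factorization_cons f hf c, factorization_cons f' hf' c'] at h
    obtain ⟨α, h1, h2⟩ := h.of_cons
    obtain ⟨rfl, rfl, e⟩ := GrObj.eq_of_comp_iso f f' α (h1.trans (Category.id_comp _))
    obtain rfl := hC.iso_eq α (Iso.refl _)
    rw [eqToHom_refl, Category.comp_id, ih h2]

end OneWayChain

end ChainSimplices

/-! ### Cochains on chains and on factorization sets -/

section Comparison

open NontrivFactorization CatGrading

variable {C : Type u} [Category.{v} C] {l : CatGrading C} {hC : l.IndiscretelyBased}

/-- The chains of `m + 1` non-identities in the one-way category, starting in degree zero and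
preceded by a morphism of length zero, with composition `p` up to the identification of the
target of `p` with `b`. -/
structure CatGrading.Cell {b : GrObj hC} {x y : C} (hy : l.cls y = b.cls) (p : x ⟶ y) (m : ℕ) where
  obj : GrObj hC
  chain : OneWayChain b m obj
  hom : x ⟶ obj.obj
  len_hom : l.len hom = 0
  deg_eq : obj.deg = 0
  fac : hom ≫ chain.comp.1 ≫ hC.can (b.cls_obj.trans hy.symm) = p

namespace CatGrading.Cell

variable {b : GrObj hC} {x y : C} {hy : l.cls y = b.cls} {p : x ⟶ y}

/-- The morphism of length zero in a cell. -/
noncomputable def zeroMor {m : ℕ} (c : Cell hy p m) : ZeroMor c.obj :=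
  ⟨x, c.hom, c.len_hom, c.deg_eq⟩

/-- The morphism of length zero in a cell, as an isomorphism. -/
noncomputable def iso {m : ℕ} (c : Cell hy p m) : x ≅ c.obj.obj :=
  hC.canIso (cls_eq_of_len_eq_zero c.hom c.len_hom)

theorem hom_eq {m : ℕ} (c : Cell hy p m) : c.hom = c.iso.hom :=
  hC.eq_of_len_eq_zero c.len_hom (len_eq_zero_of_isIso c.iso.hom)

/-- The cell obtained by composing two consecutive morphisms of the chain. -/
noncomputable def face {m : ℕ} (c : Cell hy p (m + 1)) (i : Fin (m + 1)) : Cell hy p m where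
  obj := c.obj
  chain := c.chain.face i
  hom := c.hom
  len_hom := c.len_hom
  deg_eq := c.deg_eq
  fac := by
    rw [OneWayChain.comp_face]
    exact c.fac

theorem comp_eq {m : ℕ} (c : Cell hy p m) :
    c.chain.comp.1 ≫ (hC.canIso (b.cls_obj.trans hy.symm)).hom = c.iso.symm.hom ≫ p := by
  rw [Iso.symm_hom, Iso.eq_inv_comp, ← c.hom_eq]
  exact c.fac

/-- The simplex of the augmented factorization set of `p` given by a cell. -/
noncomputable def simplex : ∀ {m : ℕ}, Cell hy p m → (factorizationSet hC p).AugSimplex m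
  | 0, _ => PUnit.unit
  | _ + 1, c => Quotient.mk _ (c.chain.factorization.transport c.iso.symm _ c.comp_eq)

theorem simplex_face {m : ℕ} (c : Cell hy p (m + 1)) (i : Fin (m + 1)) :
    (c.face i).simplex = (factorizationSet hC p).augFace i c.simplex := by
  cases m with
  | zero => rfl
  | succ m =>
    have h1 := (c.face i).chain.factorization.ladder_transport _ _ (c.face i).comp_eq
    have h2 := (c.chain.factorization.ladder_transport _ _ c.comp_eq).restrict hC
      (Fin.succAboveOrderEmb i)
    exact Quotient.sound (((h1.symm.trans (c.chain.factorization_face i).symm).trans h2).rel hC)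

/-- A cell is determined by the equivalence class of its factorization: the source of the chain is
the object of degree zero in the component of `x`, and isomorphisms in `C` between objects of the
one-way category of equal degree are identities. -/
theorem simplex_injective {m : ℕ} :
    Function.Injective (simplex : Cell hy p m → (factorizationSet hC p).AugSimplex m) := by
  intro c c' h
  obtain ⟨a, ch, f, hf, ha, e⟩ := c
  obtain ⟨a', ch', f', hf', ha', e'⟩ := c'
  obtain rfl : a = a' := by
    refine GrObj.ext ?_ (ha.trans ha'.symm)
    rw [← a.cls_obj, ← a'.cls_obj, ← cls_eq_of_len_eq_zero f hf, cls_eq_of_len_eq_zero f' hf']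
  obtain rfl := hC.eq_of_len_eq_zero hf hf'
  suffices ch = ch' by
    subst this
    rfl
  cases m with
  | zero =>
    obtain ⟨g, hg⟩ | _ := ch
    obtain ⟨g', hg'⟩ | _ := ch'
    have h1 : f ≫ g.1 ≫ hC.can (b.cls_obj.trans hy.symm) =
      f ≫ g'.1 ≫ hC.can (b.cls_obj.trans hy.symm) := e.trans e'.symm
    have : IsIso f := (hC.isIso_iff f).2 hf
    have : IsIso (hC.can (b.cls_obj.trans hy.symm)) := (hC.isIso_iff _).2 (hC.len_can _)
    rw [cancel_epi, cancel_mono] at h1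
    obtain rfl := Subtype.ext h1
    rfl
  | succ m =>
    have h1 := Ladder.of_rel (Quotient.exact h)
    exact OneWayChain.eq_of_ladder (((ch.factorization.ladder_transport _ _
      (comp_eq ⟨a, ch, f, hf, ha, e⟩)).trans h1).trans
        (ch'.factorization.ladder_transport _ _ (comp_eq ⟨a, ch', f, hf, ha, e'⟩)).symm)

theorem simplex_surjective (hp : (l.len p : ℤ) = b.deg) (hb : 0 < b.deg) {m : ℕ} :
    Function.Surjective (simplex : Cell hy p m → (factorizationSet hC p).AugSimplex m) := by
  intro σ
  let a : GrObj hC := ⟨l.cls x, 0⟩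
  let γ : x ≅ a.obj := hC.canIso (cls_rep (l.cls x)).symm
  let β : y ≅ b.obj := hC.canIso (hy.trans b.cls_obj.symm)
  have hβ : hC.can (b.cls_obj.trans hy.symm) = β.inv := rfl
  have hγ : l.len γ.hom = 0 := len_eq_zero_of_isIso _
  cases m with
  | zero =>
    refine ⟨⟨a, .single ⟨γ.inv ≫ p ≫ β.hom, ?_⟩ hb, γ.hom, hγ, rfl, ?_⟩, rfl⟩
    · simp only [l.len_comp, len_eq_zero_of_isIso, a]
      simpa using hp
    · simp [OneWayChain.comp, hβ]
  | succ m =>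
    induction σ using Quotient.inductionOn with
    | h F =>
      obtain ⟨c, hc⟩ := OneWayChain.exists_ladder_factorization F γ β (by simpa [a] using hp)
      let d : Cell hy p (m + 1) := ⟨a, c, γ.hom, hγ, rfl, by
        have h1 := hc.comm
        rw [hβ, ← Category.assoc, ← h1]
        simp⟩
      exact ⟨d, Quotient.sound (Ladder.rel hC ((hc.trans
        (c.factorization.ladder_transport _ _ d.comp_eq)).symm))⟩

end CatGrading.Cell

variable {k : Type w} [Field k] {b : GrObj hC} {y : C}

theorem SemiSimplicialSet.subsingleton_reducedCohomology_iff {k : Type*} [Field k]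
    (X : SemiSimplicialSet.{w}) (n : ℕ) : Subsingleton (X.ReducedCohomology k n) ↔
      ∀ φ, X.coboundary k n φ = 0 → φ ∈ X.boundaries k n := by
  rw [Submodule.Quotient.subsingleton_iff, Submodule.submoduleOf_eq_top]
  rfl

/-- The cochains of degree `n - 1` on the factorization sets of all morphisms with target `y`. -/
abbrev FactorizationCochain (k : Type w) (hC : l.IndiscretelyBased) (y : C) (n : ℕ) :
    Type (max u v w) :=
  ∀ s : (Σ x : C, x ⟶ y), (factorizationSet hC s.2).AugSimplex n → k

/-- The cell given by a chain and a morphism of length zero. -/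
noncomputable def CatGrading.ZeroMor.cell {a : GrObj hC} (z : ZeroMor a)
    (hy : l.cls y = b.cls) {n : ℕ} (c : OneWayChain b n a) :
    Cell hy (z.hom ≫ c.comp.1 ≫ hC.can (b.cls_obj.trans hy.symm)) n :=
  ⟨a, c, z.hom, z.len_hom, z.deg_eq, rfl⟩

variable (hy : l.cls y = b.cls) {n : ℕ}

/-- Cochains on the factorization sets of all morphisms with target `y` give a cochain on chains,
with coefficients in the dual of `A₀`. -/
noncomputable def chainCochain (Φ : FactorizationCochain k hC y n) (a : GrObj hC)
    (c : OneWayChain b n a) : (zeroMorMod k hC).obj a := fun z =>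
  Φ ⟨z.src, z.hom ≫ c.comp.1 ≫ hC.can (b.cls_obj.trans hy.symm)⟩ (z.cell hy c).simplex

theorem chainCochain_cell (Φ : FactorizationCochain k hC y n)
    {x : C} {p : x ⟶ y} (c : Cell hy p n) :
    chainCochain hy Φ c.obj c.chain c.zeroMor = Φ ⟨x, p⟩ c.simplex := by
  obtain ⟨a, ch, f, hf, ha, rfl⟩ := c
  rfl

/-- The identification of cochains is compatible with the differentials. -/
theorem sum_chainCochain_face
    (Φ : FactorizationCochain k hC y n) (a : GrObj hC)
    (c : OneWayChain b (n + 1) a) :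
    ∑ i : Fin (n + 1), (-1 : k) ^ (i : ℕ) • chainCochain hy Φ a (c.face i) =
      chainCochain hy (fun s => (factorizationSet hC s.2).coboundary k n (Φ s)) a c := by
  funext z
  rw [Finset.sum_apply]
  refine Finset.sum_congr rfl fun i _ => ?_
  let d := z.cell hy c
  change (-1 : k) ^ (i : ℕ) * chainCochain hy Φ (d.face i).obj (d.face i).chain (d.face i).zeroMor
    = _
  rw [chainCochain_cell hy Φ (d.face i), d.simplex_face]

theorem exists_chainCochain_eq (W : ∀ a, OneWayChain b n a → (zeroMorMod k hC).obj a) :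
    ∃ Φ : FactorizationCochain k hC y n,
      chainCochain hy Φ = W := by
  classical
  refine ⟨fun s σ => if h : ∃ c : Cell hy s.2 n, c.simplex = σ then
    W h.choose.obj h.choose.chain h.choose.zeroMor else 0, ?_⟩
  funext a c z
  have h : ∃ d : Cell hy (z.hom ≫ c.comp.1 ≫ hC.can (b.cls_obj.trans hy.symm)) n,
    d.simplex = (z.cell hy c).simplex := ⟨_, rfl⟩
  refine (dif_pos h).trans ?_
  rw [Cell.simplex_injective h.choose_spec]
  rfl

/-- The cochain on chains remembers the cochains on the factorization sets of the morphisms of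
length `b.deg`, and nothing else. -/
theorem chainCochain_eq_iff (hb : 0 < b.deg)
    {Φ Ψ : FactorizationCochain k hC y n} :
    chainCochain hy Φ = chainCochain hy Ψ ↔
      ∀ s : (Σ x : C, x ⟶ y), (l.len s.2 : ℤ) = b.deg → Φ s = Ψ s := by
  constructor
  · rintro h ⟨x, p⟩ hp
    funext σ
    obtain ⟨c, rfl⟩ := Cell.simplex_surjective (hy := hy) hp hb σ
    rw [← chainCochain_cell hy Φ, ← chainCochain_cell hy Ψ, h]
  · intro h
    funext a c z
    refine congrFun (h ⟨z.src, _⟩ ?_) _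
    have h1 := c.comp.2
    have h2 := z.deg_eq
    have h3 := z.len_hom
    simp only [l.len_comp, hC.len_can]
    omega

/-- Whether a cochain on chains is a coboundary can be tested on each factorization set. -/
theorem isChainCoboundary_chainCochain_iff (hb : 0 < b.deg)
    (Φ : FactorizationCochain k hC y n) :
    RightMod.IsChainCoboundary (zeroMorMod k hC) b n (chainCochain hy Φ) ↔
      ∀ s : (Σ x : C, x ⟶ y), (l.len s.2 : ℤ) = b.deg →
        Φ s ∈ (factorizationSet hC s.2).boundaries k n := by
  cases n with
  | zero => exact chainCochain_eq_iff hy hb (Φ := Φ) (Ψ := fun _ => 0)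
  | succ n =>
    constructor
    · rintro ⟨V, hV⟩ s hs
      obtain ⟨Ψ, rfl⟩ := exists_chainCochain_eq hy V
      refine ⟨Ψ s, ((chainCochain_eq_iff hy hb
        (Ψ := fun s => (factorizationSet hC s.2).coboundary k n (Ψ s))).1 ?_ s hs).symm⟩
      funext a c
      rw [hV, sum_chainCochain_face]
    · intro h
      classical
      have h' : ∀ s : (Σ x : C, x ⟶ y), ∃ ψ, (l.len s.2 : ℤ) = b.deg →
          (factorizationSet hC s.2).coboundary k n ψ = Φ s := by
        intro s
        by_cases hs : (l.len s.2 : ℤ) = b.deg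
        · obtain ⟨ψ, hψ⟩ := h s hs
          exact ⟨ψ, fun _ => hψ⟩
        · exact ⟨0, fun e => absurd e hs⟩
      choose Ψ hΨ using h'
      refine ⟨chainCochain hy Ψ, fun a c => ?_⟩
      rw [sum_chainCochain_face, ← (chainCochain_eq_iff hy hb).2 hΨ]

/-- The cobar complex of the dual of `A₀` at an object of positive degree is the product of the
augmented cochain complexes of factorization sets. -/
theorem extVanishes_zeroMorMod_iff (hy : l.cls y = b.cls) {n : ℕ} (hb : 0 < b.deg) :
    RightMod.ExtVanishes (n + 1) (zeroMorMod k hC) b ↔ ∀ s : (Σ x : C, x ⟶ y),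
      (l.len s.2 : ℤ) = b.deg → Subsingleton ((factorizationSet hC s.2).ReducedCohomology k n) := by
  rw [RightMod.extVanishes_succ_iff _ _ _ fun f h => zeroMorMod_map_of_lt f h]
  have hcocycle : ∀ Φ : FactorizationCochain k hC y n,
      (∀ (a : GrObj hC) (c : OneWayChain b (n + 1) a),
        ∑ i : Fin (n + 1), (-1 : k) ^ (i : ℕ) • chainCochain hy Φ a (c.face i) = 0) ↔
      ∀ s : (Σ x : C, x ⟶ y), (l.len s.2 : ℤ) = b.deg →
        (factorizationSet hC s.2).coboundary k n (Φ s) = 0 := by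
    intro Φ
    refine Iff.trans ?_ (chainCochain_eq_iff hy hb
      (Φ := fun s => (factorizationSet hC s.2).coboundary k n (Φ s)) (Ψ := fun _ => 0))
    simp only [sum_chainCochain_face hy]
    exact ⟨fun h => funext fun a => funext fun c => h a c, fun h a c => congrFun (congrFun h a) c⟩
  simp only [SemiSimplicialSet.subsingleton_reducedCohomology_iff]
  constructor
  · intro h s hs φ hφ
    classical
    -- a cocycle on the factorization set of one morphism is extended by zero to the other ones
    have h1 := (isChainCoboundary_chainCochain_iff hy hb (Pi.single s φ)).1
      (h _ ((hcocycle _).2 fun t _ => ?_)) s hs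
    · rwa [Pi.single_eq_same] at h1
    · by_cases e : t = s
      · subst e
        rwa [Pi.single_eq_same]
      · rw [Pi.single_eq_of_ne e, map_zero]
  · intro h W hW
    obtain ⟨Φ, rfl⟩ := exists_chainCochain_eq hy W
    exact (isChainCoboundary_chainCochain_iff hy hb Φ).2 fun s hs =>
      h s hs _ ((hcocycle Φ).1 hW s hs)

end Comparison

/-! ### Koszulity and the dimension of factorization sets -/

section MainResult

open CatGrading

variable {C : Type u} [Category.{v} C] {l : CatGrading C}

theorem SemiSimplicialSet.exists_simplex_of_le_dim (X : SemiSimplicialSet.{w}) {n : ℕ}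
    (h : (n : WithBot ℕ∞) ≤ X.dim) : ∃ m, n ≤ m ∧ Nonempty (X.simplex m) := by
  by_contra! hX
  have key : ∀ m, Nonempty (X.simplex m) → m < n := fun m hm => by
    by_contra! hnm
    exact not_isEmpty_iff.2 hm (hX m hnm)
  cases n with
  | zero =>
    have h1 : X.dim ≤ ⊥ := iSup₂_le fun m hm => absurd (key m hm) (Nat.not_lt_zero m)
    exact absurd (h.trans h1) (by simp)
  | succ n =>
    have h1 : X.dim ≤ (n : WithBot ℕ∞) := iSup₂_le fun m hm => by
      exact_mod_cast Nat.le_of_lt_succ (key m hm)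
    have h2 : ((n + 1 : ℕ) : WithBot ℕ∞) ≤ (n : ℕ) := h.trans h1
    have h3 : n + 1 ≤ n := by exact_mod_cast h2
    omega

namespace CatGrading.IndiscretelyBased

theorem len_pos (hC : l.IndiscretelyBased) {x y : C} {f : x ⟶ y} (hf : ¬ IsIso f) : 0 < l.len f :=
  Nat.pos_of_ne_zero fun h => hf ((hC.isIso_iff f).2 h)

theorem not_isIso (hC : l.IndiscretelyBased) {x y : C} {f : x ⟶ y} (hf : 0 < l.len f) :
    ¬ IsIso f := fun h => hf.ne' ((hC.isIso_iff f).1 h)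

end CatGrading.IndiscretelyBased

/-- The dimension of the factorization set of `p` is at most `len p - 2`. -/
theorem NontrivFactorization.add_two_le_len (hC : l.IndiscretelyBased) {x y : C} {p : x ⟶ y}
    {n : ℕ} (F : NontrivFactorization p n) : n + 2 ≤ l.len p := by
  induction n generalizing x p with
  | zero =>
    obtain ⟨z, f, g, hf, hg, h⟩ := F.exists_ladder_pair
    have hp : p = f ≫ g := by simpa using h.comm
    have := hC.len_pos hf
    have := hC.len_pos hg
    rw [hp, l.len_comp]
    omega
  | succ n ih =>
    obtain ⟨z, f, hf, q, G, h⟩ := F.exists_ladder_cons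
    have hp : p = f ≫ q := by simpa using h.comm
    have := hC.len_pos hf
    have := ih G
    rw [hp, l.len_comp]
    omega

/-- A composition of morphisms of length one is a single morphism or starts with one. -/
theorem CatGrading.IsCompOfLenOne.exists_first {x y : C} {p : x ⟶ y} (h : l.IsCompOfLenOne p) :
    l.len p = 1 ∨ ∃ (z : C) (f : x ⟶ z) (g : z ⟶ y), l.len f = 1 ∧ 0 < l.len g ∧ f ≫ g = p := by
  induction h with
  | of f hf => exact Or.inl hf
  | comp f g _ _ hf hg =>
    have hg' : 0 < l.len g := by
      obtain h | ⟨z, g', g'', h1, -, rfl⟩ := hg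
      · omega
      · rw [l.len_comp]
        omega
    obtain h | ⟨z, f', f'', h1, -, rfl⟩ := hf
    · exact Or.inr ⟨_, f, g, h, hg', rfl⟩
    · exact Or.inr ⟨_, f', f'' ≫ g, h1, by rw [l.len_comp]; omega, by simp⟩

/-- If `C` is generated by morphisms of length one, then the factorization set of `p` has
dimension at least `len p - 2`. -/
theorem CatGrading.GeneratedInLenOne.nonempty_factorization (hC : l.IndiscretelyBased)
    (h : l.GeneratedInLenOne) {x y : C} {p : x ⟶ y} {m : ℕ} (hp : l.len p = m + 2) :
    Nonempty (NontrivFactorization p m) := by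
  induction m generalizing x p with
  | zero =>
    obtain h1 | ⟨z, f, g, h1, h2, rfl⟩ := (h p (by omega)).exists_first
    · omega
    · exact ⟨.pair f g (hC.not_isIso (by omega)) (hC.not_isIso h2)⟩
  | succ m ih =>
    obtain h1 | ⟨z, f, g, h1, h2, rfl⟩ := (h p (by omega)).exists_first
    · omega
    · rw [l.len_comp] at hp
      obtain ⟨F⟩ := ih (p := g) (by omega)
      exact ⟨F.cons f (hC.not_isIso (by omega))⟩

variable (hC : l.IndiscretelyBased) (k : Type w) [Field k]

/-- In terms of the augmented cochain complexes of the factorization sets, Koszulity means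
exactness in all degrees below the maximal possible dimension `len p - 2`. -/
theorem isKoszul_iff_subsingleton_reducedCohomology : IsKoszul k (CatAlg.grading k l) ↔
    ∀ {x y : C} (p : x ⟶ y) (n : ℕ), n + 2 ≤ l.len p →
      Subsingleton ((factorizationSet hC p).ReducedCohomology k n) := by
  have hiff : IsKoszul k (CatAlg.grading k l) ↔ ∀ (n : ℕ) (b : GrObj hC), b.deg ≠ n →
      RightMod.ExtVanishes n (zeroMorMod k hC) b := by
    simp only [← GrModule.extVanishes_degZero_dual_iff]
    rw [← GrModule.exists_resolution_iff hC]
    exact ⟨fun h => h.exists_resolution,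
      fun h => ⟨CatAlg.isSemisimpleSubalgebra_grading_zero hC, h⟩⟩
  rw [hiff]
  constructor
  · intro h x y p n hn
    let b : GrObj hC := ⟨l.cls y, l.len p⟩
    have hb : 0 < b.deg := by
      simp only [b]
      omega
    refine (extVanishes_zeroMorMod_iff (b := b) rfl hb).1 (h (n + 1) b ?_) ⟨x, p⟩ rfl
    simp only [b]
    omega
  · intro h n b hb
    have hsub : ∀ a : GrObj hC, a.deg ≠ 0 → Subsingleton ((zeroMorMod k hC).obj a) :=
      fun a => subsingleton_zeroMorMod
    rcases lt_or_gt_of_ne hb with hlt | hgt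
    -- below degree `n` there are no chains of length `n` starting in degree zero
    · refine RightMod.extVanishes_of_deg_lt _ 0 ?_ fun a ha => hsub a ha.ne
      rwa [zero_add]
    · cases n with
      | zero =>
        have := hsub b hb
        exact fun v _ => Subsingleton.elim _ _
      | succ n =>
        have hpos : 0 < b.deg := by omega
        refine (extVanishes_zeroMorMod_iff (y := b.obj) b.cls_obj hpos).2 fun s hs => ?_
        exact h s.2 n (by omega)

/-- A morphism `p` of length at least two is decomposable, since `C(p)` would otherwise be empty and
have reduced cohomology in degree `-1`; by induction on the length, each of its factors is a
composition of morphisms of length one. -/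
theorem generatedInLenOne_of_subsingleton_reducedCohomology
    (h : ∀ {x y : C} (p : x ⟶ y) (n : ℕ), n + 2 ≤ l.len p →
      Subsingleton ((factorizationSet hC p).ReducedCohomology k n)) : l.GeneratedInLenOne := by
  intro x y p hp
  induction hN : l.len p using Nat.strong_induction_on generalizing x y p with
  | h N ih =>
    by_cases h1 : l.len p = 1
    · exact .of p h1
    have h2 : Nonempty ((factorizationSet hC p).simplex 0) := by
      by_contra hne
      -- if there are no vertices, then the constant cochain on the empty simplex is a cocycle
      have h3 := (SemiSimplicialSet.subsingleton_reducedCohomology_iff _ 0).1 (h p 0 (by omega))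
        (fun _ => 1) (funext fun σ => absurd ⟨σ⟩ hne)
      exact one_ne_zero (congrFun (show (fun _ => (1 : k)) = 0 from h3) PUnit.unit)
    obtain ⟨σ⟩ := h2
    obtain ⟨F, -⟩ := Quotient.exists_rep σ
    obtain ⟨z, f, g, hf, hg, hL⟩ := F.exists_ladder_pair
    obtain rfl : p = f ≫ g := by simpa using hL.comm
    have hf' := hC.len_pos hf
    have hg' := hC.len_pos hg
    rw [l.len_comp] at hN
    exact .comp f g (ih _ (by omega) f hf' rfl) (ih _ (by omega) g hg' rfl)

end MainResult

theorem mainTheorem1 (k : Type w) [Field k] (C : Type u) [Category.{v} C] (l : CatGrading C)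
    (hC : l.IndiscretelyBased) :
    IsKoszul k (CatAlg.grading k l) ↔
      (CatGrading.LocallyBouquet k hC ∧ l.GeneratedInLenOne) := by
  rw [isKoszul_iff_subsingleton_reducedCohomology hC k]
  constructor
  · intro h
    refine ⟨fun p n hn => ?_, generatedInLenOne_of_subsingleton_reducedCohomology hC k h⟩
    -- a simplex of dimension at least `n` forces `n + 2 ≤ len p`
    obtain ⟨m, hnm, ⟨σ⟩⟩ := (factorizationSet hC p).exists_simplex_of_le_dim hn
    obtain ⟨F, -⟩ := Quotient.exists_rep σ
    have := F.add_two_le_len hC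
    exact h p n (by omega)
  · rintro ⟨hB, hG⟩ x y p n hn
    obtain ⟨F⟩ := CatGrading.GeneratedInLenOne.nonempty_factorization hC hG (p := p)
      (m := l.len p - 2) (by omega)
    refine hB p n (le_trans ?_ (le_iSup₂ (f := fun (m : ℕ)
      (_ : Nonempty ((factorizationSet hC p).simplex m)) => (m : WithBot ℕ∞)) (l.len p - 2)
      ⟨Quotient.mk _ F⟩))
    exact_mod_cast (by omega : n ≤ l.len p - 2)
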